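/- Fix a spacetime dimension $D$, a field of constants of characteristic $0$, finitely many fields $\Phi^A$ and a family (finite or infinite) of composite labels $I$, with given statistics $\varepsilon\in\mathbb Z/2$ and ghost numbers. The variables are $\Phi^A$, their sources $K_A$, the proper fields $N^I$ (partners of the composite fields) and their sources $H_I$; a source has statistics opposite to its partner, and their ghost numbers add up to $-1$. A \emph{local function} is a formal power series in a perturbative expansion parameter $\delta$ whose coefficients are differential polynomials, i.e. polynomials in the (super)commuting variables and their spacetime derivatives, with constant coefficients. A \emph{local functional} $\int f$ is a local function modulo total derivatives; equalities between local functionals are meant in this sense. With left and right functional derivatives $\delta_l,\delta_r$ put $$(X,Y)=\int\Big(\frac{\delta_rX}{\delta\Phi^A}\frac{\delta_lY}{\delta K_A}-\frac{\delta_rX}{\delta K_A}\frac{\delta_lY}{\delta\Phi^A}\Big),\qquad \lfloor X,Y\rfloor=(X,Y)+\int\Big(\frac{\delta_rX}{\delta N^I}\frac{\delta_lY}{\delta H_I}-\frac{\delta_rX}{\delta H_I}\frac{\delta_lY}{\delta N^I}\Big).$$ Let $S(\Phi,K)=\mathcal S(\Phi)-\int R^A(\Phi)K_A$ be a bosonic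 local functional of ghost number $0$ with $(S,S)=0$. Let $\mathcal O^I(\Phi)$ be local functions with the statistics and ghost number of $N^I$, such that only finitely many of them contribute to each order in $\delta$ (no condition for a finite family), and let $R_{\mathcal O}^I=\int R^A\,\delta_l\mathcal O^I/\delta\Phi^A$ and $\tilde N^I=N^I-\mathcal O^I(\Phi)$. Consider the proper action $$S_N=\mathcal S(\Phi)-\int\big(R^A(\Phi)K_A+R_{\mathcal O}^I(\Phi)H_I\big)+\frac12\int\tilde N^IA_{IJ}\tilde N^J+\int\sum_k\rho_k\,\mathcal N_k(\tilde N)\,\mathcal O_{\mathrm{inv},k}(\Phi).$$ Here $A_{IJ}$ is a matrix of constants, compatible with statistics and ghost numbers, graded symmetric ($A_{IJ}=(-1)^{\varepsilon_I\varepsilon_J}A_{JI}$) and invertible (for an infinite family: invertible on finitely supported vectors); the $\mathcal N_k$ are monomials of degree at least two in the $\tilde N^I$ and their derivatives; the $\mathcal O_{\mathrm{inv},k}(\Phi)$ are gauge-invariant local functions, $\int R^A\,\delta_l\mathcal O_{\mathrm{inv},k}/\delta\Phi^A=0$, such that $\mathcal N_k\mathcal O_{\mathrm{inv},k}$ is bosonic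 of ghost number $0$; and the $\rho_k$ are perturbative coefficients, i.e. power series in $\delta$ without constant term, finitely many of them contributing to each order. Fix a statistics and a ghost number $g$ (in particular: bosonic and $g=0$). Suppose that in the usual formalism every local functional $\chi(\Phi,K)$ of this statistics and ghost number with $(S,\chi)=0$ has the form $\chi=\mathcal G(\Phi)+(S,\chi')$ with local functionals $\mathcal G(\Phi)$ and $\chi'(\Phi,K)$. Then the most general local functional $\chi(\Phi,K,N,H)$ of this statistics and ghost number that solves $\lfloor S_N,\chi\rfloor=0$ has the form $$\chi=\omega(\Phi)+\lfloor S_N,\chi'\rfloor$$ with local functionals $\omega(\Phi)$ and $\chi'(\Phi,K,N,H)$, where $\lfloor S_N,\omega\rfloor=0$; conversely, every local functional $\chi$ of this statistics and ghost number that has such a form is a solution. -/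

import Mathlib

noncomputable section

namespace ProperFormalism

universe u v w x

/-- Degrees: statistics (`0` bosonic, `1` fermionic) and ghost number. -/
abbrev Deg : Type := ZMod 2 × ℤ

/-- The labels of the proper fields and sources: the fields `Φ`, their sources `K`, the proper
fields `N` (partners of the composite fields) and their sources `H`. -/
inductive Lab (F : Type v) (I : Type w) : Type (max v w)
  | Φ (a : F) : Lab F I
  | K (a : F) : Lab F I
  | N (i : I) : Lab F I
  | H (i : I) : Lab F I

/-- Statistics and ghost numbers of the fields and of the composite fields. -/
structure Content (F : Type v) (I : Type w) where
  field : F → Deg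
  composite : I → Deg

/-- A source has statistics opposite to its field, and the ghost numbers add up to `-1`. -/
def Content.deg {F : Type v} {I : Type w} (c : Content F I) : Lab F I → Deg
  | .Φ a => c.field a
  | .K a => (1, -1) - c.field a
  | .N i => c.composite i
  | .H i => (1, -1) - c.composite i

/-- The jet variable `(z, α)` is the derivative `∂^α z` in `D` spacetime dimensions. -/
abbrev Jet (D : ℕ) (F : Type v) (I : Type w) : Type (max v w) := Lab F I × (Fin D → ℕ)

/-- The sign `(-1)^(p q)`. -/
def sgn (𝕜 : Type u) [Field 𝕜] (p q : ZMod 2) : 𝕜 := (-1) ^ (p.val * q.val)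

/-- Supercommutation of the jet variables. -/
inductive Rel (𝕜 : Type u) [Field 𝕜] (D : ℕ) {F : Type v} {I : Type w} (c : Content F I) :
    FreeAlgebra 𝕜 (Jet D F I) → FreeAlgebra 𝕜 (Jet D F I) → Prop
  | swap (y z : Jet D F I) : Rel 𝕜 D c
      (FreeAlgebra.ι 𝕜 y * FreeAlgebra.ι 𝕜 z)
      (sgn 𝕜 (c.deg y.1).1 (c.deg z.1).1 • (FreeAlgebra.ι 𝕜 z * FreeAlgebra.ι 𝕜 y))

/-- Differential polynomials: the free supercommutative algebra on the jet variables. -/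
def JetAlg (𝕜 : Type u) [Field 𝕜] (D : ℕ) {F : Type v} {I : Type w} (c : Content F I) :
    Type (max u v w) :=
  RingQuot (Rel 𝕜 D c)

section Algebra

variable {𝕜 : Type u} [Field 𝕜] {D : ℕ} {F : Type v} {I : Type w} {c : Content F I}

instance : Ring (JetAlg 𝕜 D c) := inferInstanceAs (Ring (RingQuot (Rel 𝕜 D c)))

instance : Algebra 𝕜 (JetAlg 𝕜 D c) := inferInstanceAs (Algebra 𝕜 (RingQuot (Rel 𝕜 D c)))

/-- A jet variable as a differential polynomial. -/
def gen (y : Jet D F I) : JetAlg 𝕜 D c :=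
  RingQuot.mkAlgHom 𝕜 (Rel 𝕜 D c) (FreeAlgebra.ι 𝕜 y)

theorem gen_mul_gen (y z : Jet D F I) :
    (gen y * gen z : JetAlg 𝕜 D c) =
      sgn 𝕜 (c.deg y.1).1 (c.deg z.1).1 • (gen z * gen y) := by
  have h := RingQuot.mkAlgHom_rel 𝕜 (Rel.swap (𝕜 := 𝕜) (c := c) y z)
  rw [map_smul, map_mul, map_mul] at h
  exact h

/-- An algebra map out of `JetAlg` is given by supercommuting images of the jet variables. -/
def liftGen {B : Type x} [Ring B] [Algebra 𝕜 B] (f : Jet D F I → B)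
    (hf : ∀ y z, f y * f z = sgn 𝕜 (c.deg y.1).1 (c.deg z.1).1 • (f z * f y)) :
    JetAlg 𝕜 D c →ₐ[𝕜] B :=
  RingQuot.liftAlgHom 𝕜 ⟨FreeAlgebra.lift 𝕜 f, by
    intro a b h
    obtain ⟨y, z⟩ := h
    simpa using hf y z⟩

theorem sgn_mul_sgn (p q r : ZMod 2) : sgn 𝕜 p r * sgn 𝕜 q r = sgn 𝕜 (p + q) r := by
  rw [sgn, sgn, sgn, ← pow_add, neg_one_pow_eq_pow_mod_two,
    neg_one_pow_eq_pow_mod_two (n := (p + q).val * r.val)]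
  congr 1
  revert p q r
  decide

theorem sgn_comm (p q : ZMod 2) : sgn 𝕜 p q = sgn 𝕜 q p := by
  simp [sgn, mul_comm]

theorem sgn_self_mul (p q : ZMod 2) : sgn 𝕜 p q * sgn 𝕜 p q = 1 := by
  rw [sgn, ← mul_pow]; simp

/-- The values `f` supercommute with the jet variables as elements of statistics `p + |y|` do. -/
def Compatible (p : ZMod 2) (f : Jet D F I → JetAlg 𝕜 D c) : Prop :=
  ∀ y z, f y * gen z = sgn 𝕜 (p + (c.deg y.1).1) (c.deg z.1).1 • (gen z * f y)

theorem leftDer_aux {p : ZMod 2} {f : Jet D F I → JetAlg 𝕜 D c} (hf : Compatible p f)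
    (y z : Jet D F I) :
    sgn 𝕜 p (c.deg y.1).1 • (gen y * f z) + f y * gen z =
      sgn 𝕜 (c.deg y.1).1 (c.deg z.1).1 •
        (sgn 𝕜 p (c.deg z.1).1 • (gen z * f y) + f z * gen y) := by
  rw [hf y z, hf z y, smul_add, smul_smul, smul_smul, ← sgn_mul_sgn, ← sgn_mul_sgn,
    sgn_comm (c.deg z.1).1 (c.deg y.1).1]
  have h := sgn_self_mul (𝕜 := 𝕜) (c.deg y.1).1 (c.deg z.1).1
  rw [show sgn 𝕜 (c.deg y.1).1 (c.deg z.1).1 *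
      (sgn 𝕜 p (c.deg y.1).1 * sgn 𝕜 (c.deg y.1).1 (c.deg z.1).1) =
      sgn 𝕜 p (c.deg y.1).1 * (sgn 𝕜 (c.deg y.1).1 (c.deg z.1).1 *
        sgn 𝕜 (c.deg y.1).1 (c.deg z.1).1) by ring, h, mul_one, add_comm, mul_comm]

theorem rightDer_aux {p : ZMod 2} {f : Jet D F I → JetAlg 𝕜 D c} (hf : Compatible p f)
    (y z : Jet D F I) :
    gen y * f z + sgn 𝕜 p (c.deg z.1).1 • (f y * gen z) =
      sgn 𝕜 (c.deg y.1).1 (c.deg z.1).1 •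
        (gen z * f y + sgn 𝕜 p (c.deg y.1).1 • (f z * gen y)) := by
  rw [hf y z, hf z y, smul_add, smul_smul, smul_smul, smul_smul, ← sgn_mul_sgn, ← sgn_mul_sgn,
    sgn_comm (c.deg z.1).1 (c.deg y.1).1]
  have h := sgn_self_mul (𝕜 := 𝕜) (c.deg y.1).1 (c.deg z.1).1
  have h1 := sgn_self_mul (𝕜 := 𝕜) p (c.deg y.1).1
  have h2 := sgn_self_mul (𝕜 := 𝕜) p (c.deg z.1).1
  generalize sgn 𝕜 (c.deg y.1).1 (c.deg z.1).1 = k at h ⊢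
  generalize sgn 𝕜 p (c.deg y.1).1 = k1 at h1 ⊢
  generalize sgn 𝕜 p (c.deg z.1).1 = k2 at h2 ⊢
  rw [show k2 * (k2 * k) = k by rw [← mul_assoc, h2, one_mul],
    show k * k1 * (k1 * k) = 1 by rw [mul_assoc, ← mul_assoc k1, h1, one_mul, h], one_smul, add_comm]

/-- The left superderivation of statistics `p` with the values `f` on the jet variables:
`d (x y) = d x · y + (-1)^(p |x|) x · d y`. -/
def leftDer (p : ZMod 2) (f : Jet D F I → JetAlg 𝕜 D c) (hf : Compatible p f) :
    JetAlg 𝕜 D c →ₗ[𝕜] JetAlg 𝕜 D c :=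
  (Matrix.entryLinearMap 𝕜 (JetAlg 𝕜 D c) (0 : Fin 2) (1 : Fin 2)).comp
    (liftGen (c := c) (B := Matrix (Fin 2) (Fin 2) (JetAlg 𝕜 D c))
      (fun y => !![sgn 𝕜 p (c.deg y.1).1 • gen y, f y; 0, gen y]) (by
        intro y z
        have h := leftDer_aux hf y z
        ext i j
        fin_cases i <;> fin_cases j
        · simp [gen_mul_gen y z, smul_smul]
          congr 1
          ring
        · simpa using h
        · simp
        · simpa using gen_mul_gen y z)).toLinearMap

/-- The right superderivation of statistics `p` with the values `f` on the jet variables: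
`d (x y) = x · d y + (-1)^(p |y|) d x · y`. -/
def rightDer (p : ZMod 2) (f : Jet D F I → JetAlg 𝕜 D c) (hf : Compatible p f) :
    JetAlg 𝕜 D c →ₗ[𝕜] JetAlg 𝕜 D c :=
  (Matrix.entryLinearMap 𝕜 (JetAlg 𝕜 D c) (0 : Fin 2) (1 : Fin 2)).comp
    (liftGen (c := c) (B := Matrix (Fin 2) (Fin 2) (JetAlg 𝕜 D c))
      (fun y => !![gen y, f y; 0, sgn 𝕜 p (c.deg y.1).1 • gen y]) (by
        intro y z
        have h := rightDer_aux hf y z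
        ext i j
        fin_cases i <;> fin_cases j
        · simpa using gen_mul_gen y z
        · simpa using h
        · simp
        · simp [gen_mul_gen y z, smul_smul]
          congr 1
          ring)).toLinearMap

open Classical in
theorem compatible_single (y : Jet D F I) :
    Compatible (𝕜 := 𝕜) (c := c) (c.deg y.1).1 (fun z => if z = y then 1 else 0) := by
  intro z z'
  by_cases h : z = y
  · subst h
    simp [sgn, CharTwo.add_self_eq_zero]
  · simp [h]

/-- The left partial derivative with respect to a jet variable. -/
def pdL (y : Jet D F I) : JetAlg 𝕜 D c →ₗ[𝕜] JetAlg 𝕜 D c := by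
  classical
  exact leftDer (c.deg y.1).1 (fun z => if z = y then 1 else 0) (compatible_single y)

/-- The right partial derivative with respect to a jet variable. -/
def pdR (y : Jet D F I) : JetAlg 𝕜 D c →ₗ[𝕜] JetAlg 𝕜 D c := by
  classical
  exact rightDer (c.deg y.1).1 (fun z => if z = y then 1 else 0) (compatible_single y)

theorem compatible_shift (μ : Fin D) :
    Compatible (𝕜 := 𝕜) (F := F) (I := I) (c := c) 0
      (fun y => gen (y.1, y.2 + Pi.single μ 1)) := by
  intro y z
  simpa using gen_mul_gen (𝕜 := 𝕜) (c := c) (y.1, y.2 + Pi.single μ 1) z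

/-- The total derivative `∂_μ`: the derivation that maps `∂^α z` to `∂_μ ∂^α z`. -/
def totalD (μ : Fin D) : JetAlg 𝕜 D c →ₗ[𝕜] JetAlg 𝕜 D c :=
  leftDer 0 (fun y => gen (y.1, y.2 + Pi.single μ 1)) (compatible_shift μ)

/-- The iterated total derivative `∂^α`. -/
def multiD (α : Fin D → ℕ) : Module.End 𝕜 (JetAlg 𝕜 D c) :=
  (List.ofFn fun μ => (totalD μ : Module.End 𝕜 (JetAlg 𝕜 D c)) ^ α μ).prod

/-- The left functional derivative of `∫ f` with respect to `z`: `∑_α (-∂)^α (∂_l f / ∂(∂^α z))`.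
Only finitely many terms differ from zero. -/
def eulerL (z : Lab F I) (f : JetAlg 𝕜 D c) : JetAlg 𝕜 D c :=
  ∑ᶠ α : Fin D → ℕ, (-1 : 𝕜) ^ (∑ μ, α μ) • multiD α (pdL (z, α) f)

/-- The right functional derivative of `∫ f` with respect to `z`. -/
def eulerR (z : Lab F I) (f : JetAlg 𝕜 D c) : JetAlg 𝕜 D c :=
  ∑ᶠ α : Fin D → ℕ, (-1 : 𝕜) ^ (∑ μ, α μ) • multiD α (pdR (z, α) f)

variable (𝕜 D c) in
/-- Differential polynomials that are homogeneous of degree `d`. -/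
def homog (d : Deg) : Submodule 𝕜 (JetAlg 𝕜 D c) :=
  Submodule.span 𝕜 {f | ∃ l : List (Jet D F I),
    (l.map fun y => c.deg y.1).sum = d ∧ (l.map gen).prod = f}

variable (𝕜 D c) in
/-- Differential polynomials in the fields and sources that satisfy `p`. -/
def polyIn (p : Lab F I → Prop) : Subalgebra 𝕜 (JetAlg 𝕜 D c) :=
  Algebra.adjoin 𝕜 {f | ∃ y : Jet D F I, p y.1 ∧ gen y = f}

end Algebra

/-- Local functions of the proper fields and sources, in the sense of perturbation theory: formal
power series in the expansion parameter whose coefficients are differential polynomials.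
A local functional is the integral `∫ f` of a local function `f`; see `SameFunctional` for equality. -/
abbrev LocalFun (𝕜 : Type u) [Field 𝕜] (D : ℕ) {F : Type v} {I : Type w} (c : Content F I) :
    Type (max u v w) :=
  PowerSeries (JetAlg 𝕜 D c)

section Functionals

variable {𝕜 : Type u} [Field 𝕜] {D : ℕ} {F : Type v} {I : Type w} {c : Content F I}

/-- Apply an operation on differential polynomials order by order. -/
def orderwise (T : JetAlg 𝕜 D c → JetAlg 𝕜 D c) (f : LocalFun 𝕜 D c) : LocalFun 𝕜 D c :=
  PowerSeries.mk fun n => T (PowerSeries.coeff n f)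

/-- The sum of a family to each order of which only finitely many members contribute. -/
def formalSum {κ : Type x} (f : κ → LocalFun 𝕜 D c) : LocalFun 𝕜 D c :=
  PowerSeries.mk fun n => ∑ᶠ k, PowerSeries.coeff n (f k)

/-- A field or source (without derivatives) as a local function. -/
def var (z : Lab F I) : LocalFun 𝕜 D c := PowerSeries.C (gen (z, 0))

/-- A power series in the expansion parameter as a (constant) local function. -/
def const (r : PowerSeries 𝕜) : LocalFun 𝕜 D c :=
  PowerSeries.map (algebraMap 𝕜 (JetAlg 𝕜 D c)) r

/-- `f` has statistics and ghost number `d`. -/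
def HasDeg (d : Deg) (f : LocalFun 𝕜 D c) : Prop :=
  ∀ n, PowerSeries.coeff n f ∈ homog 𝕜 D c d

/-- `f` depends only on the fields and sources that satisfy `p`, and on their derivatives. -/
def DependsOnlyOn (p : Lab F I → Prop) (f : LocalFun 𝕜 D c) : Prop :=
  ∀ n, PowerSeries.coeff n f ∈ polyIn 𝕜 D c p

/-- The label is a field `Φ`. -/
def IsPhi : Lab F I → Prop
  | .Φ _ => True
  | _ => False

/-- The label is a field `Φ` or a source `K`. -/
def IsPhiOrK : Lab F I → Prop
  | .Φ _ => True
  | .K _ => True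
  | _ => False

/-- The local functionals `∫ f` and `∫ g` are equal: `f` and `g` differ by a total divergence. -/
def SameFunctional (f g : LocalFun 𝕜 D c) : Prop :=
  ∃ V : Fin D → LocalFun 𝕜 D c, f - g = ∑ μ, orderwise (totalD μ) (V μ)

/-- `δ_l / δz`. -/
def dL (z : Lab F I) (f : LocalFun 𝕜 D c) : LocalFun 𝕜 D c := orderwise (eulerL z) f

/-- `δ_r / δz`. -/
def dR (z : Lab F I) (f : LocalFun 𝕜 D c) : LocalFun 𝕜 D c := orderwise (eulerR z) f

/-- The (integrand of the) usual antiparentheses `(X, Y)`. -/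
def antiparen [Fintype F] (X Y : LocalFun 𝕜 D c) : LocalFun 𝕜 D c :=
  ∑ a : F, (dR (.Φ a) X * dL (.K a) Y - dR (.K a) X * dL (.Φ a) Y)

/-- The right functional derivative of a formal sum `X = ∑_k X_k` of local functionals, taken term
by term. -/
def dRSum {κ : Type x} (z : Lab F I) (X : κ → LocalFun 𝕜 D c) : LocalFun 𝕜 D c :=
  formalSum fun k => dR z (X k)

/-- The (integrand of the) squared antiparentheses `⌊X, Y⌋` of a formal sum `X = ∑_k X_k` of local
functionals and a local functional `Y`. -/
def sqAntiparen [Fintype F] {κ : Type x} (X : κ → LocalFun 𝕜 D c) (Y : LocalFun 𝕜 D c) :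
    LocalFun 𝕜 D c :=
  ∑ a : F, (dRSum (.Φ a) X * dL (.K a) Y - dRSum (.K a) X * dL (.Φ a) Y) +
    formalSum fun i : I => dRSum (.N i) X * dL (.H i) Y - dRSum (.H i) X * dL (.N i) Y

/-- The gauge transformation `∫ R^A δ_l O / δΦ^A` of a local function `O`:
the sum over `A` and `α` of `(∂^α R^A) (∂_l O / ∂(∂^α Φ^A))`. -/
def gaugeVar [Fintype F] (R : F → LocalFun 𝕜 D c) (O : LocalFun 𝕜 D c) : LocalFun 𝕜 D c :=
  ∑ a : F, formalSum fun α : Fin D → ℕ =>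
    orderwise (multiD α) (R a) * orderwise (pdL (.Φ a, α)) O

/-- The action `𝒮(Φ) - ∫ R^A(Φ) K_A`. -/
def linearAction [Fintype F] (S₀ : LocalFun 𝕜 D c) (R : F → LocalFun 𝕜 D c) : LocalFun 𝕜 D c :=
  S₀ - ∑ a : F, R a * var (.K a)

end Functionals

/-- A gauge theory in the usual formalism: an action `S(Φ, K) = 𝒮(Φ) - ∫ R^A(Φ) K_A` that solves
the master equation `(S, S) = 0`. -/
structure GaugeTheory (𝕜 : Type u) [Field 𝕜] (D : ℕ) {F : Type v} {I : Type w} [Fintype F]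
    (c : Content F I) where
  /-- The source-independent action. -/
  S₀ : LocalFun 𝕜 D c
  S₀_dependsOn : DependsOnlyOn IsPhi S₀
  S₀_deg : HasDeg 0 S₀
  /-- The transformations of the fields. -/
  R : F → LocalFun 𝕜 D c
  R_dependsOn : ∀ a, DependsOnlyOn IsPhi (R a)
  R_deg : ∀ a, HasDeg (c.field a + (1, 1)) (R a)
  master : SameFunctional (antiparen (linearAction S₀ R) (linearAction S₀ R)) 0

/-- The action `S(Φ, K)`. -/
def GaugeTheory.action {𝕜 : Type u} [Field 𝕜] {D : ℕ} {F : Type v} {I : Type w} [Fintype F]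
    {c : Content F I} (T : GaugeTheory 𝕜 D c) : LocalFun 𝕜 D c :=
  linearAction T.S₀ T.R

/-- The composite-field sector of a gauge theory. `J` labels the higher-order terms
`∫ ρ 𝒩(Ñ) O_inv(Φ)`. -/
structure CompositeSector {𝕜 : Type u} [Field 𝕜] {D : ℕ} {F : Type v} {I : Type w} [Fintype F]
    {c : Content F I} (T : GaugeTheory 𝕜 D c) (J : Type x) where
  /-- The composite fields. -/
  O : I → LocalFun 𝕜 D c
  O_dependsOn : ∀ i, DependsOnlyOn IsPhi (O i)
  O_deg : ∀ i, HasDeg (c.composite i) (O i)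
  /-- Finitely many composite fields contribute to each order of the perturbative expansion. -/
  O_finite : ∀ n, {i | PowerSeries.coeff n (O i) ≠ 0}.Finite
  /-- The invertible matrix of constants of the quadratic terms; its entries are `entry` below. -/
  A : (I →₀ 𝕜) ≃ₗ[𝕜] (I →₀ 𝕜)
  A_symm : ∀ i j, A (Finsupp.single j 1) i =
    sgn 𝕜 (c.composite i).1 (c.composite j).1 * A (Finsupp.single i 1) j
  A_deg : ∀ i j, A (Finsupp.single j 1) i ≠ 0 → c.composite i + c.composite j = 0
  /-- The coefficients of the higher-order terms, which are perturbative. -/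
  ρ : J → PowerSeries 𝕜
  ρ_zero : ∀ k, PowerSeries.coeff 0 (ρ k) = 0
  ρ_finite : ∀ n, {k | PowerSeries.coeff n (ρ k) ≠ 0}.Finite
  /-- The factors `∂^α Ñ^i` of the monomial `𝒩(Ñ)`, at least two. -/
  mon : J → List (I × (Fin D → ℕ))
  mon_length : ∀ k, 2 ≤ (mon k).length
  /-- The gauge-invariant composite fields. -/
  Oinv : J → LocalFun 𝕜 D c
  Oinv_dependsOn : ∀ k, DependsOnlyOn IsPhi (Oinv k)
  Oinv_deg : ∀ k, HasDeg (-((mon k).map fun q => c.composite q.1).sum) (Oinv k)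
  Oinv_invariant : ∀ k, gaugeVar T.R (Oinv k) = 0

namespace CompositeSector

variable {𝕜 : Type u} [Field 𝕜] {D : ℕ} {F : Type v} {I : Type w} [Fintype F]
  {c : Content F I} {T : GaugeTheory 𝕜 D c} {J : Type x} (P : CompositeSector T J)

/-- The matrix entry `A_ij`. -/
def entry (i j : I) : 𝕜 := P.A (Finsupp.single j 1) i

/-- `Ñ^i = N^i - O^i(Φ)`. -/
def tildeN (i : I) : LocalFun 𝕜 D c := var (.N i) - P.O i

/-- The monomial `𝒩(Ñ)`, a product of derivatives of the `Ñ^i`. -/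
def monomial (k : J) : LocalFun 𝕜 D c :=
  ((P.mon k).map fun q => orderwise (multiD q.2) (P.tildeN q.1)).prod

/-- The terms whose formal sum is the proper action
`S_N = 𝒮(Φ) - ∫ R^A(Φ) K_A - ∫ R_O^I(Φ) H_I + ½ ∫ Ñ^I A_IJ Ñ^J + ∫ ρ 𝒩(Ñ) O_inv(Φ)`. -/
def properAction : Unit ⊕ I ⊕ (I × I) ⊕ J → LocalFun 𝕜 D c
  | .inl _ => T.action
  | .inr (.inl i) => -(gaugeVar T.R (P.O i) * var (.H i))
  | .inr (.inr (.inl (i, j))) =>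
      (1 / 2 * P.entry i j : 𝕜) • (P.tildeN i * P.tildeN j)
  | .inr (.inr (.inr k)) => const (P.ρ k) * P.monomial k * P.Oinv k

end CompositeSector

end ProperFormalism

end

open ProperFormalism

noncomputable section

namespace ProperFormalism

universe u v w x

variable {𝕜 : Type u} [Field 𝕜] {D : ℕ} {F : Type v} {I : Type w} {c : Content F I}

/-! Integration by parts replaces the bracket with the proper action by a derivation: modulo total
divergences, `sqAntiparen P.properAction` is an odd evolutionary derivation Q of local functions,
`vf (ev (flow P.properAction))`, and Q commutes with total derivatives. The usual master equation
yields that the gauge transformation is nilpotent and leaves the source-independent action invariant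
up to a divergence (`GaugeTheory.gaugeVar_R`, `GaugeTheory.gaugeVar_S₀_mem_divs`). Since N
transforms like O, the Ñ are invariant, and therefore so is each source-independent term of the
proper action. These facts give Q² = 0 exactly, on local functions and not only on functionals
(`vf_sq_eq_zero`).

In the variables where Ñ takes the place of N, Q = Q₀ + V (`shiftedFlow_eq`). Here Q₀ acts on Φ and
K as in the usual formalism, kills N, and sends each H to a combination of the N with coefficients
from A. The interaction V sends K to the composite terms of the Φ equations and H to the terms with
the coefficients ρ; it vanishes at N = H = 0. The odd derivation that sends N to H through the
inverse of A has as its anticommutator with Q₀ the number operator of N and H (`homotopy`). Division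
by that number gives an operator h with Q₀h + hQ₀ = 1 - P, where P sets N = H = 0.

For the full Q this becomes Qh + hQ = 1 - P - E with E = -(Vh + hV). At order zero in the expansion
parameter the ρ terms drop out of V; what remains replaces a K by an expression free of K, while h
preserves the number of K. Hence E lowers that number at leading order and is nilpotent order by
order (`defect_nilpotent`), so 1 - E is inverted by a Neumann series. All these operators commute
with total derivatives, so the argument descends to functionals: a closed functional killed by P is
exact (`exists_sub_mem_divs`).

Finally, let χ be closed. Then Pχ is closed in the usual formalism, and the hypothesis writes it as
G + (S, χ₀) with G a functional of Φ. What is left of χ after removing G + Qχ₀ has, up to a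
divergence, a representative killed by P; it is closed because V kills functionals of Φ. Hence it is
exact (`exists_of_closed`). The converse, and the closedness of ω, follow from Q² = 0. -/

/-! ### Monomials, signs and the parity automorphism. -/

theorem liftGen_gen {B : Type x} [Ring B] [Algebra 𝕜 B] (f : Jet D F I → B)
    (hf : ∀ y z, f y * f z = sgn 𝕜 (c.deg y.1).1 (c.deg z.1).1 • (f z * f y)) (y : Jet D F I) :
    liftGen (𝕜 := 𝕜) (c := c) f hf (gen y) = f y := by
  unfold liftGen gen
  erw [RingQuot.liftAlgHom_mkAlgHom_apply]
  simp

/-- A subspace that contains `1` and is closed under left multiplication by jet variables is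
everything. -/
theorem eq_top_of_gen_mul (M : Submodule 𝕜 (JetAlg 𝕜 D c)) (h1 : 1 ∈ M)
    (h : ∀ y, ∀ b ∈ M, gen y * b ∈ M) : M = ⊤ := by
  let m : FreeAlgebra 𝕜 (Jet D F I) →ₐ[𝕜] JetAlg 𝕜 D c := RingQuot.mkAlgHom 𝕜 (Rel 𝕜 D c)
  have key : ∀ a : FreeAlgebra 𝕜 (Jet D F I), ∀ b ∈ M, m a * b ∈ M := by
    intro a
    induction a using FreeAlgebra.induction with
    | grade0 r =>
      intro b hb
      rw [AlgHom.commutes, ← Algebra.smul_def]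
      exact M.smul_mem _ hb
    | grade1 y => exact fun b hb => h y b hb
    | mul a a' ha ha' =>
      intro b hb
      rw [map_mul, mul_assoc]
      exact ha _ (ha' _ hb)
    | add a a' ha ha' =>
      intro b hb
      rw [map_add, add_mul]
      exact M.add_mem (ha _ hb) (ha' _ hb)
  rw [eq_top_iff]
  rintro b -
  obtain ⟨a, rfl⟩ := RingQuot.mkAlgHom_surjective 𝕜 (Rel 𝕜 D c) b
  have := key a 1 h1
  rwa [mul_one] at this

theorem jet_induction {p : JetAlg 𝕜 D c → Prop} (one : p 1) (gen_mul : ∀ y b, p b → p (gen y * b))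
    (add : ∀ a b, p a → p b → p (a + b)) (smul : ∀ (r : 𝕜) b, p b → p (r • b)) (b) : p b := by
  have h0 : p 0 := by simpa using smul 0 1 one
  let M : Submodule 𝕜 (JetAlg 𝕜 D c) :=
    { carrier := {b | p b}, add_mem' := fun ha hb => add _ _ ha hb, zero_mem' := h0,
      smul_mem' := fun r b hb => smul r b hb }
  have := eq_top_of_gen_mul M one gen_mul
  exact (this ▸ Submodule.mem_top : b ∈ M)

theorem span_monomials : Submodule.span 𝕜 (Set.range fun l : List (Jet D F I) =>
    ((l.map gen).prod : JetAlg 𝕜 D c)) = ⊤ := by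
  apply eq_top_of_gen_mul
  · exact Submodule.subset_span ⟨[], by simp⟩
  · intro y b hb
    induction hb using Submodule.span_induction with
    | mem b hb =>
      obtain ⟨l, rfl⟩ := hb
      exact Submodule.subset_span ⟨y :: l, by simp⟩
    | zero => simp
    | add a b _ _ ha hb => rw [mul_add]; exact Submodule.add_mem _ ha hb
    | smul r b _ hb => rw [mul_smul_comm]; exact Submodule.smul_mem _ _ hb

/-- Linear maps that agree on the monomials agree. -/
theorem linearMap_eq_of_monomials {M : Type x} [AddCommGroup M] [Module 𝕜 M]
    {S T : JetAlg 𝕜 D c →ₗ[𝕜] M} (h : ∀ l : List (Jet D F I), S (l.map gen).prod = T (l.map gen).prod) :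
    S = T := by
  apply LinearMap.ext_on span_monomials
  rintro _ ⟨l, rfl⟩
  exact h l

theorem sgn_mul_self (p q : ZMod 2) : sgn 𝕜 p q * sgn 𝕜 p q = 1 := sgn_self_mul p q

theorem sgn_add_left (p q r : ZMod 2) : sgn 𝕜 (p + q) r = sgn 𝕜 p r * sgn 𝕜 q r :=
  (sgn_mul_sgn p q r).symm

theorem sgn_add_right (p q r : ZMod 2) : sgn 𝕜 p (q + r) = sgn 𝕜 p q * sgn 𝕜 p r := by
  rw [sgn_comm, sgn_add_left, sgn_comm q, sgn_comm r]

@[simp] theorem sgn_zero_left (p : ZMod 2) : sgn 𝕜 0 p = 1 := by simp [sgn]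

@[simp] theorem sgn_zero_right (p : ZMod 2) : sgn 𝕜 p 0 = 1 := by simp [sgn]

theorem sgn_ne_zero (p q : ZMod 2) : sgn 𝕜 p q ≠ 0 := by
  intro h
  simpa [h] using sgn_mul_self (𝕜 := 𝕜) p q

theorem add_self_zmod_two (p : ZMod 2) : p + p = 0 := CharTwo.add_self_eq_zero p

/-- The parity automorphism `x ↦ (-1)^(p |x|) x`. -/
def par (p : ZMod 2) : JetAlg 𝕜 D c →ₐ[𝕜] JetAlg 𝕜 D c :=
  liftGen (fun y => sgn 𝕜 p (c.deg y.1).1 • gen y) (by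
    intro y z
    rw [smul_mul_smul_comm, smul_mul_smul_comm, gen_mul_gen y z, smul_smul, smul_smul]
    congr 1
    ring)

@[simp] theorem par_gen (p : ZMod 2) (y : Jet D F I) :
    par p (gen y : JetAlg 𝕜 D c) = sgn 𝕜 p (c.deg y.1).1 • gen y :=
  liftGen_gen _ _ _

theorem algHom_ext_gen {B : Type x} [Ring B] [Algebra 𝕜 B] {f g : JetAlg 𝕜 D c →ₐ[𝕜] B}
    (h : ∀ y, f (gen y) = g (gen y)) : f = g := by
  apply AlgHom.toLinearMap_injective
  apply linearMap_eq_of_monomials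
  intro l
  induction l with
  | nil => simp
  | cons y l ih => simp only [AlgHom.toLinearMap_apply, List.map_cons, List.prod_cons, map_mul] at ih ⊢
                   rw [h, ih]

theorem par_comp_par (p q : ZMod 2) :
    (par p).comp (par q) = (par (p + q) : JetAlg 𝕜 D c →ₐ[𝕜] JetAlg 𝕜 D c) := by
  apply algHom_ext_gen
  intro y
  simp [smul_smul, sgn_add_left, mul_comm]

theorem par_par (p q : ZMod 2) (b : JetAlg 𝕜 D c) : par p (par q b) = par (p + q) b :=
  DFunLike.congr_fun (par_comp_par p q) b

theorem par_zero : (par 0 : JetAlg 𝕜 D c →ₐ[𝕜] JetAlg 𝕜 D c) = AlgHom.id 𝕜 _ := by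
  apply algHom_ext_gen
  intro y
  simp

/-! ### Leibniz rules for left and right superderivations. -/

section Derivations

variable {p : ZMod 2} {f : Jet D F I → JetAlg 𝕜 D c} (hf : Compatible p f)

theorem leftDer_gen (y : Jet D F I) : leftDer p f hf (gen y) = f y := by
  simp [leftDer, liftGen_gen]

theorem leftDer_one : leftDer p f hf 1 = 0 := by
  simp [leftDer]

/-- `leftDer` is the upper right entry of an algebra map into upper triangular matrices with the
parity twist and the identity on the diagonal, so the Leibniz rule is matrix multiplication. What
has to be checked is that the lower right entry returns `b` itself. -/
theorem leftDer_gen_mul (y : Jet D F I) (b : JetAlg 𝕜 D c) :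
    leftDer p f hf (gen y * b) = f y * b + par p (gen y) * leftDer p f hf b := by
  suffices h : ∀ b, ∀ B : Matrix (Fin 2) (Fin 2) (JetAlg 𝕜 D c), B = liftGen (c := c)
      (B := Matrix (Fin 2) (Fin 2) (JetAlg 𝕜 D c))
      (fun y => !![sgn 𝕜 p (c.deg y.1).1 • gen y, f y; 0, gen y]) (by
        intro y z
        have h := leftDer_aux hf y z
        ext i j
        fin_cases i <;> fin_cases j
        · simp [gen_mul_gen y z, smul_smul]
          congr 1
          ring
        · simpa using h
        · simp
        · simpa using gen_mul_gen y z) b → B 1 1 = b by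
    simp [leftDer, liftGen_gen]
    simp [Matrix.vecMul, dotProduct, Fin.sum_univ_two, h b _ rfl, add_comm]
  intro b
  induction b using jet_induction with
  | one => simp
  | gen_mul y b hb =>
    rintro B rfl
    have := hb _ rfl
    simp [liftGen_gen, Matrix.mul_apply, this]
  | add a b ha hb => rintro B rfl; simp [ha _ rfl, hb _ rfl]
  | smul r b hb => rintro B rfl; simp [hb _ rfl]

theorem rightDer_one : rightDer p f hf 1 = 0 := by
  simp [rightDer]

theorem rightDer_gen_mul (y : Jet D F I) (b : JetAlg 𝕜 D c) :
    rightDer p f hf (gen y * b) = gen y * rightDer p f hf b + f y * par p b := by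
  suffices h : ∀ b, ∀ B : Matrix (Fin 2) (Fin 2) (JetAlg 𝕜 D c), B = liftGen (c := c)
      (B := Matrix (Fin 2) (Fin 2) (JetAlg 𝕜 D c))
      (fun y => !![gen y, f y; 0, sgn 𝕜 p (c.deg y.1).1 • gen y]) (by
        intro y z
        have h := rightDer_aux hf y z
        ext i j
        fin_cases i <;> fin_cases j
        · simpa using gen_mul_gen y z
        · simpa using h
        · simp
        · simp [gen_mul_gen y z, smul_smul]
          congr 1
          ring) b → B 1 1 = par p b by
    simp [rightDer, liftGen_gen]
    simp [Matrix.vecMul, dotProduct, Fin.sum_univ_two, h b _ rfl]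
  intro b
  induction b using jet_induction with
  | one => simp
  | gen_mul y b hb =>
    rintro B rfl
    have := hb _ rfl
    simp [liftGen_gen, Matrix.mul_apply, this]
  | add a b ha hb => rintro B rfl; simp [ha _ rfl, hb _ rfl]
  | smul r b hb => rintro B rfl; simp [hb _ rfl]

theorem leftDer_mul (a b : JetAlg 𝕜 D c) :
    leftDer p f hf (a * b) = leftDer p f hf a * b + par p a * leftDer p f hf b := by
  induction a using jet_induction with
  | one => simp [leftDer_one]
  | gen_mul y a ha =>
    rw [mul_assoc, leftDer_gen_mul, ha, leftDer_gen_mul, map_mul]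
    noncomm_ring
  | add a a' ha hb => simp only [add_mul, map_add, ha, hb]; abel
  | smul r a ha => simp only [smul_mul_assoc, map_smul, ha, smul_add]

end Derivations

/-- Two linear maps agree if both satisfy the same recursion on products with jet variables. -/
theorem eq_zero_of_gen_mul {M : Type x} [AddCommGroup M] [Module 𝕜 M] (T : JetAlg 𝕜 D c →ₗ[𝕜] M)
    (h1 : T 1 = 0) (h : ∀ y b, T b = 0 → T (gen y * b) = 0) : T = 0 := by
  rw [← LinearMap.ker_eq_top]
  exact eq_top_of_gen_mul _ h1 h

/-! ### Partial and total derivatives of differential polynomials. -/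

section PartialDerivatives

theorem totalD_gen (μ : Fin D) (z : Lab F I) (α : Fin D → ℕ) :
    totalD μ (gen (z, α) : JetAlg 𝕜 D c) = gen (z, α + Pi.single μ 1) := leftDer_gen _ _

theorem totalD_mul (μ : Fin D) (a b : JetAlg 𝕜 D c) :
    totalD μ (a * b) = totalD μ a * b + a * totalD μ b := by
  have := leftDer_mul (compatible_shift (𝕜 := 𝕜) (c := c) μ) a b
  rwa [par_zero] at this

open Classical in
theorem pdL_gen (y z : Jet D F I) : pdL y (gen z : JetAlg 𝕜 D c) = if z = y then 1 else 0 :=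
  leftDer_gen _ _

theorem pdL_mul (y : Jet D F I) (a b : JetAlg 𝕜 D c) :
    pdL y (a * b) = pdL y a * b + par (c.deg y.1).1 a * pdL y b :=
  leftDer_mul _ _ _

theorem pdL_one (y : Jet D F I) : pdL y (1 : JetAlg 𝕜 D c) = 0 := leftDer_one _

open Classical in
theorem pdR_gen_mul (y z : Jet D F I) (b : JetAlg 𝕜 D c) :
    pdR y (gen z * b) = gen z * pdR y b + (if z = y then 1 else 0) * par (c.deg y.1).1 b :=
  rightDer_gen_mul _ _ _

theorem pdR_one (y : Jet D F I) : pdR y (1 : JetAlg 𝕜 D c) = 0 := rightDer_one _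

/-- Trades right derivatives for left ones, so that only the calculus of left superderivations is
needed afterwards. Both sides obey the same recursion under multiplication by a jet variable. -/
theorem pdR_eq (y : Jet D F I) (b : JetAlg 𝕜 D c) :
    pdR y b = sgn 𝕜 (c.deg y.1).1 (c.deg y.1).1 • pdL y (par (c.deg y.1).1 b) := by
  induction b using jet_induction with
  | one => simp [pdR_one, pdL_one]
  | gen_mul z b hb =>
    rw [pdR_gen_mul, hb, map_mul, pdL_mul, par_gen, map_smul, pdL_gen, smul_mul_assoc,
      map_smul, par_gen]
    simp only [smul_mul_assoc, mul_smul_comm, smul_add, smul_smul, sgn_mul_self, mul_one]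
    by_cases h : z = y
    · subst h
      simp [sgn_mul_self, add_comm]
    · simp [h]
  | add a b ha hb => simp [ha, hb]
  | smul r b hb => rw [map_smul, map_smul, map_smul, hb, smul_comm]

theorem pdL_finite (b : JetAlg 𝕜 D c) : {y | pdL y b ≠ 0}.Finite := by
  induction b using jet_induction with
  | one => simp [pdL_one]
  | gen_mul z b hb =>
    refine (hb.union (Set.finite_singleton z)).subset ?_
    intro y hy
    by_contra hcon
    simp only [Set.mem_union, Set.mem_ofPred_eq, Set.mem_singleton_iff, not_or, not_not] at hcon
    apply hy
    rw [pdL_mul, hcon.1, pdL_gen, if_neg (Ne.symm hcon.2)]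
    simp
  | add a b ha hb =>
    refine (ha.union hb).subset ?_
    intro y hy
    by_contra hcon
    simp only [Set.mem_union, Set.mem_ofPred_eq, not_or, not_not] at hcon
    exact hy (by simp [hcon.1, hcon.2])
  | smul r b hb =>
    refine hb.subset ?_
    intro y hy h0
    exact hy (by simp [h0])

theorem pdL_par (r : ZMod 2) (y : Jet D F I) (b : JetAlg 𝕜 D c) :
    pdL y (par r b) = sgn 𝕜 r (c.deg y.1).1 • par r (pdL y b) := by
  induction b using jet_induction with
  | one => simp [pdL_one]
  | gen_mul z b hb =>
    rw [map_mul, pdL_mul, pdL_mul, hb, map_add, map_mul, map_mul, par_gen, map_smul, pdL_gen,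
      map_smul, par_gen, map_smul, par_gen]
    by_cases h : z = y
    · subst h
      simp only [if_true, map_one, one_mul, smul_mul_assoc, mul_smul_comm]
      module
    · simp only [if_neg h, smul_mul_assoc, mul_smul_comm, map_zero, zero_mul, smul_zero, zero_add]
      module
  | add a b ha hb => simp [ha, hb]
  | smul r b hb => simp only [map_smul, hb, smul_comm r]

theorem totalD_par (r : ZMod 2) (μ : Fin D) (b : JetAlg 𝕜 D c) :
    totalD μ (par r b) = par r (totalD μ b) := by
  induction b using jet_induction with
  | one => simp [totalD, leftDer_one]
  | gen_mul z b hb =>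
    obtain ⟨z, α⟩ := z
    simp only [map_mul, totalD_mul, hb, map_add, par_gen, map_smul, totalD_gen]
  | add a b ha hb => simp [ha, hb]
  | smul r b hb => simp [hb]

theorem totalD_comm (μ ν : Fin D) (b : JetAlg 𝕜 D c) :
    totalD μ (totalD ν b) = totalD ν (totalD μ b) := by
  induction b using jet_induction with
  | one => simp [totalD, leftDer_one]
  | gen_mul z b hb =>
    obtain ⟨z, α⟩ := z
    simp only [totalD_mul, map_add, totalD_gen, hb, add_right_comm α]
    abel
  | add a b ha hb => simp [ha, hb]
  | smul r b hb => simp [hb]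

-- A total derivative raises the multi-index of a jet variable by one, so the partial derivative at
-- α also detects the variable at α minus one step. The case distinction is essential: subtraction
-- of multi-indices truncates, and without it a spurious term would appear at α μ = 0.
open Classical in
theorem pdL_totalD (z : Lab F I) (α : Fin D → ℕ) (μ : Fin D) (b : JetAlg 𝕜 D c) :
    pdL (z, α) (totalD μ b) = totalD μ (pdL (z, α) b) +
      if α μ = 0 then 0 else pdL (z, α - Pi.single μ 1) b := by
  induction b using jet_induction with
  | one => simp [totalD, leftDer_one, pdL_one]
  | gen_mul y b hb =>
    obtain ⟨y, β⟩ := y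
    simp only [totalD_mul, map_add, pdL_mul, hb, totalD_gen, pdL_gen, par_gen, map_smul,
      smul_mul_assoc, mul_add, smul_add]
    by_cases h0 : α μ = 0
    · have h1 : ¬ ((y, β + Pi.single μ 1) = (z, α)) := by
        intro h
        have := congrFun (congrArg Prod.snd h) μ
        simp [h0] at this
      have h2 : totalD μ ((if (y, β) = (z, α) then 1 else 0 : JetAlg 𝕜 D c)) = 0 := by
        split_ifs <;> simp [totalD, leftDer_one]
      simp only [if_neg h1, if_pos h0, h2, zero_mul, mul_zero, smul_zero, zero_add, add_zero]
      abel
    · have h1 : ((y, β + Pi.single μ 1) = (z, α)) ↔ ((y, β) = (z, α - Pi.single μ 1)) := by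
        have hs : Pi.single μ 1 ≤ α := by
          intro ν
          by_cases h : ν = μ
          · subst h; simp; omega
          · simp [h]
        constructor
        · intro h
          obtain ⟨h1, h2⟩ := Prod.mk.inj h
          rw [h1, ← h2, add_tsub_cancel_right]
        · intro h
          obtain ⟨h1, h2⟩ := Prod.mk.inj h
          rw [h1, h2, tsub_add_cancel_of_le hs]
      have h2 : totalD μ ((if (y, β) = (z, α) then 1 else 0 : JetAlg 𝕜 D c)) = 0 := by
        split_ifs <;> simp [totalD, leftDer_one]
      simp only [h1, if_neg h0, h2, zero_mul, zero_add]
      abel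
  | add a b ha hb => simp only [map_add, ha, hb]; split_ifs <;> (try simp only [add_zero]) <;> abel
  | smul r b hb => simp only [map_smul, hb]; split_ifs <;> simp

/-- `multiD` is an ordered product of powers; since the factors commute, an additional one can be
pulled to the front. -/
theorem list_ofFn_prod_add_single {M : Type x} [Monoid M] {n : ℕ} (f : Fin n → M)
    (hf : ∀ i j, f i * f j = f j * f i) (α : Fin n → ℕ) (i : Fin n) :
    (List.ofFn fun j => f j ^ (α + Pi.single i 1 : Fin n → ℕ) j).prod =
      f i * (List.ofFn fun j => f j ^ α j).prod := by
  induction n with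
  | zero => exact i.elim0
  | succ n ih =>
    rw [List.ofFn_succ, List.ofFn_succ, List.prod_cons, List.prod_cons]
    refine Fin.cases ?_ (fun i => ?_) i
    · have h : ∀ j : Fin n, (α + Pi.single 0 1 : Fin (n + 1) → ℕ) j.succ = α j.succ := by
        intro j; simp
      simp only [h]
      rw [← mul_assoc]
      congr 1
      simp [pow_succ']
    · have h : ∀ j : Fin n, (α + Pi.single i.succ 1 : Fin (n + 1) → ℕ) j.succ =
          ((fun k => α (Fin.succ k)) + Pi.single i 1 : Fin n → ℕ) j := by
        intro j
        by_cases h : j = i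
        · subst h; simp
        · simp [h]
      simp only [h]
      rw [ih (fun j => f j.succ) (fun _ _ => hf _ _), ← mul_assoc, ← mul_assoc]
      congr 1
      have h0 : (α + Pi.single i.succ 1 : Fin (n + 1) → ℕ) 0 = α 0 := by simp
      rw [h0]
      exact (Commute.pow_left (hf _ _ : Commute (f 0) (f i.succ)) _).eq

theorem multiD_add_single (α : Fin D → ℕ) (μ : Fin D) (b : JetAlg 𝕜 D c) :
    multiD (α + Pi.single μ 1) b = totalD μ (multiD α b) := by
  have := list_ofFn_prod_add_single (M := Module.End 𝕜 (JetAlg 𝕜 D c)) (fun μ => totalD μ)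
    (fun μ ν => LinearMap.ext fun b => totalD_comm μ ν b) α μ
  exact DFunLike.congr_fun this b

theorem multiD_zero (b : JetAlg 𝕜 D c) : multiD 0 b = b := by
  have h : (List.ofFn fun _ : Fin D => (1 : Module.End 𝕜 (JetAlg 𝕜 D c))).prod = 1 := by simp
  simp [multiD]

theorem multiIndex_induction {p : (Fin D → ℕ) → Prop} (zero : p 0)
    (add_single : ∀ α μ, p α → p (α + Pi.single μ 1)) (α) : p α := by
  induction h : ∑ μ, α μ generalizing α with
  | zero =>
    have : α = 0 := by
      ext μ
      simpa using (Finset.sum_eq_zero_iff.1 h) μ (Finset.mem_univ μ)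
    rwa [this]
  | succ n ih =>
    obtain ⟨μ, hμ⟩ : ∃ μ, α μ ≠ 0 := by
      by_contra hcon
      push Not at hcon
      simp [hcon] at h
    have hs : Pi.single μ 1 ≤ α := by
      intro ν
      by_cases hν : ν = μ
      · subst hν; simp; omega
      · simp [hν]
    have hα : α - Pi.single μ 1 + Pi.single μ 1 = α := tsub_add_cancel_of_le hs
    rw [← hα]
    apply add_single
    apply ih
    have : ∑ ν, (α - Pi.single μ 1 + Pi.single μ 1 : Fin D → ℕ) ν = n + 1 := by rw [hα, h]
    simp only [Pi.add_apply, Finset.sum_add_distrib, Finset.sum_pi_single', Finset.mem_univ] at this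
    simpa using this

theorem gen_eq_multiD (z : Lab F I) (α : Fin D → ℕ) :
    (gen (z, α) : JetAlg 𝕜 D c) = multiD α (gen (z, 0)) := by
  induction α using multiIndex_induction with
  | zero => rw [multiD_zero]
  | add_single α μ ih => rw [multiD_add_single, ← ih, totalD_gen]

end PartialDerivatives

/-! ### Operators that are linear over the expansion parameter. -/

open PowerSeries in
/-- Linearity over the power series in the expansion parameter, for additive maps. -/
def XLin (T : LocalFun 𝕜 D c →ₗ[𝕜] LocalFun 𝕜 D c) : Prop := ∀ f, T (X * f) = X * T f

theorem exists_eq_C_add_X_mul (f : LocalFun 𝕜 D c) :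
    ∃ g, f = PowerSeries.C (PowerSeries.coeff 0 f) + PowerSeries.X * g := by
  refine ⟨PowerSeries.mk fun p => PowerSeries.coeff (p + 1) f, ?_⟩
  rw [add_comm]
  simpa using PowerSeries.eq_X_mul_shift_add_const f

/-- Local functions that start at order `n + 1`. -/
def VanishTo (n : ℕ) (f : LocalFun 𝕜 D c) : Prop := ∀ m ≤ n, PowerSeries.coeff m f = 0

theorem exists_eq_X_mul {f : LocalFun 𝕜 D c} (hf : PowerSeries.coeff 0 f = 0) :
    ∃ g, f = PowerSeries.X * g := by
  obtain ⟨g, hg⟩ := exists_eq_C_add_X_mul f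
  exact ⟨g, by rw [hg, hf]; simp⟩

namespace XLin

variable {S T : LocalFun 𝕜 D c →ₗ[𝕜] LocalFun 𝕜 D c}

theorem zero : XLin (0 : LocalFun 𝕜 D c →ₗ[𝕜] LocalFun 𝕜 D c) := fun f => by simp

theorem id : XLin (LinearMap.id : LocalFun 𝕜 D c →ₗ[𝕜] LocalFun 𝕜 D c) := fun _ => rfl

theorem add (hS : XLin S) (hT : XLin T) : XLin (S + T) := fun f => by
  simp [hS f, hT f, mul_add]

theorem sub (hS : XLin S) (hT : XLin T) : XLin (S - T) := fun f => by
  simp [hS f, hT f, mul_sub]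

theorem smul (r : 𝕜) (hT : XLin T) : XLin (r • T) := fun f => by
  simp [hT f]

theorem comp (hS : XLin S) (hT : XLin T) : XLin (S ∘ₗ T) := fun f => by
  simp [hS _, hT f]

theorem mulLeft (g : LocalFun 𝕜 D c) : XLin (LinearMap.mulLeft 𝕜 g) := fun f => by
  simp only [LinearMap.mulLeft_apply]
  rw [← mul_assoc, ← mul_assoc, PowerSeries.X_mul]

theorem mulRight (g : LocalFun 𝕜 D c) : XLin (LinearMap.mulRight 𝕜 g) := fun f => by
  simp [mul_assoc]

/-- Splitting off the constant term leaves `X * g`, on which the operator is `X * T g`, so the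
coefficients vanish by induction on the order. No continuity has to be assumed: it follows from
linearity over `X`. -/
theorem ext_C (hT : XLin T) (h : ∀ b, T (PowerSeries.C b) = 0) : T = 0 := by
  have key : ∀ n f, PowerSeries.coeff n (T f) = 0 := by
    intro n
    induction n with
    | zero =>
      intro f
      obtain ⟨g, hg⟩ := exists_eq_C_add_X_mul f
      rw [hg, map_add, h, hT]
      simp
    | succ n ih =>
      intro f
      obtain ⟨g, hg⟩ := exists_eq_C_add_X_mul f
      rw [hg, map_add, h, hT, zero_add, PowerSeries.coeff_succ_X_mul, ih]
  ext f n
  simp [key]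

/-- Linearity over `X` preserves the filtration by powers of `X`. This is what lets such operators
pass through infinite formal sums. -/
theorem vanishTo (hT : XLin T) {n : ℕ} {f : LocalFun 𝕜 D c} (hf : VanishTo n f) :
    VanishTo n (T f) := by
  induction n generalizing f with
  | zero =>
    intro m hm
    obtain ⟨g, rfl⟩ := exists_eq_X_mul (hf 0 le_rfl)
    obtain rfl : m = 0 := by omega
    rw [hT]
    simp
  | succ n ih =>
    obtain ⟨g, rfl⟩ := exists_eq_X_mul (hf 0 (Nat.zero_le _))
    have hg : VanishTo n g := fun m hm => by
      have := hf (m + 1) (by omega)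
      rwa [PowerSeries.coeff_succ_X_mul] at this
    intro m hm
    rw [hT]
    cases m with
    | zero => simp
    | succ m => rw [PowerSeries.coeff_succ_X_mul]; exact ih hg m (by omega)

end XLin

theorem VanishTo.mul_left {n : ℕ} {f : LocalFun 𝕜 D c} (hf : VanishTo n f) (g : LocalFun 𝕜 D c) :
    VanishTo n (g * f) := (XLin.mulLeft g).vanishTo hf

theorem VanishTo.mul_right {n : ℕ} {f : LocalFun 𝕜 D c} (hf : VanishTo n f) (g : LocalFun 𝕜 D c) :
    VanishTo n (f * g) := (XLin.mulRight g).vanishTo hf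

/-- Apply a linear map order by order. -/
def ow (T : JetAlg 𝕜 D c →ₗ[𝕜] JetAlg 𝕜 D c) : LocalFun 𝕜 D c →ₗ[𝕜] LocalFun 𝕜 D c where
  toFun := orderwise T
  map_add' f g := by ext n; simp [orderwise]
  map_smul' r f := by ext n; simp [orderwise]

@[simp] theorem coeff_ow (T : JetAlg 𝕜 D c →ₗ[𝕜] JetAlg 𝕜 D c) (f : LocalFun 𝕜 D c) (n : ℕ) :
    PowerSeries.coeff n (ow T f) = T (PowerSeries.coeff n f) := by
  simp [ow, orderwise]

@[simp] theorem ow_C (T : JetAlg 𝕜 D c →ₗ[𝕜] JetAlg 𝕜 D c) (b : JetAlg 𝕜 D c) :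
    ow T (PowerSeries.C b) = PowerSeries.C (T b) := by
  ext n
  rw [coeff_ow, PowerSeries.coeff_C, PowerSeries.coeff_C]
  split_ifs <;> simp

theorem XLin.ow (T : JetAlg 𝕜 D c →ₗ[𝕜] JetAlg 𝕜 D c) : XLin (ow T) := fun f => by
  ext n
  cases n with
  | zero => simp
  | succ n => simp [PowerSeries.coeff_succ_X_mul]

/-- The constant local functions embed linearly. -/
def CLin : JetAlg 𝕜 D c →ₗ[𝕜] LocalFun 𝕜 D c where
  toFun := PowerSeries.C
  map_add' := map_add _
  map_smul' r b := by
    ext n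
    rw [PowerSeries.coeff_C]
    simp only [RingHom.id_apply, LinearMap.map_smul_of_tower]
    erw [PowerSeries.coeff_C]
    split_ifs <;> simp

theorem C_smul (r : 𝕜) (b : JetAlg 𝕜 D c) :
    (PowerSeries.C (r • b) : LocalFun 𝕜 D c) = r • PowerSeries.C b :=
  (CLin (c := c)).map_smul r b

theorem XLin.ext_gen {T : LocalFun 𝕜 D c →ₗ[𝕜] LocalFun 𝕜 D c} (hT : XLin T) (h1 : T 1 = 0)
    (h : ∀ y f, T f = 0 → T (PowerSeries.C (gen y) * f) = 0) : T = 0 := by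
  apply hT.ext_C
  have : T ∘ₗ CLin = 0 := by
    apply eq_zero_of_gen_mul
    · simpa [CLin] using h1
    · intro y b hb
      have := h y (PowerSeries.C b) hb
      simpa [CLin] using this
  exact fun b => DFunLike.congr_fun this b

/-! ### Locally finite families and formal sums. -/

/-- A family of local functions to each order of which finitely many members contribute. -/
def LF {κ : Type x} (f : κ → LocalFun 𝕜 D c) : Prop :=
  ∀ n, {k | PowerSeries.coeff n (f k) ≠ 0}.Finite

section LocallyFinite

variable {κ : Type x} {f g : κ → LocalFun 𝕜 D c}

theorem coeff_formalSum (f : κ → LocalFun 𝕜 D c) (n : ℕ) :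
    PowerSeries.coeff n (formalSum f) = ∑ᶠ k, PowerSeries.coeff n (f k) := by
  simp [formalSum]

theorem LF.vanishTo (hf : LF f) (n : ℕ) : {k | ¬ VanishTo n (f k)}.Finite := by
  have : {k | ¬ VanishTo n (f k)} = ⋃ m ∈ Finset.range (n + 1), {k | PowerSeries.coeff m (f k) ≠ 0} := by
    ext k
    simp [VanishTo]
  rw [this]
  exact Set.Finite.biUnion (Finset.finite_toSet _) fun m _ => hf m

theorem LF.of_vanishTo (h : ∀ n, {k | ¬ VanishTo n (f k)}.Finite) : LF f := fun n =>
  (h n).subset fun _ hk h0 => hk (h0 n le_rfl)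

theorem LF.of_forall (hf : LF f) (h : ∀ n k, VanishTo n (f k) → VanishTo n (g k)) : LF g :=
  LF.of_vanishTo fun n => (hf.vanishTo n).subset fun k hk h0 => hk (h n k h0)

theorem LF.map (hf : LF f) {T : κ → LocalFun 𝕜 D c →ₗ[𝕜] LocalFun 𝕜 D c} (hT : ∀ k, XLin (T k)) :
    LF fun k => T k (f k) :=
  hf.of_forall fun _ k h => (hT k).vanishTo h

theorem LF.mul_left (hf : LF f) (g : κ → LocalFun 𝕜 D c) : LF fun k => g k * f k :=
  hf.of_forall fun _ k h => h.mul_left (g k)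

theorem LF.mul_right (hf : LF f) (g : κ → LocalFun 𝕜 D c) : LF fun k => f k * g k :=
  hf.of_forall fun _ k h => h.mul_right (g k)

theorem LF.smul (hf : LF f) (r : κ → 𝕜) : LF fun k => r k • f k :=
  hf.of_forall fun n k h m hm => by simp [h m hm]

theorem LF.neg (hf : LF f) : LF fun k => -f k :=
  hf.of_forall fun n k h m hm => by simp [h m hm]

theorem LF.add (hf : LF f) (hg : LF g) : LF fun k => f k + g k := fun n =>
  ((hf n).union (hg n)).subset fun k hk => by
    by_contra hcon
    simp only [Set.mem_union, Set.mem_ofPred_eq, not_or, not_not] at hcon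
    exact hk (by simp [hcon.1, hcon.2])

theorem LF.sub (hf : LF f) (hg : LF g) : LF fun k => f k - g k := fun n =>
  ((hf n).union (hg n)).subset fun k hk => by
    by_contra hcon
    simp only [Set.mem_union, Set.mem_ofPred_eq, not_or, not_not] at hcon
    exact hk (by simp [hcon.1, hcon.2])

theorem LF.of_finite [Finite κ] (f : κ → LocalFun 𝕜 D c) : LF f := fun _ => Set.toFinite _

theorem LF.of_support_finite (h : {k | f k ≠ 0}.Finite) : LF f := fun _ =>
  h.subset fun _ hk h0 => hk (by simp [h0])

theorem LF.zero : LF (fun _ : κ => (0 : LocalFun 𝕜 D c)) := fun n => by simp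

theorem LF.comp_injective {κ' : Type*} (hf : LF f) {e : κ' → κ} (he : Function.Injective e) :
    LF fun k => f (e k) := fun n => (hf n).preimage he.injOn

/-- Modulo higher orders a formal sum is a finite sum. -/
theorem LF.exists_finset (hf : LF f) (n : ℕ) :
    ∃ s : Finset κ, (∀ k ∉ s, VanishTo n (f k)) ∧ ∀ t : Finset κ, s ⊆ t →
      VanishTo n (formalSum f - ∑ k ∈ t, f k) := by
  refine ⟨(hf.vanishTo n).toFinset, fun k hk => ?_, fun t ht m hm => ?_⟩
  · simpa using hk
  · rw [map_sub, coeff_formalSum, map_sum, sub_eq_zero]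
    apply finsum_eq_finsetSum_of_support_subset
    intro k hk
    apply ht
    simp only [Set.Finite.mem_toFinset, Set.mem_ofPred_eq]
    exact fun h => hk (h m hm)

theorem formalSum_add (hf : LF f) (hg : LF g) :
    formalSum (fun k => f k + g k) = formalSum f + formalSum g := by
  ext n
  simp only [coeff_formalSum, map_add]
  exact finsum_add_distrib (hf n) (hg n)

theorem formalSum_sub (hf : LF f) (hg : LF g) :
    formalSum (fun k => f k - g k) = formalSum f - formalSum g := by
  ext n
  simp only [coeff_formalSum, map_sub]
  exact finsum_sub_distrib (hf n) (hg n)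

theorem formalSum_zero : formalSum (fun _ : κ => (0 : LocalFun 𝕜 D c)) = 0 := by
  ext n
  simp [coeff_formalSum]

theorem formalSum_fintype [Fintype κ] (f : κ → LocalFun 𝕜 D c) : formalSum f = ∑ k, f k := by
  ext n
  rw [coeff_formalSum, map_sum, finsum_eq_sum_of_fintype]

theorem formalSum_single (f : κ → LocalFun 𝕜 D c) (a : κ) (h : ∀ k, k ≠ a → f k = 0) :
    formalSum f = f a := by
  ext n
  rw [coeff_formalSum]
  exact finsum_eq_single _ a fun k hk => by simp [h k hk]

/-- Up to order n, both formal sums are finite sums over a common finite set, and the remainder of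
the first one starts beyond order n, where `T` keeps it. -/
theorem XLin.map_formalSum {T : LocalFun 𝕜 D c →ₗ[𝕜] LocalFun 𝕜 D c} (hT : XLin T) (hf : LF f) :
    T (formalSum f) = formalSum fun k => T (f k) := by
  ext n
  obtain ⟨s, -, hs⟩ := hf.exists_finset n
  obtain ⟨s', -, hs'⟩ := (hf.map (fun _ => hT)).exists_finset n
  classical
  have h1 := hT.vanishTo (hs (s ∪ s') Finset.subset_union_left) n le_rfl
  have h2 := hs' (s ∪ s') Finset.subset_union_right n le_rfl
  rw [map_sub, map_sub, sub_eq_zero] at h1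
  rw [map_sub, sub_eq_zero] at h2
  rw [h1, h2, map_sum]

theorem mul_formalSum (g : LocalFun 𝕜 D c) (hf : LF f) :
    g * formalSum f = formalSum fun k => g * f k :=
  (XLin.mulLeft g).map_formalSum hf

theorem formalSum_mul (g : LocalFun 𝕜 D c) (hf : LF f) :
    formalSum f * g = formalSum fun k => f k * g :=
  (XLin.mulRight g).map_formalSum hf

theorem smul_formalSum (r : 𝕜) (hf : LF f) : r • formalSum f = formalSum fun k => r • f k :=
  (XLin.id.smul r).map_formalSum hf

theorem VanishTo.formalSum {n : ℕ} (h : ∀ k, VanishTo n (f k)) : VanishTo n (formalSum f) := by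
  intro m hm
  rw [coeff_formalSum]
  exact finsum_eq_zero_of_forall_eq_zero fun k => h k m hm

theorem formalSum_equiv {κ' : Type*} (e : κ' ≃ κ) (f : κ → LocalFun 𝕜 D c) :
    formalSum (fun k => f (e k)) = formalSum f := by
  ext n
  rw [coeff_formalSum, coeff_formalSum]
  exact finsum_comp_equiv e (f := fun k => PowerSeries.coeff n (f k))

theorem formalSum_injective {κ' : Type*} {e : κ' → κ} (he : Function.Injective e)
    (f : κ → LocalFun 𝕜 D c) (h : ∀ k ∉ Set.range e, f k = 0) :
    formalSum f = formalSum (fun k => f (e k)) := by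
  ext n
  rw [coeff_formalSum, coeff_formalSum, ← finsum_mem_range (f := fun k => PowerSeries.coeff n (f k)) he]
  apply finsum_congr
  intro k
  by_cases hk : k ∈ Set.range e
  · simp [hk]
  · simp [hk, h k hk]

theorem formalSum_prod {κ' : Type*} {f : κ × κ' → LocalFun 𝕜 D c} (hf : LF f) :
    formalSum f = formalSum fun k => formalSum fun k' => f (k, k') := by
  ext n
  simp only [coeff_formalSum]
  exact finsum_curry (fun k => PowerSeries.coeff n (f k)) (hf n)

/-- The dominating family `g` leaves finitely many first indices at each order, and each of those
admits finitely many second indices. This justifies all later exchanges of double sums. -/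
theorem LF.prod {κ' : Type*} {f : κ × κ' → LocalFun 𝕜 D c} (g : κ → LocalFun 𝕜 D c) (hg : LF g)
    (h1 : ∀ n k k', VanishTo n (g k) → VanishTo n (f (k, k'))) (h2 : ∀ k, LF fun k' => f (k, k')) :
    LF f := by
  intro n
  refine ((hg.vanishTo n).biUnion (t := fun k => (fun k' => (k, k')) ''
    {k' | PowerSeries.coeff n (f (k, k')) ≠ 0}) fun k _ => ((h2 k) n).image _).subset ?_
  rintro ⟨k, k'⟩ hk
  simp only [Set.mem_iUnion]
  exact ⟨k, fun h => hk (h1 n k k' h n le_rfl), k', hk, rfl⟩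

theorem formalSum_comm {κ' : Type*} {f : κ → κ' → LocalFun 𝕜 D c}
    (hf : LF fun k : κ × κ' => f k.1 k.2) :
    (formalSum fun k => formalSum fun k' => f k k') =
      formalSum fun k' => formalSum fun k => f k k' := by
  rw [← formalSum_prod (f := fun k : κ × κ' => f k.1 k.2) hf,
    ← formalSum_prod (f := fun k : κ' × κ => f k.2 k.1) (hf.comp_injective Prod.swap_injective)]
  exact (formalSum_equiv (Equiv.prodComm κ' κ) fun k => f k.1 k.2).symm

theorem LF.sum {κ' : Type*} {f : κ ⊕ κ' → LocalFun 𝕜 D c} (h1 : LF fun k => f (.inl k))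
    (h2 : LF fun k => f (.inr k)) : LF f := by
  intro n
  refine (((h1 n).image Sum.inl).union ((h2 n).image Sum.inr)).subset ?_
  rintro (k | k) hk
  · exact Or.inl ⟨k, hk, rfl⟩
  · exact Or.inr ⟨k, hk, rfl⟩

theorem formalSum_sum {κ' : Type*} {f : κ ⊕ κ' → LocalFun 𝕜 D c} (hf : LF f) :
    formalSum f = (formalSum fun k => f (.inl k)) + formalSum fun k => f (.inr k) := by
  classical
  have e1 : formalSum f = formalSum (fun k => Sum.elim (fun a => f (.inl a)) (fun _ => 0) k +
      Sum.elim (fun _ => 0) (fun a => f (.inr a)) k) := by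
    congr 1
    ext1 k
    cases k <;> simp
  rw [e1, formalSum_add, formalSum_injective Sum.inl_injective, formalSum_injective Sum.inr_injective]
  · rfl
  · rintro (k | k) hk <;> simp at hk ⊢
  · rintro (k | k) hk <;> simp at hk ⊢
  · exact LF.sum (hf.comp_injective Sum.inl_injective) LF.zero
  · exact LF.sum LF.zero (hf.comp_injective Sum.inr_injective)

/-- The formal sum of a locally finite family of linear operators. -/
def opSum (T : κ → LocalFun 𝕜 D c →ₗ[𝕜] LocalFun 𝕜 D c) (h : ∀ f, LF fun k => T k f) :
    LocalFun 𝕜 D c →ₗ[𝕜] LocalFun 𝕜 D c where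
  toFun f := formalSum fun k => T k f
  map_add' f g := by simp only [map_add]; exact formalSum_add (h f) (h g)
  map_smul' r f := by simp only [map_smul]; exact (smul_formalSum r (h f)).symm

theorem XLin.opSum {T : κ → LocalFun 𝕜 D c →ₗ[𝕜] LocalFun 𝕜 D c} (h : ∀ f, LF fun k => T k f)
    (hT : ∀ k, XLin (T k)) : XLin (opSum T h) := fun f => by
  change formalSum _ = _ * formalSum _
  rw [mul_formalSum _ (h f)]
  congr 1
  ext1 k
  exact hT k f

end LocallyFinite

/-! ### The same calculus for local functions. -/

/-- The total derivative of local functions. -/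
def tD (μ : Fin D) : LocalFun 𝕜 D c →ₗ[𝕜] LocalFun 𝕜 D c := ow (totalD μ)

/-- The iterated total derivative of local functions. -/
def mD (α : Fin D → ℕ) : LocalFun 𝕜 D c →ₗ[𝕜] LocalFun 𝕜 D c := ow (multiD α)

/-- The left partial derivative of local functions. -/
def pd (y : Jet D F I) : LocalFun 𝕜 D c →ₗ[𝕜] LocalFun 𝕜 D c := ow (pdL y)

/-- The parity automorphism of local functions. -/
def pa (p : ZMod 2) : LocalFun 𝕜 D c →ₗ[𝕜] LocalFun 𝕜 D c := ow (par p).toLinearMap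

/-- A jet variable as a local function. -/
def jet (y : Jet D F I) : LocalFun 𝕜 D c := PowerSeries.C (gen y)

theorem XLin.tD (μ : Fin D) : XLin (tD μ : LocalFun 𝕜 D c →ₗ[𝕜] _) := XLin.ow _
theorem XLin.mD (α : Fin D → ℕ) : XLin (mD α : LocalFun 𝕜 D c →ₗ[𝕜] _) := XLin.ow _
theorem XLin.pd (y : Jet D F I) : XLin (pd y : LocalFun 𝕜 D c →ₗ[𝕜] _) := XLin.ow _
theorem XLin.pa (p : ZMod 2) : XLin (pa p : LocalFun 𝕜 D c →ₗ[𝕜] _) := XLin.ow _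

@[simp] theorem pa_mul (p : ZMod 2) (f g : LocalFun 𝕜 D c) : pa p (f * g) = pa p f * pa p g := by
  ext n
  simp [pa, PowerSeries.coeff_mul]

@[simp] theorem pa_one (p : ZMod 2) : pa p (1 : LocalFun 𝕜 D c) = 1 := by
  rw [← map_one PowerSeries.C, pa, ow_C]
  simp

theorem pa_pa (p q : ZMod 2) (f : LocalFun 𝕜 D c) : pa p (pa q f) = pa (p + q) f := by
  ext n
  simp [pa, par_par]

@[simp] theorem pa_zero (f : LocalFun 𝕜 D c) : pa 0 f = f := by
  ext n
  simp [pa, par_zero]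

@[simp] theorem pa_jet (p : ZMod 2) (y : Jet D F I) :
    pa p (jet y : LocalFun 𝕜 D c) = sgn 𝕜 p (c.deg y.1).1 • jet y := by
  simp [jet, pa, C_smul]

theorem tD_mul (μ : Fin D) (f g : LocalFun 𝕜 D c) : tD μ (f * g) = tD μ f * g + f * tD μ g := by
  ext n
  simp [tD, PowerSeries.coeff_mul, totalD_mul, Finset.sum_add_distrib]

theorem tD_one (μ : Fin D) : tD μ (1 : LocalFun 𝕜 D c) = 0 := by
  have := tD_mul μ (1 : LocalFun 𝕜 D c) 1
  simpa using this

theorem tD_jet (μ : Fin D) (z : Lab F I) (α : Fin D → ℕ) :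
    tD μ (jet (z, α) : LocalFun 𝕜 D c) = jet (z, α + Pi.single μ 1) := by
  simp [tD, jet, totalD_gen]

theorem tD_pa (r : ZMod 2) (μ : Fin D) (f : LocalFun 𝕜 D c) : tD μ (pa r f) = pa r (tD μ f) := by
  ext n
  simp [tD, pa, totalD_par]

theorem mD_zero (f : LocalFun 𝕜 D c) : mD 0 f = f := by
  ext n
  simp [mD, multiD_zero]

theorem mD_add_single (α : Fin D → ℕ) (μ : Fin D) (f : LocalFun 𝕜 D c) :
    mD (α + Pi.single μ 1) f = tD μ (mD α f) := by
  ext n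
  simp [mD, tD, multiD_add_single]

/-- An operator that commutes with total derivatives commutes with iterated ones. -/
theorem comm_mD {T : LocalFun 𝕜 D c →ₗ[𝕜] LocalFun 𝕜 D c} (h : ∀ μ f, T (tD μ f) = tD μ (T f))
    (α : Fin D → ℕ) (f : LocalFun 𝕜 D c) : T (mD α f) = mD α (T f) := by
  induction α using multiIndex_induction with
  | zero => simp [mD_zero]
  | add_single α μ ih => simp [mD_add_single, h, ih]

theorem tD_comm (μ ν : Fin D) (f : LocalFun 𝕜 D c) : tD μ (tD ν f) = tD ν (tD μ f) := by
  ext n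
  simp only [tD, coeff_ow]
  exact totalD_comm _ _ _

theorem tD_mD (μ : Fin D) (α : Fin D → ℕ) (f : LocalFun 𝕜 D c) :
    tD μ (mD α f) = mD α (tD μ f) := comm_mD (fun ν f => tD_comm μ ν f) α f

theorem jet_eq_mD (z : Lab F I) (α : Fin D → ℕ) :
    (jet (z, α) : LocalFun 𝕜 D c) = mD α (jet (z, 0)) := by
  rw [jet, jet, mD, ow_C, ← gen_eq_multiD]

theorem var_eq (z : Lab F I) : (var z : LocalFun 𝕜 D c) = jet (z, 0) := rfl

theorem pd_mul (y : Jet D F I) (f g : LocalFun 𝕜 D c) :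
    pd y (f * g) = pd y f * g + pa (c.deg y.1).1 f * pd y g := by
  ext n
  simp [pd, pa, PowerSeries.coeff_mul, pdL_mul, Finset.sum_add_distrib]

open Classical in
theorem pd_jet (y z : Jet D F I) : pd y (jet z : LocalFun 𝕜 D c) = if z = y then 1 else 0 := by
  rw [jet, pd, ow_C, pdL_gen]
  split_ifs <;> simp

theorem pd_jet_self (y : Jet D F I) : pd y (jet y : LocalFun 𝕜 D c) = 1 := by simp [pd_jet]

theorem pd_jet_of_ne {y z : Jet D F I} (h : z ≠ y) : pd y (jet z : LocalFun 𝕜 D c) = 0 := by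
  simp [pd_jet, h]

theorem pd_pa (r : ZMod 2) (y : Jet D F I) (f : LocalFun 𝕜 D c) :
    pd y (pa r f) = sgn 𝕜 r (c.deg y.1).1 • pa r (pd y f) := by
  ext n
  simp [pd, pa, pdL_par]

open Classical in
theorem pd_tD (z : Lab F I) (α : Fin D → ℕ) (μ : Fin D) (f : LocalFun 𝕜 D c) :
    pd (z, α) (tD μ f) = tD μ (pd (z, α) f) +
      if α μ = 0 then 0 else pd (z, α - Pi.single μ 1) f := by
  ext n
  by_cases h : α μ = 0 <;> simp [pd, tD, pdL_totalD, h]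

theorem LF.pd (f : LocalFun 𝕜 D c) : LF fun y : Jet D F I => ProperFormalism.pd y f := fun n =>
  (pdL_finite (PowerSeries.coeff n f)).subset fun y hy => by simpa [ProperFormalism.pd] using hy

/-! ### Superderivations of local functions and evolutionary vector fields. -/

section Derivations

/-- Left superderivations of statistics `p`. -/
def IsDer (p : ZMod 2) (T : LocalFun 𝕜 D c →ₗ[𝕜] LocalFun 𝕜 D c) : Prop :=
  ∀ f g, T (f * g) = T f * g + pa p f * T g

theorem IsDer.one {p : ZMod 2} {T : LocalFun 𝕜 D c →ₗ[𝕜] LocalFun 𝕜 D c} (hT : IsDer p T) :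
    T 1 = 0 := by
  have := hT 1 1
  simpa using this

theorem IsDer.sub {p : ZMod 2} {S T : LocalFun 𝕜 D c →ₗ[𝕜] LocalFun 𝕜 D c} (hS : IsDer p S)
    (hT : IsDer p T) : IsDer p (S - T) := fun f g => by
  simp only [LinearMap.sub_apply, hS f g, hT f g]
  noncomm_ring

theorem IsDer.pd (y : Jet D F I) : IsDer (c.deg y.1).1 (pd y : LocalFun 𝕜 D c →ₗ[𝕜] _) := pd_mul y

theorem IsDer.tD (μ : Fin D) : IsDer 0 (tD μ : LocalFun 𝕜 D c →ₗ[𝕜] _) := fun f g => by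
  rw [pa_zero, tD_mul]

theorem IsDer.eq_zero {p : ZMod 2} {T : LocalFun 𝕜 D c →ₗ[𝕜] LocalFun 𝕜 D c} (hT : IsDer p T)
    (hX : XLin T) (h : ∀ y, T (jet y) = 0) : T = 0 :=
  hX.ext_gen hT.one fun y f hf => by
    have := hT (jet y) f
    rw [h y, hf, zero_mul, mul_zero, add_zero] at this
    exact this

/-- Operators of statistics `p`. -/
def OpPar (p : ZMod 2) (T : LocalFun 𝕜 D c →ₗ[𝕜] LocalFun 𝕜 D c) : Prop :=
  ∀ r f, T (pa r f) = sgn 𝕜 r p • pa r (T f)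

theorem OpPar.pd (y : Jet D F I) : OpPar (c.deg y.1).1 (pd y : LocalFun 𝕜 D c →ₗ[𝕜] _) :=
  fun r f => pd_pa r y f

theorem OpPar.tD (μ : Fin D) : OpPar 0 (tD μ : LocalFun 𝕜 D c →ₗ[𝕜] _) := fun r f => by
  rw [tD_pa, sgn_zero_right, one_smul]

/-- The supercommutator of superderivations is a superderivation. -/
theorem IsDer.comm {p q : ZMod 2} {S T : LocalFun 𝕜 D c →ₗ[𝕜] LocalFun 𝕜 D c} (hS : IsDer p S)
    (hT : IsDer q T) (hS' : OpPar p S) (hT' : OpPar q T) :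
    IsDer (p + q) (S ∘ₗ T - sgn 𝕜 p q • (T ∘ₗ S)) := fun f g => by
  simp only [LinearMap.sub_apply, LinearMap.smul_apply, LinearMap.comp_apply, hS f g, hT f g,
    map_add, hS _ _, hT _ _, hS' q, hT' p, pa_pa, add_comm q p, sgn_comm q p,
    smul_mul_assoc, smul_add, smul_smul, sgn_mul_self, one_smul, sub_mul, mul_sub, mul_smul_comm]
  abel

/-- The superderivation with given values on the jet variables. -/
def vf (q : Jet D F I → LocalFun 𝕜 D c) : LocalFun 𝕜 D c →ₗ[𝕜] LocalFun 𝕜 D c :=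
  opSum (fun y => LinearMap.mulLeft 𝕜 (q y) ∘ₗ pd y) fun f => (LF.pd f).mul_left q

theorem vf_apply (q : Jet D F I → LocalFun 𝕜 D c) (f : LocalFun 𝕜 D c) :
    vf q f = formalSum fun y => q y * pd y f := rfl

theorem XLin.vf (q : Jet D F I → LocalFun 𝕜 D c) : XLin (vf q) :=
  XLin.opSum _ fun y => (XLin.mulLeft _).comp (XLin.pd y)

@[simp] theorem vf_jet (q : Jet D F I → LocalFun 𝕜 D c) (y : Jet D F I) : vf q (jet y) = q y := by
  rw [vf_apply, formalSum_single _ y, pd_jet_self, mul_one]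
  intro z hz
  rw [pd_jet_of_ne hz.symm, mul_zero]

/-- Local functions of statistics `p`. -/
def HasPar (p : ZMod 2) (f : LocalFun 𝕜 D c) : Prop := ∀ r, pa r f = sgn 𝕜 r p • f

theorem gen_mul_eq (y : Jet D F I) (b : JetAlg 𝕜 D c) :
    gen y * b = par (c.deg y.1).1 b * gen y := by
  induction b using jet_induction with
  | one => simp
  | gen_mul z b hb =>
    rw [← mul_assoc, gen_mul_gen y z, map_mul, par_gen, smul_mul_assoc, smul_mul_assoc,
      mul_assoc, hb, smul_mul_assoc, mul_assoc]
  | add a b ha hb => simp [mul_add, add_mul, ha, hb]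
  | smul r b hb => simp [hb]

theorem monomial_mul_eq (l : List (Jet D F I)) (b : JetAlg 𝕜 D c) :
    (l.map gen).prod * b = par (l.map fun y => (c.deg y.1).1).sum b * (l.map gen).prod := by
  induction l generalizing b with
  | nil => simp [par_zero]
  | cons y l ih =>
    simp only [List.map_cons, List.prod_cons, List.sum_cons]
    rw [mul_assoc, ih, ← mul_assoc, gen_mul_eq, par_par, mul_assoc]

theorem par_monomial (r : ZMod 2) (l : List (Jet D F I)) :
    par r ((l.map gen).prod : JetAlg 𝕜 D c) =
      sgn 𝕜 r (l.map fun y => (c.deg y.1).1).sum • (l.map gen).prod := by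
  induction l with
  | nil => simp
  | cons y l ih =>
    simp only [List.map_cons, List.prod_cons, List.sum_cons, map_mul, ih, par_gen,
      smul_mul_smul_comm, sgn_add_right]

theorem one_add_sgn {p q : ZMod 2} (h : p ≠ q) : 1 + sgn 𝕜 p 1 * sgn 𝕜 1 q = 0 := by
  revert h
  revert p q
  have : ∀ p q : ZMod 2, p ≠ q → (p.val * (1 : ZMod 2).val + (1 : ZMod 2).val * q.val) = 1 := by
    decide
  intro p q h
  rw [sgn, sgn, ← pow_add, this p q h]
  simp

/-- The operator `1 + sgn p 1 • par 1` doubles monomials of statistics `p` and kills the others, so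
it reduces the claim to monomials of the right statistics. It also doubles `a`, and the factor 2
cancels in characteristic zero. -/
theorem mul_eq_of_par [CharZero 𝕜] {p : ZMod 2} {a : JetAlg 𝕜 D c}
    (ha : par 1 a = sgn 𝕜 1 p • a) (b : JetAlg 𝕜 D c) : a * b = par p b * a := by
  have key : LinearMap.mulRight 𝕜 b ∘ₗ (LinearMap.id + sgn 𝕜 p 1 • (par 1).toLinearMap) =
      LinearMap.mulLeft 𝕜 (par p b) ∘ₗ (LinearMap.id + sgn 𝕜 p 1 • (par 1).toLinearMap) := by
    apply linearMap_eq_of_monomials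
    intro l
    have e : (LinearMap.id + sgn 𝕜 p 1 • (par 1).toLinearMap : JetAlg 𝕜 D c →ₗ[𝕜] JetAlg 𝕜 D c)
        (l.map gen).prod = (1 + sgn 𝕜 p 1 * sgn 𝕜 1 (l.map fun y => (c.deg y.1).1).sum) •
          (l.map gen).prod := by
      simp [par_monomial, add_smul, smul_smul]
    rw [LinearMap.comp_apply, LinearMap.comp_apply, e]
    by_cases h : p = (l.map fun y => (c.deg y.1).1).sum
    · simp only [LinearMap.mulRight_apply, LinearMap.mulLeft_apply, smul_mul_assoc, mul_smul_comm]
      rw [monomial_mul_eq, ← h]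
    · rw [one_add_sgn h]
      simp
  have := DFunLike.congr_fun key a
  simp only [LinearMap.comp_apply, LinearMap.add_apply, LinearMap.smul_apply, LinearMap.id_apply,
    AlgHom.toLinearMap_apply, ha, smul_smul, sgn_comm p 1, sgn_mul_self, one_smul,
    LinearMap.mulRight_apply, LinearMap.mulLeft_apply, ← two_smul 𝕜 a, smul_mul_assoc,
    mul_smul_comm] at this
  exact smul_right_injective _ (two_ne_zero (α := 𝕜)) this

namespace HasPar

variable {p q : ZMod 2} {f g : LocalFun 𝕜 D c}

theorem mul_comm [CharZero 𝕜] (hf : HasPar p f) (g : LocalFun 𝕜 D c) : f * g = pa p g * f := by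
  have h : LinearMap.mulLeft 𝕜 f - LinearMap.mulRight 𝕜 f ∘ₗ ProperFormalism.pa p = 0 := by
    apply XLin.ext_C
    · exact (XLin.mulLeft f).sub ((XLin.mulRight f).comp (XLin.pa p))
    · intro b
      ext n
      simp only [LinearMap.sub_apply, LinearMap.comp_apply, LinearMap.mulLeft_apply,
        LinearMap.mulRight_apply, ProperFormalism.pa, ow_C, map_sub, PowerSeries.coeff_mul_C,
        PowerSeries.coeff_C_mul, map_zero, AlgHom.toLinearMap_apply]
      rw [sub_eq_zero]
      apply mul_eq_of_par
      have := congrArg (PowerSeries.coeff n) (hf 1)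
      simpa [ProperFormalism.pa] using this
  have := DFunLike.congr_fun h g
  simpa [sub_eq_zero] using this

theorem mul (hf : HasPar p f) (hg : HasPar q g) : HasPar (p + q) (f * g) := fun r => by
  rw [pa_mul, hf r, hg r, smul_mul_smul_comm, sgn_add_right]

theorem one : HasPar 0 (1 : LocalFun 𝕜 D c) := fun r => by simp

theorem zero : HasPar p (0 : LocalFun 𝕜 D c) := fun r => by simp

theorem add (hf : HasPar p f) (hg : HasPar p g) : HasPar p (f + g) := fun r => by
  rw [map_add, hf r, hg r, smul_add]

theorem sub (hf : HasPar p f) (hg : HasPar p g) : HasPar p (f - g) := fun r => by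
  rw [map_sub, hf r, hg r, smul_sub]

theorem neg (hf : HasPar p f) : HasPar p (-f) := fun r => by
  rw [map_neg, hf r, smul_neg]

theorem smul (hf : HasPar p f) (a : 𝕜) : HasPar p (a • f) := fun r => by
  rw [map_smul, hf r, smul_comm]

theorem jet (y : Jet D F I) : HasPar (c.deg y.1).1 (jet y : LocalFun 𝕜 D c) := fun r => pa_jet r y

theorem apply_op {T : LocalFun 𝕜 D c →ₗ[𝕜] LocalFun 𝕜 D c} (hT : OpPar q T) (hf : HasPar p f) :
    HasPar (q + p) (T f) := fun r => by
  have h := hT r f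
  rw [hf r, map_smul] at h
  rw [sgn_add_right, mul_smul, h, smul_smul, sgn_mul_self, one_smul]

theorem mD (hf : HasPar p f) (α : Fin D → ℕ) : HasPar p (mD α f) := fun r => by
  rw [comm_mD (fun μ f => (tD_pa r μ f).symm), hf r, map_smul]

theorem formalSum {κ : Type x} {f : κ → LocalFun 𝕜 D c} (hf : LF f) (h : ∀ k, HasPar p (f k)) :
    HasPar p (formalSum f) := fun r => by
  rw [(XLin.pa r).map_formalSum hf, smul_formalSum _ hf]
  congr 1
  ext1 k
  exact h k r

end HasPar

theorem IsDer.vf [CharZero 𝕜] {p : ZMod 2} {q : Jet D F I → LocalFun 𝕜 D c}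
    (hq : ∀ y, HasPar (p + (c.deg y.1).1) (q y)) : IsDer p (vf q) := fun f g => by
  simp only [vf_apply]
  rw [formalSum_mul _ ((LF.pd f).mul_left q), mul_formalSum _ ((LF.pd g).mul_left q), ← formalSum_add]
  · congr 1
    ext1 y
    rw [pd_mul, mul_add, ← mul_assoc, ← mul_assoc, ← mul_assoc, (hq y).mul_comm (pa _ f), pa_pa, add_assoc,
      add_self_zmod_two, add_zero]
  · exact ((LF.pd f).mul_left q).mul_right _
  · exact ((LF.pd g).mul_left q).mul_left _

theorem OpPar.vf {p : ZMod 2} {q : Jet D F I → LocalFun 𝕜 D c}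
    (hq : ∀ y, HasPar (p + (c.deg y.1).1) (q y)) : OpPar p (vf q) := fun r f => by
  simp only [vf_apply]
  rw [(XLin.pa r).map_formalSum ((LF.pd f).mul_left q),
    smul_formalSum _ (((LF.pd f).mul_left q).map fun _ => XLin.pa r)]
  congr 1
  ext1 y
  rw [pd_pa, pa_mul, hq y r, mul_smul_comm, smul_mul_assoc, smul_smul, sgn_add_right, ← mul_assoc,
    sgn_mul_self, one_mul]

/-- The prolongation of a characteristic. -/
def ev (q : Lab F I → LocalFun 𝕜 D c) (y : Jet D F I) : LocalFun 𝕜 D c := mD y.2 (q y.1)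

theorem HasPar.ev {p : ZMod 2} {q : Lab F I → LocalFun 𝕜 D c}
    (hq : ∀ z, HasPar (p + (c.deg z).1) (q z)) (y : Jet D F I) :
    HasPar (p + (c.deg y.1).1) (ev q y) := (hq y.1).mD y.2

theorem ev_zero (q : Lab F I → LocalFun 𝕜 D c) (z : Lab F I) : ev q (z, 0) = q z := mD_zero _

theorem vf_ev_var (q : Lab F I → LocalFun 𝕜 D c) (z : Lab F I) : vf (ev q) (var z) = q z := by
  rw [var_eq, vf_jet, ev_zero]

/-- The supercommutator with a total derivative is a superderivation, and the prolongation formula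
makes it vanish on every jet variable. -/
theorem vf_ev_tD [CharZero 𝕜] {p : ZMod 2} {q : Lab F I → LocalFun 𝕜 D c}
    (hq : ∀ z, HasPar (p + (c.deg z).1) (q z)) (μ : Fin D) (f : LocalFun 𝕜 D c) :
    vf (ev q) (tD μ f) = tD μ (vf (ev q) f) := by
  have h := (IsDer.comm (IsDer.vf (HasPar.ev hq)) (IsDer.tD μ) (OpPar.vf (HasPar.ev hq))
    (OpPar.tD μ)).eq_zero (((XLin.vf _).comp (XLin.tD μ)).sub
      (((XLin.tD μ).comp (XLin.vf _)).smul _)) (by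
      rintro ⟨z, α⟩
      simp [tD_jet, ev, mD_add_single])
  have := DFunLike.congr_fun h f
  simpa [sub_eq_zero] using this

/-- Superderivations that commute with total derivatives are determined by their values on the
variables without derivatives. -/
theorem IsDer.eq_zero_of_var {p : ZMod 2} {T : LocalFun 𝕜 D c →ₗ[𝕜] LocalFun 𝕜 D c}
    (hT : IsDer p T) (hX : XLin T) (hD : ∀ μ f, T (ProperFormalism.tD μ f) = ProperFormalism.tD μ (T f))
    (h : ∀ z, T (var z) = 0) : T = 0 := by
  apply hT.eq_zero hX
  rintro ⟨z, α⟩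
  rw [jet_eq_mD, comm_mD hD, ← var_eq, h, map_zero]

/-- The supercommutator of the two derivations is again a superderivation; comparison on jet
variables identifies it as the field whose coefficients are the differentiated coefficients `q z`.
-/
theorem pd_vf [CharZero 𝕜] {p : ZMod 2} {q : Jet D F I → LocalFun 𝕜 D c}
    (hq : ∀ y, HasPar (p + (c.deg y.1).1) (q y)) (y : Jet D F I) (f : LocalFun 𝕜 D c) :
    pd y (vf q f) = sgn 𝕜 (c.deg y.1).1 p • vf q (pd y f) + vf (fun z => pd y (q z)) f := by
  have hq' : ∀ z : Jet D F I, HasPar ((c.deg y.1).1 + p + (c.deg z.1).1) (pd y (q z)) := fun z => by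
    rw [add_assoc]
    exact (hq z).apply_op (OpPar.pd y)
  have h := (((IsDer.pd y).comm (IsDer.vf hq) (OpPar.pd y) (OpPar.vf hq)).sub (IsDer.vf hq')).eq_zero
    ((((XLin.pd y).comp (XLin.vf _)).sub (((XLin.vf _).comp (XLin.pd y)).smul _)).sub (XLin.vf _)) (by
      intro z
      have : vf q (pd y (jet z)) = 0 := by
        rw [pd_jet]
        split_ifs
        · exact (IsDer.vf hq).one
        · simp
      simp [this])
  have := DFunLike.congr_fun h f
  simp only [LinearMap.sub_apply, LinearMap.smul_apply, LinearMap.comp_apply,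
    LinearMap.zero_apply, sub_eq_zero] at this
  rw [sub_eq_iff_eq_add] at this
  rw [this, add_comm]

end Derivations

/-! ### Functional derivatives and the variation of a transformed functional. -/

/-- The sign `(-1)^|α|`. -/
def sg (𝕜 : Type u) [Field 𝕜] {D : ℕ} (α : Fin D → ℕ) : 𝕜 := (-1) ^ (∑ μ, α μ)

theorem sg_zero : sg 𝕜 (0 : Fin D → ℕ) = 1 := by simp [sg]

theorem sg_add_single (α : Fin D → ℕ) (μ : Fin D) : sg 𝕜 (α + Pi.single μ 1) = -sg 𝕜 α := by
  simp [sg, Finset.sum_add_distrib, pow_succ]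

section Variation

/-- The sum `∑_α (-∂)^α ((∂_l f / ∂(∂^α z)) g)`. -/
def vpair (z : Lab F I) (f g : LocalFun 𝕜 D c) : LocalFun 𝕜 D c :=
  formalSum fun α : Fin D → ℕ => sg 𝕜 α • mD α (pd (z, α) f * g)

theorem LF.pd_index (z : Lab F I) (f : LocalFun 𝕜 D c) :
    LF fun α : Fin D → ℕ => ProperFormalism.pd (z, α) f :=
  (LF.pd f).comp_injective (e := fun α => (z, α)) fun _ _ h => (Prod.mk.inj h).2

theorem LF.vpair (z : Lab F I) (f g : LocalFun 𝕜 D c) :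
    LF fun α : Fin D → ℕ => sg 𝕜 α • ProperFormalism.mD α (ProperFormalism.pd (z, α) f * g) :=
  (((LF.pd_index z f).mul_right fun _ => g).map fun α => XLin.mD α).smul _

/-- `vpair` as a linear map in its first argument. -/
def vpairL (z : Lab F I) (g : LocalFun 𝕜 D c) : LocalFun 𝕜 D c →ₗ[𝕜] LocalFun 𝕜 D c :=
  opSum (fun α : Fin D → ℕ => sg 𝕜 α • (mD α ∘ₗ LinearMap.mulRight 𝕜 g ∘ₗ pd (z, α)))
    fun f => LF.vpair z f g

/-- `vpair` as a linear map in its second argument. -/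
def vpairR (z : Lab F I) (f : LocalFun 𝕜 D c) : LocalFun 𝕜 D c →ₗ[𝕜] LocalFun 𝕜 D c :=
  opSum (fun α : Fin D → ℕ => sg 𝕜 α • (mD α ∘ₗ LinearMap.mulLeft 𝕜 (pd (z, α) f)))
    fun g => LF.vpair z f g

theorem vpairL_apply (z : Lab F I) (f g : LocalFun 𝕜 D c) : vpairL z g f = vpair z f g := rfl

theorem vpairR_apply (z : Lab F I) (f g : LocalFun 𝕜 D c) : vpairR z f g = vpair z f g := rfl

theorem XLin.vpairL (z : Lab F I) (g : LocalFun 𝕜 D c) : XLin (vpairL z g) :=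
  XLin.opSum _ fun α => ((XLin.mD α).comp ((XLin.mulRight g).comp (XLin.pd _))).smul _

theorem XLin.vpairR (z : Lab F I) (f : LocalFun 𝕜 D c) : XLin (vpairR z f) :=
  XLin.opSum _ fun α => ((XLin.mD α).comp (XLin.mulLeft _)).smul _

theorem vpair_smul_left (z : Lab F I) (a : 𝕜) (f g : LocalFun 𝕜 D c) :
    vpair z (a • f) g = a • vpair z f g := map_smul (vpairL z g) a f

theorem vpair_smul_right (z : Lab F I) (a : 𝕜) (f g : LocalFun 𝕜 D c) :
    vpair z f (a • g) = a • vpair z f g := map_smul (vpairR z f) a g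

theorem vpair_sub_left (z : Lab F I) (f f' g : LocalFun 𝕜 D c) :
    vpair z (f - f') g = vpair z f g - vpair z f' g := map_sub (vpairL z g) f f'

theorem vpair_sub_right (z : Lab F I) (f g g' : LocalFun 𝕜 D c) :
    vpair z f (g - g') = vpair z f g - vpair z f g' := map_sub (vpairR z f) g g'

theorem vpair_zero_left (z : Lab F I) (g : LocalFun 𝕜 D c) : vpair z 0 g = 0 :=
  map_zero (vpairL z g)

theorem vpair_zero_right (z : Lab F I) (f : LocalFun 𝕜 D c) : vpair z f 0 = 0 :=
  map_zero (vpairR z f)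

/-- The index-lowering part of the commutator of `pd` with a total derivative, reindexed by one step
and with its sign flipped, is minus the total derivative of the products; the product rule leaves
the derivative on `g`. For `g = 1` this says that a divergence has zero functional derivative. -/
theorem vpair_tD (z : Lab F I) (μ : Fin D) (f g : LocalFun 𝕜 D c) :
    vpair z (tD μ f) g = -vpair z f (tD μ g) := by
  classical
  let A : (Fin D → ℕ) → LocalFun 𝕜 D c := fun α => sg 𝕜 α • mD α (tD μ (pd (z, α) f) * g)
  let B : (Fin D → ℕ) → LocalFun 𝕜 D c := fun α =>
    sg 𝕜 α • mD α ((if α μ = 0 then 0 else pd (z, α - Pi.single μ 1) f) * g)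
  let C : (Fin D → ℕ) → LocalFun 𝕜 D c := fun α => sg 𝕜 α • mD α (tD μ (pd (z, α) f * g))
  have hs : ∀ α : Fin D → ℕ, α + Pi.single μ 1 - Pi.single μ 1 = α := fun α =>
    add_tsub_cancel_right _ _
  have hA : LF A := (((LF.pd_index z f).map fun _ => XLin.tD μ).mul_right fun _ => g).map
    (fun α => XLin.mD α) |>.smul _
  have hC : LF C := ((((LF.pd_index z f).mul_right fun _ => g).map fun _ => XLin.tD μ).map
    fun α => XLin.mD α).smul _
  have hinj : Function.Injective fun α : Fin D → ℕ => α + Pi.single μ 1 :=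
    fun α β h => add_right_cancel h
  have hout : ∀ α ∉ Set.range (fun α : Fin D → ℕ => α + Pi.single μ 1), B α = 0 := by
    intro α hα
    have : α μ = 0 := by
      by_contra h0
      apply hα
      refine ⟨α - Pi.single μ 1, tsub_add_cancel_of_le (?_ : (Pi.single μ 1 : Fin D → ℕ) ≤ α)⟩
      intro ν
      by_cases hν : ν = μ
      · subst hν; simp; omega
      · simp [hν]
    simp [B, this]
  have hBC : ∀ α, B (α + Pi.single μ 1) = -C α := fun α => by
    simp [B, C, sg_add_single, mD_add_single, tD_mD]
  have hB : LF B := by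
    have : LF fun α : Fin D → ℕ => B (α + Pi.single μ 1) := by
      simp only [hBC]
      exact hC.neg
    intro n
    refine ((this n).image fun α => α + Pi.single μ 1).subset ?_
    intro α hα
    by_contra hcon
    apply hα
    by_cases h : α ∈ Set.range (fun α : Fin D → ℕ => α + Pi.single μ 1)
    · obtain ⟨β, rfl⟩ := h
      by_contra h0
      exact hcon ⟨β, h0, rfl⟩
    · simp [hout α h]
  have e1 : vpair z (tD μ f) g = formalSum A + formalSum B := by
    rw [← formalSum_add hA hB]
    unfold vpair
    congr 1
    ext1 α
    simp only [A, B, pd_tD, add_mul, map_add, smul_add]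
  have e2 : formalSum B = -formalSum C := by
    rw [formalSum_injective hinj B hout]
    simp only [hBC]
    have := (XLin.id.smul (-1 : 𝕜)).map_formalSum hC
    simpa using this.symm
  have e3 : vpair z f (tD μ g) = formalSum C - formalSum A := by
    rw [← formalSum_sub hC hA]
    unfold vpair
    congr 1
    ext1 α
    simp only [A, C, tD_mul, map_add, smul_add, add_sub_cancel_left]
  rw [e1, e2, e3]
  abel

theorem vpair_mD (z : Lab F I) (α : Fin D → ℕ) (f g : LocalFun 𝕜 D c) :
    vpair z (mD α f) g = vpair z f (sg 𝕜 α • mD α g) := by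
  induction α using multiIndex_induction generalizing g with
  | zero => simp [mD_zero, sg_zero]
  | add_single α μ ih =>
    rw [mD_add_single, vpair_tD, ih, mD_add_single, sg_add_single, ← tD_mD, neg_smul,
      ← vpairR_apply, ← vpairR_apply, ← map_neg]

theorem sgn_one_left (p : ZMod 2) : sgn 𝕜 1 p = sgn 𝕜 p p := by
  revert p
  have : ∀ p : ZMod 2, (1 : ZMod 2).val * p.val = p.val * p.val := by decide
  intro p
  rw [sgn, sgn, this]

/-- Variation of `Q f` for an odd evolutionary derivation `Q`. -/
theorem vpair_vf [CharZero 𝕜] {q : Lab F I → LocalFun 𝕜 D c}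
    (hq : ∀ z, HasPar (1 + (c.deg z).1) (q z)) (z : Lab F I) (f g : LocalFun 𝕜 D c) :
    vpair z (vf (ev q) f) g = sgn 𝕜 (c.deg z).1 1 • vf (ev q) (vpair z f g) -
      vpair z (pa 1 f) (vf (ev q) g) + formalSum fun w => vpair z (q w) (vpair w f g) := by
  have hder := IsDer.vf (HasPar.ev hq)
  let A : (Fin D → ℕ) → LocalFun 𝕜 D c := fun α => sg 𝕜 α • mD α (pd (z, α) f * g)
  let B : (Fin D → ℕ) → LocalFun 𝕜 D c := fun α => sg 𝕜 α • mD α (pd (z, α) (pa 1 f) * vf (ev q) g)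
  let C : (Fin D → ℕ) × Jet D F I → LocalFun 𝕜 D c := fun k =>
    sg 𝕜 k.1 • mD k.1 (pd (z, k.1) (ev q k.2) * (pd k.2 f * g))
  have hA : LF A := LF.vpair z f g
  have hB : LF B := LF.vpair z _ _
  have hC' : LF fun k : Jet D F I × (Fin D → ℕ) => C k.swap := by
    apply LF.prod (fun y => pd y f) (LF.pd f)
    · intro n y α h
      have h1 := (XLin.mD α).vanishTo ((h.mul_right g).mul_left (pd (z, α) (ev q y)))
      intro m hm
      simp only [C, Prod.swap_prod_mk, LinearMap.map_smul_of_tower, h1 m hm,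
        smul_zero]
    · intro y
      exact LF.vpair z (ev q y) (pd y f * g)
  have hC : LF C := by
    have := hC'.comp_injective (Prod.swap_injective (α := Fin D → ℕ) (β := Jet D F I))
    simpa using this
  -- The commutator of the partial derivative with Q produces Q applied to the partial derivative
  -- and the derivative of the characteristic. The Leibniz rule turns the former into `A`
  -- transformed by Q, minus `B`; the latter is the double sum `C`.
  have e1 : vpair z (vf (ev q) f) g = (sgn 𝕜 (c.deg z).1 1 • formalSum fun α => vf (ev q) (A α)) -
      formalSum B + formalSum fun α => formalSum fun y => C (α, y) := by
    rw [smul_formalSum _ (hA.map fun _ => XLin.vf _), ← formalSum_prod hC,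
      ← formalSum_sub ((hA.map fun _ => XLin.vf _).smul _) hB, formalSum_prod hC, ← formalSum_add
      (((hA.map fun _ => XLin.vf _).smul _).sub hB)]
    · unfold vpair
      congr 1
      ext1 α
      have e2 : (formalSum fun y => C (α, y)) = sg 𝕜 α • mD α (vf (fun y => pd (z, α) (ev q y)) f * g) := by
        rw [vf_apply, formalSum_mul _ ((LF.pd f).mul_left _), (XLin.mD α).map_formalSum
          (((LF.pd f).mul_left _).mul_right _), smul_formalSum _
          ((((LF.pd f).mul_left _).mul_right _).map fun _ => XLin.mD α)]
        simp only [C, mul_assoc]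
      have e3 : vf (ev q) (A α) = sg 𝕜 α • mD α (vf (ev q) (pd (z, α) f) * g +
          pa 1 (pd (z, α) f) * vf (ev q) g) := by
        simp only [A, map_smul]
        rw [comm_mD (vf_ev_tD hq), hder]
      rw [e2, e3, pd_vf (HasPar.ev hq)]
      simp only [B, pd_pa, add_mul, smul_mul_assoc, map_add, map_smul, smul_add,
        sgn_comm (𝕜 := 𝕜) 1 (c.deg z).1]
      module
    · intro n
      refine ((hC n).image Prod.fst).subset ?_
      intro α hα
      by_contra hcon
      apply hα
      rw [coeff_formalSum]
      apply finsum_eq_zero_of_forall_eq_zero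
      intro y
      by_contra h0
      exact hcon ⟨(α, y), h0, rfl⟩
  have hE : LF fun y : Jet D F I => vpair z (ev q y) (pd y f * g) :=
    ((LF.pd f).mul_right fun _ => g).map fun y => XLin.vpairR z (ev q y)
  -- Summing over the multi-index first makes `C` a sum of pairings with the prolonged
  -- characteristic; `vpair_mD` then moves the prolonging derivatives to the second argument, where
  -- they assemble the functional derivative of `f`.
  rw [e1, formalSum_comm (f := fun α y => C (α, y)) hC, ← (XLin.vf _).map_formalSum hA]
  congr 1
  change (formalSum fun y => vpair z (ev q y) (pd y f * g)) = _
  rw [formalSum_prod hE]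
  congr 1
  ext1 w
  rw [← vpairR_apply z (q w), vpair, (XLin.vpairR z (q w)).map_formalSum (LF.vpair w f g)]
  congr 1
  ext1 β
  rw [ev, vpair_mD]
  rfl

theorem dL_eq (z : Lab F I) (f : LocalFun 𝕜 D c) : dL z f = vpair z f 1 := by
  ext n
  simp only [dL, orderwise, eulerL, vpair, mul_one, coeff_formalSum, PowerSeries.coeff_mk]
  simp [mD, pd, sg]

theorem dR_eq (z : Lab F I) (f : LocalFun 𝕜 D c) :
    dR z f = sgn 𝕜 (c.deg z).1 (c.deg z).1 • vpair z (pa (c.deg z).1 f) 1 := by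
  rw [vpair, smul_formalSum _ (LF.vpair _ _ _)]
  ext n
  simp only [dR, orderwise, eulerR, mul_one, coeff_formalSum, PowerSeries.coeff_mk]
  apply finsum_congr
  intro α
  rw [pdR_eq, map_smul]
  simp only [LinearMap.map_smul_of_tower]
  rw [smul_comm]
  simp [mD, pd, pa, sg]

theorem vpair_mul (z : Lab F I) (f f' g : LocalFun 𝕜 D c) :
    vpair z (f * f') g = vpair z f (f' * g) +
      formalSum fun α : Fin D → ℕ => sg 𝕜 α • mD α (pa (c.deg z).1 f * (pd (z, α) f' * g)) := by
  unfold vpair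
  rw [← formalSum_add (LF.vpair _ _ _)]
  · congr 1
    ext1 α
    rw [pd_mul, add_mul, map_add, smul_add, mul_assoc, mul_assoc]
  · exact ((((LF.pd_index z f').mul_right _).mul_left _).map fun α => XLin.mD α).smul _

/-- `f` does not depend on `z`. -/
def IndepOf (z : Lab F I) (f : LocalFun 𝕜 D c) : Prop := ∀ α, pd (z, α) f = 0

theorem IndepOf.vpair {z : Lab F I} {f : LocalFun 𝕜 D c} (hf : IndepOf z f) (g : LocalFun 𝕜 D c) :
    vpair z f g = 0 := by
  simp [ProperFormalism.vpair, hf _, formalSum_zero]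

theorem vpair_mul_of_indep {z : Lab F I} {f' : LocalFun 𝕜 D c} (hf : IndepOf z f')
    (f g : LocalFun 𝕜 D c) : vpair z (f * f') g = vpair z f (f' * g) := by
  rw [vpair_mul]
  simp [hf _, formalSum_zero]

end Variation

/-! ### Total divergences and integration by parts. -/

section Divergences

variable (𝕜 D c) in
/-- Total divergences. -/
def divs : Submodule 𝕜 (LocalFun 𝕜 D c) where
  carrier := {f | ∃ V : Fin D → LocalFun 𝕜 D c, f = ∑ μ, tD μ (V μ)}
  add_mem' := by
    rintro _ _ ⟨V, rfl⟩ ⟨W, rfl⟩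
    exact ⟨V + W, by simp [Finset.sum_add_distrib]⟩
  zero_mem' := ⟨0, by simp⟩
  smul_mem' := by
    rintro r _ ⟨V, rfl⟩
    exact ⟨r • V, by simp [Finset.smul_sum]⟩

theorem sameFunctional_iff {f g : LocalFun 𝕜 D c} : SameFunctional f g ↔ f - g ∈ divs 𝕜 D c :=
  Iff.rfl

/-- The components of the current can be chosen independently at each order, so being a divergence
is a condition on each coefficient. -/
theorem mem_divs_iff {f : LocalFun 𝕜 D c} : f ∈ divs 𝕜 D c ↔
    ∀ n, ∃ v : Fin D → JetAlg 𝕜 D c, PowerSeries.coeff n f = ∑ μ, totalD μ (v μ) := by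
  constructor
  · rintro ⟨V, rfl⟩ n
    exact ⟨fun μ => PowerSeries.coeff n (V μ), by simp [tD]⟩
  · intro h
    choose v hv using h
    refine ⟨fun μ => PowerSeries.mk fun n => v n μ, ?_⟩
    ext n
    simp [tD, hv]

theorem formalSum_mem_divs {κ : Type x} {f : κ → LocalFun 𝕜 D c} (h : ∀ k, f k ∈ divs 𝕜 D c) :
    formalSum f ∈ divs 𝕜 D c := by
  rw [mem_divs_iff]
  intro n
  rw [coeff_formalSum]
  -- At an order where infinitely many terms contribute, `finsum` is zero, which is also a
  -- divergence; hence no local finiteness is required.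
  apply finsum_induction (p := fun b => ∃ v : Fin D → JetAlg 𝕜 D c, b = ∑ μ, totalD μ (v μ))
  · exact ⟨0, by simp⟩
  · rintro _ _ ⟨V, rfl⟩ ⟨W, rfl⟩
    exact ⟨V + W, by simp [Finset.sum_add_distrib]⟩
  · exact fun k => mem_divs_iff.1 (h k) n

theorem tD_mem_divs (μ : Fin D) (f : LocalFun 𝕜 D c) : tD μ f ∈ divs 𝕜 D c := by
  classical
  refine ⟨Pi.single μ f, ?_⟩
  rw [Finset.sum_eq_single μ]
  · simp
  · intro ν _ hν
    simp [hν]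
  · simp

theorem map_mem_divs {T : LocalFun 𝕜 D c →ₗ[𝕜] LocalFun 𝕜 D c} (hT : ∀ μ f, T (tD μ f) = tD μ (T f))
    {f : LocalFun 𝕜 D c} (hf : f ∈ divs 𝕜 D c) : T f ∈ divs 𝕜 D c := by
  obtain ⟨V, rfl⟩ := hf
  exact ⟨fun μ => T (V μ), by simp [hT]⟩

theorem vpair_one_of_mem_divs {f : LocalFun 𝕜 D c} (hf : f ∈ divs 𝕜 D c) (z : Lab F I) :
    vpair z f 1 = 0 := by
  obtain ⟨V, rfl⟩ := hf
  rw [← vpairL_apply, map_sum]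
  apply Finset.sum_eq_zero
  intro μ _
  rw [vpairL_apply, vpair_tD, tD_one, ← vpairR_apply, map_zero, neg_zero]

theorem mul_mD_sub_mem_divs (α : Fin D → ℕ) (f g : LocalFun 𝕜 D c) :
    f * (sg 𝕜 α • mD α g) - mD α f * g ∈ divs 𝕜 D c := by
  induction α using multiIndex_induction generalizing g with
  | zero => simp [mD_zero, sg_zero]
  | add_single α μ ih =>
    have h1 := ih (tD μ g)
    have h2 := tD_mem_divs μ (mD α f * g)
    have h3 := neg_mem (add_mem h1 h2)
    convert h3 using 1
    simp only [mD_add_single, sg_add_single, tD_mul, tD_mD, neg_smul, mul_neg]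
    abel

/-- Integration by parts: the pairing of a characteristic with the functional derivatives. -/
theorem formalSum_mul_dL_sub_mem_divs (q : Lab F I → LocalFun 𝕜 D c) (f : LocalFun 𝕜 D c) :
    (formalSum fun z => q z * dL z f) - vf (ev q) f ∈ divs 𝕜 D c := by
  have h1 : LF fun y : Jet D F I => q y.1 * (sg 𝕜 y.2 • mD y.2 (pd y f)) :=
    (((LF.pd f).map fun y => XLin.mD y.2).smul _).mul_left _
  have h2 : LF fun y : Jet D F I => ev q y * pd y f := (LF.pd f).mul_left _
  have e : (formalSum fun z => q z * dL z f) =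
      formalSum fun y : Jet D F I => q y.1 * (sg 𝕜 y.2 • mD y.2 (pd y f)) := by
    rw [formalSum_prod h1]
    congr 1
    ext1 z
    rw [dL_eq, vpair, mul_formalSum _ (LF.vpair _ _ _)]
    simp
  rw [e, vf_apply, ← formalSum_sub h1 h2]
  exact formalSum_mem_divs fun y => mul_mD_sub_mem_divs _ _ _

theorem LF.dL (f : LocalFun 𝕜 D c) : LF fun z : Lab F I => ProperFormalism.dL z f := by
  have h : LF fun y : Jet D F I => sg 𝕜 y.2 • ProperFormalism.mD y.2 (ProperFormalism.pd y f * 1) :=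
    (((LF.pd f).mul_right _).map fun y => XLin.mD y.2).smul _
  intro n
  refine ((h n).image Prod.fst).subset ?_
  intro z hz
  by_contra hcon
  apply hz
  change PowerSeries.coeff n (ProperFormalism.dL z f) = 0
  rw [dL_eq, ProperFormalism.vpair, coeff_formalSum]
  apply finsum_eq_zero_of_forall_eq_zero
  intro α
  by_contra h0
  exact hcon ⟨(z, α), h0, rfl⟩

end Divergences

/-! ### Nilpotency of the flow of an action that is linear in the sources. -/

/-- The labels of the fields `Φ` and `N`. -/
def fld : F ⊕ I → Lab F I
  | .inl a => .Φ a
  | .inr i => .N i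

/-- The labels of the sources `K` and `H`. -/
def src : F ⊕ I → Lab F I
  | .inl a => .K a
  | .inr i => .H i

theorem fld_injective : Function.Injective (fld : F ⊕ I → Lab F I) := by
  rintro (a | a) (b | b) h <;> simp_all [fld]

theorem src_injective : Function.Injective (src : F ⊕ I → Lab F I) := by
  rintro (a | a) (b | b) h <;> simp_all [src]

theorem fld_ne_src (u v : F ⊕ I) : fld u ≠ src v := by
  rcases u with a | a <;> rcases v with b | b <;> simp [fld, src]

theorem exists_fld_or_src (z : Lab F I) : (∃ u, z = fld u) ∨ ∃ u, z = src u := by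
  cases z with
  | Φ a => exact Or.inl ⟨.inl a, rfl⟩
  | K a => exact Or.inr ⟨.inl a, rfl⟩
  | N a => exact Or.inl ⟨.inr a, rfl⟩
  | H a => exact Or.inr ⟨.inr a, rfl⟩

theorem deg_src (u : F ⊕ I) : (c.deg (src u)).1 = 1 + (c.deg (fld u)).1 := by
  rcases u with a | a <;> simp [fld, src, Content.deg, CharTwo.sub_eq_add]

theorem formalSum_lab (f : Lab F I → LocalFun 𝕜 D c) (h : ∀ u, f (src u) = 0) :
    formalSum f = formalSum fun u => f (fld u) := by
  apply formalSum_injective fld_injective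
  intro z hz
  rcases exists_fld_or_src z with ⟨u, rfl⟩ | ⟨u, rfl⟩
  · exact absurd ⟨u, rfl⟩ hz
  · exact h u

theorem sgn_one_one : sgn 𝕜 1 1 = -1 := by
  have : (1 : ZMod 2).val = 1 := by decide
  simp [sgn, this]

/-- An odd superderivation that squares to zero on the variables squares to zero. -/
theorem sq_eq_zero_of_var [CharZero 𝕜] {q : Lab F I → LocalFun 𝕜 D c}
    (hq : ∀ z, HasPar (1 + (c.deg z).1) (q z)) (h : ∀ z, vf (ev q) (q z) = 0)
    (f : LocalFun 𝕜 D c) : vf (ev q) (vf (ev q) f) = 0 := by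
  have hd := IsDer.vf (HasPar.ev hq)
  have hp := OpPar.vf (HasPar.ev hq)
  have hX := XLin.vf (ev q)
  -- For an odd derivation the supercommutator with itself is twice its square, and it is a
  -- derivation; so the square is determined by its values on the variables.
  have key := (hd.comm hd hp hp).eq_zero_of_var ((hX.comp hX).sub ((hX.comp hX).smul _)) (by
    intro μ f
    simp [vf_ev_tD hq]) (by
    intro z
    simp [vf_ev_var, h])
  have := DFunLike.congr_fun key f
  rw [LinearMap.sub_apply, LinearMap.smul_apply, sgn_one_one, neg_one_smul, sub_neg_eq_add,
    ← two_smul 𝕜] at this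
  simpa using this

/-- The antifield equations of motion square to zero for an action `∑ B_l - ∑ r_u u*` whose
transformations `r` are nilpotent and leave the `∫ B_l` invariant. -/
theorem vf_sq_eq_zero [CharZero 𝕜] {Λ : Type x} {q : Lab F I → LocalFun 𝕜 D c}
    {r : F ⊕ I → LocalFun 𝕜 D c} {B : Λ → LocalFun 𝕜 D c}
    (hq : ∀ z, HasPar (1 + (c.deg z).1) (q z)) (hqf : ∀ u, q (fld u) = r u)
    (hqs : ∀ u, q (src u) = sgn 𝕜 (c.deg (fld u)).1 (c.deg (fld u)).1 •
      ((formalSum fun l => vpair (fld u) (B l) 1) -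
        formalSum fun v => vpair (fld u) (r v) (var (src v))))
    (hr : ∀ u v, IndepOf (src u) (r v)) (hB : ∀ u l, IndepOf (src u) (B l)) (hrLF : LF r)
    (hBLF : ∀ u, LF fun l => vpair (fld u) (B l) 1)
    (hQr : ∀ u, vf (ev q) (r u) = 0) (hQB : ∀ u l, vpair (fld u) (vf (ev q) (B l)) 1 = 0)
    (f : LocalFun 𝕜 D c) : vf (ev q) (vf (ev q) f) = 0 := by
  apply sq_eq_zero_of_var hq
  intro z
  rcases exists_fld_or_src z with ⟨w, rfl⟩ | ⟨w, rfl⟩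
  · rw [hqf, hQr]
  let b : F ⊕ I → LocalFun 𝕜 D c := fun u => formalSum fun l => vpair (fld u) (B l) 1
  let ψ : F ⊕ I → LocalFun 𝕜 D c := fun u => formalSum fun v => vpair (fld u) (r v) (var (src v))
  let s : 𝕜 := sgn 𝕜 (c.deg (fld w)).1 1
  have hψLF : ∀ u, LF fun v => vpair (fld u) (r v) (var (src v)) := fun u =>
    hrLF.map fun v => XLin.vpairL (fld u) (var (src v))
  have hrg : ∀ g : F ⊕ I → LocalFun 𝕜 D c, LF fun v => vpair (fld w) (r v) (g v) := fun g =>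
    hrLF.map fun v => XLin.vpairL (fld w) (g v)
  -- This is the functional derivative of the invariance of the term `B l`: the variation of `vf (ev
  -- q) (B l)` vanishes, and `vpair_vf` expresses how the equation of motion of that term
  -- transforms.
  have h1 : ∀ l, s • vf (ev q) (vpair (fld w) (B l) 1) =
      (-1 : 𝕜) • formalSum fun v => vpair (fld w) (r v) (vpair (fld v) (B l) 1) := by
    intro l
    have h := vpair_vf hq (fld w) (B l) 1
    rw [hQB, (IsDer.vf (HasPar.ev hq)).one, vpair_zero_right, sub_zero,
      formalSum_lab] at h
    · simp only [hqf] at h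
      rw [neg_one_smul]
      exact eq_neg_of_add_eq_zero_left h.symm
    · intro u
      rw [(hB u l).vpair, vpair_zero_right]
  have h2 : s • vf (ev q) (b w) = (-1 : 𝕜) • formalSum fun v => vpair (fld w) (r v) (b v) := by
    rw [(XLin.vf _).map_formalSum (hBLF w), smul_formalSum _ ((hBLF w).map fun _ => XLin.vf _)]
    simp only [h1]
    have hLF : LF fun k : (F ⊕ I) × Λ => vpair (fld w) (r k.1) (vpair (fld k.1) (B k.2) 1) :=
      LF.prod r hrLF (fun n v l h => (XLin.vpairL _ _).vanishTo h)
        fun v => (hBLF v).map fun l => XLin.vpairR (fld w) (r v)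
    rw [← smul_formalSum]
    · congr 1
      rw [← formalSum_comm (f := fun v l => vpair (fld w) (r v) (vpair (fld v) (B l) 1)) hLF]
      congr 1
      ext1 v
      exact ((XLin.vpairR (fld w) (r v)).map_formalSum (hBLF v)).symm
    · have := ((hBLF w).map fun _ => XLin.vf (ev q)).smul fun _ => s
      simp only [h1] at this
      have := this.smul fun _ => (-1 : 𝕜)
      simpa using this
  -- The functional derivative of the nilpotency condition on `r v`, paired with its source. The
  -- source itself transforms into its equation of motion, which is where `b` and `ψ` enter; the
  -- signs combine to -1.
  have h3 : ∀ v, s • vf (ev q) (vpair (fld w) (r v) (var (src v))) =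
      vpair (fld w) (r v) (ψ v) - vpair (fld w) (r v) (b v) -
        formalSum fun u => vpair (fld w) (r u) (vpair (fld u) (r v) (var (src v))) := by
    intro v
    have h := vpair_vf hq (fld w) (r v) (var (src v))
    rw [hQr, vpair_zero_left, vf_ev_var, hqs, formalSum_lab] at h
    · simp only [hqf] at h
      have hpar : pa 1 (r v) = sgn 𝕜 1 (1 + (c.deg (fld v)).1) • r v := by
        rw [← hqf]
        exact hq _ 1
      rw [hpar, vpair_smul_left, vpair_smul_right, smul_smul, sgn_add_right, sgn_one_one,
        sgn_one_left, mul_assoc, sgn_mul_self, mul_one, neg_one_smul, vpair_sub_right] at h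
      have h' := eq_neg_of_add_eq_zero_left h.symm
      rw [sub_neg_eq_add] at h'
      rw [eq_sub_of_add_eq h']
      simp only [b, ψ]
      abel
    · intro u
      rw [(hr u v).vpair, vpair_zero_right]
  have h4 : s • vf (ev q) (ψ w) = (-1 : 𝕜) • formalSum fun v => vpair (fld w) (r v) (b v) := by
    rw [(XLin.vf _).map_formalSum (hψLF w), smul_formalSum _ ((hψLF w).map fun _ => XLin.vf _)]
    simp only [h3]
    have hLF : LF fun k : (F ⊕ I) × (F ⊕ I) =>
        vpair (fld w) (r k.1) (vpair (fld k.1) (r k.2) (var (src k.2))) :=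
      LF.prod r hrLF (fun n v l h => (XLin.vpairL _ _).vanishTo h)
        fun v => (hψLF v).map fun l => XLin.vpairR (fld w) (r v)
    have hLF' : LF fun v => formalSum fun u =>
        vpair (fld w) (r u) (vpair (fld u) (r v) (var (src v))) := by
      refine hrLF.of_forall fun n v h => ?_
      exact VanishTo.formalSum fun u => (XLin.vpairR _ _).vanishTo ((XLin.vpairL _ _).vanishTo h)
    rw [formalSum_sub ((hrg ψ).sub (hrg b)) hLF', formalSum_sub (hrg ψ) (hrg b),
      ← formalSum_comm (f := fun u v => vpair (fld w) (r u) (vpair (fld u) (r v) (var (src v)))) hLF]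
    -- After exchange of the two sums, the terms quadratic in the transformations cancel against the
    -- `ψ` terms of `h3`; only the `b` terms remain, and they agree with `h2`.
    have : (formalSum fun u => formalSum fun v =>
        vpair (fld w) (r u) (vpair (fld u) (r v) (var (src v)))) =
        formalSum fun u => vpair (fld w) (r u) (ψ u) := by
      congr 1
      ext1 u
      exact ((XLin.vpairR (fld w) (r u)).map_formalSum (hψLF u)).symm
    rw [this, neg_one_smul]
    abel
  rw [hqs, map_smul, map_sub]
  have h5 : s • (vf (ev q) (b w) - vf (ev q) (ψ w)) = 0 := by rw [smul_sub, h2, h4, sub_self]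
  rw [smul_eq_zero] at h5
  rw [show vf (ev q) (b w) - vf (ev q) (ψ w) = 0 from h5.resolve_left (sgn_ne_zero _ _), smul_zero]

/-! ### Counting operators, their inverses and the projection to weight zero. -/

section Weights

variable (wt : Lab F I → ℕ)

/-- The grading of differential polynomials by a weight of the variables. -/
def weightHom : JetAlg 𝕜 D c →ₐ[𝕜] Polynomial (JetAlg 𝕜 D c) :=
  liftGen (fun y => Polynomial.monomial (wt y.1) (gen y)) (by
    intro y z
    rw [Polynomial.monomial_mul_monomial, Polynomial.monomial_mul_monomial, gen_mul_gen y z,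
      Polynomial.smul_monomial, add_comm])

/-- The total weight of a list of jet variables. -/
def listWeight (l : List (Jet D F I)) : ℕ := (l.map fun y => wt y.1).sum

theorem weightHom_monomial (l : List (Jet D F I)) :
    weightHom wt ((l.map gen).prod : JetAlg 𝕜 D c) =
      Polynomial.monomial (listWeight wt l) (l.map gen).prod := by
  induction l with
  | nil => simp [listWeight]
  | cons y l ih =>
    simp only [listWeight, List.map_cons, List.prod_cons, List.sum_cons, map_mul] at ih ⊢
    rw [ih, weightHom, liftGen_gen, Polynomial.monomial_mul_monomial]

/-- The operator that multiplies differential polynomials of weight `k` by `φ k`. -/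
def weightOp (φ : ℕ → 𝕜) : JetAlg 𝕜 D c →ₗ[𝕜] JetAlg 𝕜 D c :=
  (Polynomial.lsum fun k => φ k • LinearMap.id) ∘ₗ (weightHom wt).toLinearMap

theorem weightOp_monomial (φ : ℕ → 𝕜) (l : List (Jet D F I)) :
    weightOp wt φ ((l.map gen).prod : JetAlg 𝕜 D c) = φ (listWeight wt l) • (l.map gen).prod := by
  simp [weightOp, weightHom_monomial, Polynomial.lsum_apply, Polynomial.sum_monomial_index]

/-- The operator `weightOp` on local functions. -/
def wf (φ : ℕ → 𝕜) : LocalFun 𝕜 D c →ₗ[𝕜] LocalFun 𝕜 D c := ow (weightOp wt φ)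

theorem XLin.wf (φ : ℕ → 𝕜) : XLin (wf wt φ : LocalFun 𝕜 D c →ₗ[𝕜] _) := XLin.ow _

/-- Linear operators on local functions that agree on monomials agree. -/
theorem XLin.ext_monomial {S T : LocalFun 𝕜 D c →ₗ[𝕜] LocalFun 𝕜 D c} (hS : XLin S) (hT : XLin T)
    (h : ∀ l : List (Jet D F I), S (PowerSeries.C (l.map gen).prod) = T (PowerSeries.C (l.map gen).prod)) :
    S = T := by
  rw [← sub_eq_zero]
  apply (hS.sub hT).ext_C
  have key : (S - T) ∘ₗ CLin = 0 := linearMap_eq_of_monomials fun l => by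
    simpa [CLin, sub_eq_zero] using h l
  exact fun b => DFunLike.congr_fun key b

theorem wf_monomial (φ : ℕ → 𝕜) (l : List (Jet D F I)) :
    wf wt φ (PowerSeries.C (l.map gen).prod : LocalFun 𝕜 D c) =
      φ (listWeight wt l) • PowerSeries.C (l.map gen).prod := by
  rw [wf, ow_C, weightOp_monomial, C_smul]

theorem wf_jet (φ : ℕ → 𝕜) (y : Jet D F I) :
    wf wt φ (jet y : LocalFun 𝕜 D c) = φ (wt y.1) • jet y := by
  have := wf_monomial (c := c) wt φ [y]
  simp only [listWeight, List.map_cons, List.map_nil, List.prod_cons, List.prod_nil, mul_one,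
    List.sum_cons, List.sum_nil, add_zero] at this
  exact this

theorem wf_wf (φ ψ : ℕ → 𝕜) (f : LocalFun 𝕜 D c) : wf wt φ (wf wt ψ f) = wf wt (φ * ψ) f := by
  have h : wf wt φ ∘ₗ wf wt ψ = (wf wt (φ * ψ) : LocalFun 𝕜 D c →ₗ[𝕜] _) :=
    ((XLin.wf wt φ).comp (XLin.wf wt ψ)).ext_monomial (XLin.wf wt _) fun l => by
      simp [wf_monomial, smul_smul, mul_comm]
  exact DFunLike.congr_fun h f

theorem wf_const (r : 𝕜) (f : LocalFun 𝕜 D c) : wf wt (fun _ => r) f = r • f := by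
  have h : wf wt (fun _ => r) = (r • LinearMap.id : LocalFun 𝕜 D c →ₗ[𝕜] _) :=
    (XLin.wf wt _).ext_monomial (XLin.id.smul r) fun l => by
      simp [wf_monomial]
  exact DFunLike.congr_fun h f

theorem wf_add (φ ψ : ℕ → 𝕜) (f : LocalFun 𝕜 D c) :
    wf wt (φ + ψ) f = wf wt φ f + wf wt ψ f := by
  have h : wf wt (φ + ψ) = (wf wt φ + wf wt ψ : LocalFun 𝕜 D c →ₗ[𝕜] _) :=
    (XLin.wf wt _).ext_monomial ((XLin.wf wt φ).add (XLin.wf wt ψ)) fun l => by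
      simp [wf_monomial, add_smul]
  exact DFunLike.congr_fun h f

/-- A bilinear identity between linear operators holds if it holds for monomials. -/
theorem ext_monomial₂ {A B C : LocalFun 𝕜 D c → LocalFun 𝕜 D c →ₗ[𝕜] LocalFun 𝕜 D c}
    {A' : LocalFun 𝕜 D c → LocalFun 𝕜 D c →ₗ[𝕜] LocalFun 𝕜 D c}
    (hA : ∀ g, XLin (A g)) (hB : ∀ g, XLin (B g)) (hC : ∀ f, XLin (C f)) (hA' : ∀ f, XLin (A' f))
    (hAA : ∀ f g, A g f = A' f g) (hBC : ∀ f g, B g f = C f g)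
    (h : ∀ l m : List (Jet D F I), A (PowerSeries.C (m.map gen).prod) (PowerSeries.C (l.map gen).prod) =
      B (PowerSeries.C (m.map gen).prod) (PowerSeries.C (l.map gen).prod)) (f g : LocalFun 𝕜 D c) :
    A g f = B g f := by
  have h1 : ∀ m : List (Jet D F I), A (PowerSeries.C (m.map gen).prod) =
      B (PowerSeries.C (m.map gen).prod) := fun m =>
    (hA _).ext_monomial (hB _) fun l => h l m
  have h2 : A' f = C f := (hA' f).ext_monomial (hC f) fun m => by
    rw [← hAA, ← hBC, h1]
  rw [hAA, hBC, h2]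

theorem wf_C_mul_C (φ : ℕ → 𝕜) (l m : List (Jet D F I)) :
    wf wt φ (PowerSeries.C (l.map gen).prod * PowerSeries.C (m.map gen).prod : LocalFun 𝕜 D c) =
      φ (listWeight wt l + listWeight wt m) •
        (PowerSeries.C (l.map gen).prod * PowerSeries.C (m.map gen).prod) := by
  have := wf_monomial (c := c) wt φ (l ++ m)
  rw [List.map_append, List.prod_append, map_mul] at this
  rw [this]
  simp [listWeight]

/-- The number operator. -/
def num : LocalFun 𝕜 D c →ₗ[𝕜] LocalFun 𝕜 D c := wf wt fun k => (k : 𝕜)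

theorem XLin.num : XLin (num wt : LocalFun 𝕜 D c →ₗ[𝕜] _) := XLin.wf _ _

theorem num_jet (y : Jet D F I) : num wt (jet y : LocalFun 𝕜 D c) = (wt y.1 : 𝕜) • jet y :=
  wf_jet _ _ _

theorem IsDer.num : IsDer 0 (num wt : LocalFun 𝕜 D c →ₗ[𝕜] _) := by
  intro f g
  have := ext_monomial₂ (𝕜 := 𝕜) (c := c) (D := D)
    (A := fun g => ProperFormalism.num wt ∘ₗ LinearMap.mulRight 𝕜 g)
    (A' := fun f => ProperFormalism.num wt ∘ₗ LinearMap.mulLeft 𝕜 f)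
    (B := fun g => LinearMap.mulRight 𝕜 g ∘ₗ ProperFormalism.num wt +
      LinearMap.mulRight 𝕜 (ProperFormalism.num wt g))
    (C := fun f => LinearMap.mulLeft 𝕜 (ProperFormalism.num wt f) +
      LinearMap.mulLeft 𝕜 f ∘ₗ ProperFormalism.num wt)
    (fun g => (XLin.num wt).comp (XLin.mulRight g))
    (fun g => ((XLin.mulRight g).comp (XLin.num wt)).add (XLin.mulRight _))
    (fun f => (XLin.mulLeft _).add ((XLin.mulLeft f).comp (XLin.num wt)))
    (fun f => (XLin.num wt).comp (XLin.mulLeft f)) (fun f g => rfl) (fun f g => rfl) (fun l m => by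
      simp only [LinearMap.comp_apply, LinearMap.add_apply, LinearMap.mulRight_apply]
      rw [ProperFormalism.num, wf_C_mul_C, wf_monomial, wf_monomial, smul_mul_assoc,
        mul_smul_comm, ← add_smul, Nat.cast_add]) f g
  simpa using this

theorem OpPar.num : OpPar 0 (num wt : LocalFun 𝕜 D c →ₗ[𝕜] _) := fun r f => by
  have h : ProperFormalism.num wt ∘ₗ pa r = (pa r ∘ₗ ProperFormalism.num wt : LocalFun 𝕜 D c →ₗ[𝕜] _) :=
    ((XLin.num wt).comp (XLin.pa r)).ext_monomial ((XLin.pa r).comp (XLin.num wt)) fun l => by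
      simp only [LinearMap.comp_apply, pa, ow_C, AlgHom.toLinearMap_apply, par_monomial, C_smul,
        map_smul, ProperFormalism.num, wf_monomial]
      rw [smul_comm]
  simpa using DFunLike.congr_fun h f

theorem num_tD (μ : Fin D) (f : LocalFun 𝕜 D c) : num wt (tD μ f) = tD μ (num wt f) := by
  have h := ((IsDer.num wt).comm (IsDer.tD μ) (OpPar.num wt) (OpPar.tD (c := c) (𝕜 := 𝕜) μ)).eq_zero
    (((XLin.num wt).comp (XLin.tD μ)).sub (((XLin.tD μ).comp (XLin.num wt)).smul _)) (by
      rintro ⟨z, α⟩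
      simp [num_jet, tD_jet])
  have := DFunLike.congr_fun h f
  simpa [sub_eq_zero] using this

/-- The projection to weight zero. -/
def proj0 : LocalFun 𝕜 D c →ₗ[𝕜] LocalFun 𝕜 D c := wf wt fun k => if k = 0 then 1 else 0

/-- The inverse of the number operator on positive weights. -/
def invNum : LocalFun 𝕜 D c →ₗ[𝕜] LocalFun 𝕜 D c := wf wt fun k => (k : 𝕜)⁻¹

theorem XLin.proj0 : XLin (proj0 wt : LocalFun 𝕜 D c →ₗ[𝕜] _) := XLin.wf _ _

theorem XLin.invNum : XLin (invNum wt : LocalFun 𝕜 D c →ₗ[𝕜] _) := XLin.wf _ _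

theorem proj0_jet (y : Jet D F I) :
    proj0 wt (jet y : LocalFun 𝕜 D c) = if wt y.1 = 0 then jet y else 0 := by
  rw [proj0, wf_jet]
  split_ifs <;> simp

theorem proj0_one : proj0 wt (1 : LocalFun 𝕜 D c) = 1 := by
  have := wf_monomial (c := c) wt (fun k => if k = 0 then 1 else 0 : ℕ → 𝕜) ([] : List (Jet D F I))
  simpa [listWeight, proj0] using this

theorem proj0_mul (f g : LocalFun 𝕜 D c) : proj0 wt (f * g) = proj0 wt f * proj0 wt g := by
  have := ext_monomial₂ (𝕜 := 𝕜) (c := c) (D := D)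
    (A := fun g => proj0 wt ∘ₗ LinearMap.mulRight 𝕜 g)
    (A' := fun f => proj0 wt ∘ₗ LinearMap.mulLeft 𝕜 f)
    (B := fun g => LinearMap.mulRight 𝕜 (proj0 wt g) ∘ₗ proj0 wt)
    (C := fun f => LinearMap.mulLeft 𝕜 (proj0 wt f) ∘ₗ proj0 wt)
    (fun g => (XLin.proj0 wt).comp (XLin.mulRight g))
    (fun g => (XLin.mulRight _).comp (XLin.proj0 wt))
    (fun f => (XLin.mulLeft _).comp (XLin.proj0 wt))
    (fun f => (XLin.proj0 wt).comp (XLin.mulLeft f)) (fun f g => rfl) (fun f g => rfl) (fun l m => by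
      simp only [LinearMap.comp_apply, LinearMap.mulRight_apply]
      rw [proj0, wf_C_mul_C, wf_monomial, wf_monomial, smul_mul_assoc, mul_smul_comm, smul_smul]
      congr 1
      by_cases h1 : listWeight wt l = 0 <;> by_cases h2 : listWeight wt m = 0 <;> simp [h1, h2]) f g
  simpa using this

variable [CharZero 𝕜]

/-- Because `0⁻¹ = 0`, `invNum` annihilates weight zero, and characteristic zero makes every
positive weight invertible. The product therefore misses exactly the weight-zero part. -/
theorem num_invNum (f : LocalFun 𝕜 D c) : num wt (invNum wt f) = f - proj0 wt f := by
  have h1 := wf_const (c := c) wt (1 : 𝕜) f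
  have h2 : (fun _ => 1 : ℕ → 𝕜) = (fun k : ℕ => (k : 𝕜)) * (fun k : ℕ => (k : 𝕜)⁻¹) +
      fun k : ℕ => if k = 0 then 1 else 0 := by
    ext k
    by_cases hk : k = 0 <;> simp [hk]
  rw [h2, wf_add, ← wf_wf, one_smul] at h1
  exact eq_sub_of_add_eq h1

theorem invNum_num (f : LocalFun 𝕜 D c) : invNum wt (num wt f) = f - proj0 wt f := by
  rw [← num_invNum, invNum, num, wf_wf, wf_wf, mul_comm]

theorem num_proj0 (f : LocalFun 𝕜 D c) : num wt (proj0 wt f) = 0 := by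
  rw [num, proj0, wf_wf]
  have h := wf_const (c := c) wt (0 : 𝕜) f
  rw [zero_smul] at h
  rw [← h]
  congr 2
  ext k
  by_cases hk : k = 0 <;> simp [hk]

theorem invNum_proj0 (f : LocalFun 𝕜 D c) : invNum wt (proj0 wt f) = 0 := by
  rw [invNum, proj0, wf_wf]
  have h := wf_const (c := c) wt (0 : 𝕜) f
  rw [zero_smul] at h
  rw [← h]
  congr 2
  ext k
  by_cases hk : k = 0 <;> simp [hk]

theorem proj0_invNum (f : LocalFun 𝕜 D c) : proj0 wt (invNum wt f) = 0 := by
  rw [← invNum_proj0 wt f, invNum, proj0, wf_wf, wf_wf, mul_comm]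

theorem proj0_num (f : LocalFun 𝕜 D c) : proj0 wt (num wt f) = 0 := by
  rw [← num_proj0 wt f, num, proj0, wf_wf, wf_wf, mul_comm]

variable {wt} {T : LocalFun 𝕜 D c →ₗ[𝕜] LocalFun 𝕜 D c}

/-- The kernel and the range of `num` are the range and the kernel of `proj0`, and an operator that
commutes with `num` preserves both. -/
theorem comm_proj0 (h : ∀ f, T (num wt f) = num wt (T f)) (f : LocalFun 𝕜 D c) :
    T (proj0 wt f) = proj0 wt (T f) := by
  have h1 : proj0 wt (T (proj0 wt f)) = T (proj0 wt f) := by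
    have := invNum_num wt (T (proj0 wt f))
    rw [← h, num_proj0, map_zero, map_zero] at this
    exact (sub_eq_zero.1 this.symm).symm
  have h2 : proj0 wt (T (f - proj0 wt f)) = 0 := by
    rw [← num_invNum, h, proj0_num]
  rw [map_sub, map_sub, h1, sub_eq_zero] at h2
  exact h2.symm

theorem comm_invNum (h : ∀ f, T (num wt f) = num wt (T f)) (f : LocalFun 𝕜 D c) :
    T (invNum wt f) = invNum wt (T f) := by
  have h1 : invNum wt (T (f - proj0 wt f)) = T (invNum wt f) := by
    rw [← num_invNum, h, invNum_num, ← comm_proj0 h, proj0_invNum, map_zero, sub_zero]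
  rw [← h1, map_sub, comm_proj0 h, map_sub, invNum_proj0, sub_zero]

end Weights

/-! ### Homotopy up to an error that is nilpotent order by order. -/

section Perturbation

/-- Once a power of `E` has made `f` divisible by `X`, the quotient can be treated in the same way;
each round gains one order. -/
theorem exists_vanishTo {E : Module.End 𝕜 (LocalFun 𝕜 D c)} (hX : XLin E)
    (h : ∀ f, ∃ m, VanishTo 0 ((E ^ m) f)) (n : ℕ) (f : LocalFun 𝕜 D c) :
    ∃ m, VanishTo n ((E ^ m) f) := by
  have hpow : ∀ m, XLin (E ^ m) := by
    intro m
    induction m with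
    | zero => exact XLin.id
    | succ m ih => rw [pow_succ]; exact ih.comp hX
  induction n generalizing f with
  | zero => exact h f
  | succ n ih =>
    obtain ⟨m, hm⟩ := h f
    obtain ⟨g, hg⟩ := exists_eq_X_mul (hm 0 le_rfl)
    obtain ⟨k, hk⟩ := ih g
    refine ⟨k + m, ?_⟩
    rw [pow_add, Module.End.mul_apply, hg, hpow]
    intro j hj
    cases j with
    | zero => simp
    | succ j => rw [PowerSeries.coeff_succ_X_mul]; exact hk j (by omega)

/-- A perturbation of the identity that is nilpotent order by order is injective. -/
theorem injective_of_vanishTo {E : Module.End 𝕜 (LocalFun 𝕜 D c)} (hX : XLin E)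
    (h : ∀ f, ∃ m, VanishTo 0 ((E ^ m) f)) {f : LocalFun 𝕜 D c} (hf : f - E f = 0) : f = 0 := by
  have hf' : E f = f := (sub_eq_zero.1 hf).symm
  have hpow : ∀ m, (E ^ m) f = f := by
    intro m
    induction m with
    | zero => simp
    | succ m ih => rw [pow_succ, Module.End.mul_apply, hf', ih]
  ext n
  obtain ⟨m, hm⟩ := exists_vanishTo hX h n f
  rw [hpow] at hm
  simpa using hm n le_rfl

/-- A perturbation of the identity that is nilpotent order by order is surjective. -/
theorem surjective_of_vanishTo {E : Module.End 𝕜 (LocalFun 𝕜 D c)} (hX : XLin E)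
    (h : ∀ f, ∃ m, VanishTo 0 ((E ^ m) f)) (f : LocalFun 𝕜 D c) : ∃ g, g - E g = f := by
  have hpow : ∀ m, XLin (E ^ m) := by
    intro m
    induction m with
    | zero => exact XLin.id
    | succ m ih => rw [pow_succ]; exact ih.comp hX
  have hv : ∀ n, ∃ m, ∀ k ≥ m, VanishTo n ((E ^ k) f) := by
    intro n
    obtain ⟨m, hm⟩ := exists_vanishTo hX h n f
    refine ⟨m, fun k hk => ?_⟩
    obtain ⟨j, rfl⟩ := Nat.exists_eq_add_of_le hk
    rw [add_comm, pow_add, Module.End.mul_apply]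
    exact (hpow j).vanishTo hm
  have hLF : LF fun k : ℕ => (E ^ k) f := by
    intro n
    obtain ⟨m, hm⟩ := hv n
    refine (Set.finite_lt_nat m).subset fun k hk => ?_
    by_contra hcon
    exact hk (hm k (not_lt.1 hcon) n le_rfl)
  -- The Neumann series. At each order only finitely many powers contribute, so `g - E g` telescopes
  -- there to the coefficient of `f`.
  refine ⟨formalSum fun k : ℕ => (E ^ k) f, ?_⟩
  rw [hX.map_formalSum hLF, ← formalSum_sub hLF (hLF.map fun _ => hX)]
  ext n
  obtain ⟨m, hm⟩ := hv n
  rw [coeff_formalSum, finsum_eq_finsetSum_of_support_subset (s := Finset.range m)]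
  · have : ∀ k, E ((E ^ k) f) = (E ^ (k + 1)) f := fun k => by
      rw [pow_succ', Module.End.mul_apply]
    simp only [this, map_sub]
    rw [Finset.sum_range_sub' (fun k => PowerSeries.coeff n ((E ^ k) f)), hm m le_rfl n le_rfl]
    simp
  · intro k hk
    simp only [Finset.coe_range, Set.mem_Iio]
    by_contra hcon
    apply hk
    change PowerSeries.coeff n ((E ^ k) f - E ((E ^ k) f)) = 0
    rw [map_sub, hm k (not_lt.1 hcon) n le_rfl, hX.vanishTo (hm k (not_lt.1 hcon)) n le_rfl, sub_zero]

/-- An operator that is, at leading order, the sum of nothing but terms that lower a weight by one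
is nilpotent at leading order. -/
theorem exists_pow_vanishTo_zero [CharZero 𝕜] {wt : Lab F I → ℕ}
    {E E' : Module.End 𝕜 (LocalFun 𝕜 D c)} (hX' : XLin E')
    (hEE : ∀ f, VanishTo 0 (E f - E' f))
    (hE' : ∀ f, num wt (E' f) = E' (num wt f) - E' f) (f : LocalFun 𝕜 D c) :
    ∃ m, VanishTo 0 ((E ^ m) f) := by
  have hstep : ∀ m f, VanishTo 0 ((E ^ m) f - (E' ^ m) f) := by
    intro m
    induction m with
    | zero => intro f; simp [VanishTo]
    | succ m ih =>
      intro f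
      rw [pow_succ', pow_succ', Module.End.mul_apply, Module.End.mul_apply]
      have h1 := hEE ((E ^ m) f)
      have h2 := hX'.vanishTo (ih f)
      intro k hk
      have h1 := h1 k hk
      have h2 := h2 k hk
      rw [map_sub] at h1 h2 ⊢
      rw [map_sub] at h2
      rw [sub_eq_zero] at h1 h2 ⊢
      rw [h1, h2]
  -- Each application of `E'` lowers the eigenvalue of `num` by one, so one application more than
  -- the weight leads below weight zero.
  have hmon : ∀ l : List (Jet D F I), (E' ^ (listWeight wt l + 1)) (PowerSeries.C (l.map gen).prod) = 0 := by
    intro l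
    have h1 : ∀ j : ℕ, num wt ((E' ^ j) (PowerSeries.C (l.map gen).prod)) =
        ((listWeight wt l : 𝕜) - j) • (E' ^ j) (PowerSeries.C (l.map gen).prod) := by
      intro j
      induction j with
      | zero => simp [num, wf_monomial]
      | succ j ih =>
        rw [pow_succ', Module.End.mul_apply, hE', ih, map_smul]
        push_cast
        module
    have h2 := h1 (listWeight wt l + 1)
    set g := (E' ^ (listWeight wt l + 1)) (PowerSeries.C (l.map gen).prod)
    -- The eigenvalue is now -1. It is not the weight of any monomial: `num` plus the identity
    -- multiplies weight k by k + 1 and is invertible.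
    have h3 : wf wt (fun k => (k : 𝕜) + 1) g = 0 := by
      have := wf_add wt (fun k => (k : 𝕜)) (fun _ => 1) g
      rw [wf_const, ← num, h2] at this
      rw [show (fun k : ℕ => (k : 𝕜) + 1) = (fun k : ℕ => (k : 𝕜)) + fun _ => 1 from rfl, this]
      push_cast
      module
    have h4 := wf_wf wt (fun k => ((k : 𝕜) + 1)⁻¹) (fun k => (k : 𝕜) + 1) g
    rw [h3, map_zero] at h4
    have h5 : (fun k : ℕ => ((k : 𝕜) + 1)⁻¹) * (fun k : ℕ => (k : 𝕜) + 1) = fun _ => 1 := by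
      ext k
      exact inv_mul_cancel₀ (Nat.cast_add_one_ne_zero k)
    rw [h5, wf_const, one_smul] at h4
    exact h4.symm
  have hb : ∀ b : JetAlg 𝕜 D c, ∃ m, ∀ j ≥ m, (E' ^ j) (PowerSeries.C b) = 0 := by
    intro b
    have : b ∈ Submodule.span 𝕜 (Set.range fun l : List (Jet D F I) =>
        ((l.map gen).prod : JetAlg 𝕜 D c)) := by
      rw [span_monomials]
      exact Submodule.mem_top
    induction this using Submodule.span_induction with
    | mem b hb =>
      obtain ⟨l, rfl⟩ := hb
      refine ⟨listWeight wt l + 1, fun j hj => ?_⟩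
      obtain ⟨i, rfl⟩ := Nat.exists_eq_add_of_le hj
      rw [add_comm, pow_add, Module.End.mul_apply, hmon, map_zero]
    | zero => exact ⟨0, fun j _ => by simp⟩
    | add a b _ _ ha hb =>
      obtain ⟨m, hm⟩ := ha
      obtain ⟨m', hm'⟩ := hb
      refine ⟨max m m', fun j hj => ?_⟩
      rw [map_add, map_add, hm j (le_trans (le_max_left _ _) hj),
        hm' j (le_trans (le_max_right _ _) hj), add_zero]
    | smul r b _ hb =>
      obtain ⟨m, hm⟩ := hb
      exact ⟨m, fun j hj => by rw [C_smul, map_smul, hm j hj, smul_zero]⟩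
  obtain ⟨g, hg⟩ := exists_eq_C_add_X_mul f
  obtain ⟨m, hm⟩ := hb (PowerSeries.coeff 0 f)
  refine ⟨m, ?_⟩
  have hpow : ∀ m, XLin (E' ^ m) := by
    intro m
    induction m with
    | zero => exact XLin.id
    | succ m ih => rw [pow_succ]; exact ih.comp hX'
  intro k hk
  have := hstep m f k hk
  rw [map_sub, sub_eq_zero] at this
  rw [this, hg, map_add, hm m le_rfl, zero_add, hpow]
  obtain rfl : k = 0 := by omega
  simp

/-- Closed functionals in the kernel of `P` are exact, given a homotopy up to a small error. -/
theorem exists_sub_mem_divs {Q H P E : Module.End 𝕜 (LocalFun 𝕜 D c)} (hX : XLin E)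
    (hnil : ∀ f, ∃ m, VanishTo 0 ((E ^ m) f)) (hH : ∀ μ f, H (tD μ f) = tD μ (H f))
    (hE : ∀ μ f, E (tD μ f) = tD μ (E f)) (hQ : ∀ f, Q (Q f) = 0)
    (hhom : ∀ f, Q (H f) + H (Q f) = f - P f - E f) (hPE : ∀ f, P (E f) = 0)
    (hPQ : ∀ f, P f = 0 → P (Q f) = 0) {f : LocalFun 𝕜 D c} (hf : P f = 0) (hQf : Q f ∈ divs 𝕜 D c) :
    ∃ g, f - Q g ∈ divs 𝕜 D c := by
  obtain ⟨g, hg⟩ := surjective_of_vanishTo hX hnil f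
  have hPg : P g = 0 := by
    have := congrArg P hg
    rwa [map_sub, hPE, sub_zero, hf] at this
  have h1 : Q (H g) + H (Q g) = f := by rw [hhom, hPg, sub_zero, hg]
  -- The homotopy identity for `Q g`, together with `Q` applied to the identity for `g`. Thus `1 -
  -- E` maps `Q g` to `Q f`.
  have h2 : Q g - E (Q g) = Q f := by
    have := hhom (Q g)
    rw [hQ, map_zero, add_zero, hPQ g hPg, sub_zero] at this
    rw [← this, ← h1, map_add, hQ, zero_add]
  -- `1 - E` is bijective and commutes with total derivatives, so the current of `Q f` can be pulled
  -- back componentwise; injectivity identifies the resulting divergence with `Q g`. This is what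
  -- carries the exact identity over to functionals.
  have h3 : Q g ∈ divs 𝕜 D c := by
    obtain ⟨V, hV⟩ := hQf
    choose W hW using fun μ => surjective_of_vanishTo hX hnil (V μ)
    refine ⟨W, ?_⟩
    rw [← sub_eq_zero]
    apply injective_of_vanishTo hX hnil
    have h4 : ∑ μ, tD μ (W μ) - E (∑ μ, tD μ (W μ)) = Q f := by
      rw [map_sum, ← Finset.sum_sub_distrib, hV]
      apply Finset.sum_congr rfl
      intro μ _
      rw [hE, ← map_sub, hW]
    rw [map_sub, sub_sub_sub_comm, h2, h4, sub_self]
  refine ⟨H g, ?_⟩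
  rw [← h1, add_sub_cancel_left]
  exact map_mem_divs hH h3

end Perturbation

/-! ### Substitutions of variables and multiplicative operators. -/

section Substitution

/-- The continuous extension of a linear map from differential polynomials to local functions. -/
def extX (T : JetAlg 𝕜 D c →ₗ[𝕜] LocalFun 𝕜 D c) : LocalFun 𝕜 D c →ₗ[𝕜] LocalFun 𝕜 D c where
  toFun f := PowerSeries.mk fun n =>
    ∑ p ∈ Finset.HasAntidiagonal.antidiagonal n, PowerSeries.coeff p.1 (T (PowerSeries.coeff p.2 f))
  map_add' f g := by
    ext n
    simp [Finset.sum_add_distrib]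
  map_smul' r f := by
    ext n
    simp [Finset.smul_sum]

theorem coeff_extX (T : JetAlg 𝕜 D c →ₗ[𝕜] LocalFun 𝕜 D c) (f : LocalFun 𝕜 D c) (n : ℕ) :
    PowerSeries.coeff n (extX T f) =
      ∑ p ∈ Finset.HasAntidiagonal.antidiagonal n, PowerSeries.coeff p.1 (T (PowerSeries.coeff p.2 f)) := by
  simp [extX]

theorem extX_C (T : JetAlg 𝕜 D c →ₗ[𝕜] LocalFun 𝕜 D c) (b : JetAlg 𝕜 D c) :
    extX T (PowerSeries.C b) = T b := by
  ext n
  rw [coeff_extX, Finset.sum_eq_single (n, 0)]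
  · simp
  · rintro ⟨i, j⟩ hij hne
    have hj : j ≠ 0 := by
      rintro rfl
      apply hne
      simpa using hij
    simp [PowerSeries.coeff_C_of_ne_zero hj]
  · simp

theorem XLin.extX (T : JetAlg 𝕜 D c →ₗ[𝕜] LocalFun 𝕜 D c) : XLin (extX T) := fun f => by
  ext n
  cases n with
  | zero => simp [coeff_extX]
  | succ n =>
    rw [PowerSeries.coeff_succ_X_mul, coeff_extX, coeff_extX, Finset.Nat.antidiagonal_succ']
    simp [PowerSeries.coeff_succ_X_mul]

/-- Multiplicative operators. -/
def IsHom (T : LocalFun 𝕜 D c →ₗ[𝕜] LocalFun 𝕜 D c) : Prop := T 1 = 1 ∧ ∀ f g, T (f * g) = T f * T g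

theorem IsHom.id : IsHom (LinearMap.id : LocalFun 𝕜 D c →ₗ[𝕜] _) := ⟨rfl, fun _ _ => rfl⟩

theorem IsHom.comp {S T : LocalFun 𝕜 D c →ₗ[𝕜] LocalFun 𝕜 D c} (hS : IsHom S) (hT : IsHom T) :
    IsHom (S ∘ₗ T) :=
  ⟨by simp [hT.1, hS.1], fun f g => by simp [hT.2 f g, hS.2 (T f) (T g)]⟩

theorem IsHom.ext {S T : LocalFun 𝕜 D c →ₗ[𝕜] LocalFun 𝕜 D c} (hS : IsHom S) (hT : IsHom T)
    (hS' : XLin S) (hT' : XLin T) (h : ∀ y, S (jet y) = T (jet y)) : S = T := by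
  rw [← sub_eq_zero]
  apply (hS'.sub hT').ext_gen
  · simp [hS.1, hT.1]
  · intro y f hf
    change S (jet y * f) - T (jet y * f) = 0
    have hf' : S f = T f := sub_eq_zero.1 hf
    rw [hS.2, hT.2, h, hf', sub_self]

theorem IsHom.comm_tD {T : LocalFun 𝕜 D c →ₗ[𝕜] LocalFun 𝕜 D c} (hT : IsHom T) (hX : XLin T)
    (h : ∀ μ y, T (tD μ (jet y)) = tD μ (T (jet y))) (μ : Fin D) (f : LocalFun 𝕜 D c) :
    T (tD μ f) = tD μ (T f) := by
  have key : T ∘ₗ tD μ - tD μ ∘ₗ T = 0 := by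
    apply ((hX.comp (XLin.tD μ)).sub ((XLin.tD μ).comp hX)).ext_gen
    · simp [tD_one, hT.1]
    · intro y f hf
      change T (tD μ (jet y * f)) - tD μ (T (jet y * f)) = 0
      have hf' : T (tD μ f) = tD μ (T f) := sub_eq_zero.1 hf
      rw [hT.2, tD_mul, tD_mul, map_add, hT.2, hT.2, h, hf', sub_self]
  exact sub_eq_zero.1 (DFunLike.congr_fun key f)

theorem IsHom.comm_tD_of_var {T : LocalFun 𝕜 D c →ₗ[𝕜] LocalFun 𝕜 D c} (hT : IsHom T) (hX : XLin T)
    (h : ∀ y : Jet D F I, T (jet y) = mD y.2 (T (var y.1))) (μ : Fin D) (f : LocalFun 𝕜 D c) :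
    T (tD μ f) = tD μ (T f) := by
  apply hT.comm_tD hX
  rintro μ ⟨z, α⟩
  rw [tD_jet, h, h, mD_add_single]

/-- The composite obeys a Leibniz rule along `P`, so it vanishes as soon as it vanishes on the jet
variables. -/
theorem IsHom.map_der_eq_zero {P T : LocalFun 𝕜 D c →ₗ[𝕜] LocalFun 𝕜 D c} {p : ZMod 2}
    (hP : IsHom P) (hPX : XLin P) (hT : IsDer p T) (hTX : XLin T) (h : ∀ y, P (T (jet y)) = 0)
    (f : LocalFun 𝕜 D c) : P (T f) = 0 := by
  have key : P ∘ₗ T = 0 := by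
    apply (hPX.comp hTX).ext_gen
    · simp [hT.one]
    · intro y f hf
      change P (T (jet y * f)) = 0
      have hf' : P (T f) = 0 := hf
      rw [hT, map_add, hP.2, hP.2, h, hf', zero_mul, mul_zero, add_zero]
  exact DFunLike.congr_fun key f

theorem IsHom.map_der_eq_zero_of_var {P T : LocalFun 𝕜 D c →ₗ[𝕜] LocalFun 𝕜 D c} {p : ZMod 2}
    (hP : IsHom P) (hPX : XLin P) (hPD : ∀ μ f, P (tD μ f) = tD μ (P f)) (hT : IsDer p T)
    (hTX : XLin T) (hTD : ∀ μ f, T (tD μ f) = tD μ (T f)) (h : ∀ z, P (T (var z)) = 0)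
    (f : LocalFun 𝕜 D c) : P (T f) = 0 := by
  apply hP.map_der_eq_zero hPX hT hTX
  rintro ⟨z, α⟩
  rw [jet_eq_mD, comm_mD hTD, comm_mD hPD, ← var_eq, h, map_zero]

theorem IsHom.proj0 (wt : Lab F I → ℕ) : IsHom (proj0 wt : LocalFun 𝕜 D c →ₗ[𝕜] _) :=
  ⟨proj0_one wt, proj0_mul wt⟩

theorem proj0_tD (wt : Lab F I → ℕ) (μ : Fin D) (f : LocalFun 𝕜 D c) :
    proj0 wt (tD μ f) = tD μ (proj0 wt f) := by
  apply (IsHom.proj0 wt).comm_tD (XLin.proj0 wt)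
  rintro μ ⟨z, α⟩
  rw [tD_jet, proj0_jet, proj0_jet]
  split_ifs
  · rw [tD_jet]
  · rw [map_zero]

variable [CharZero 𝕜] (s : Lab F I → LocalFun 𝕜 D c) (hs : ∀ z, HasPar (c.deg z).1 (s z))

/-- The substitution of local functions for the variables. -/
def subst : LocalFun 𝕜 D c →ₗ[𝕜] LocalFun 𝕜 D c :=
  extX (liftGen (c := c) (ev s) (by
    intro y z
    have h := (hs z.1).mD z.2
    rw [ev, ev, ((hs y.1).mD y.2).mul_comm, h, smul_mul_assoc])).toLinearMap

theorem XLin.subst : XLin (subst s hs) := XLin.extX _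

theorem IsHom.subst : IsHom (subst s hs) := by
  constructor
  · rw [← map_one PowerSeries.C, ProperFormalism.subst, extX_C]
    simp
  · have h1 : ∀ b b', ProperFormalism.subst s hs (PowerSeries.C b * PowerSeries.C b') =
        ProperFormalism.subst s hs (PowerSeries.C b) *
          ProperFormalism.subst s hs (PowerSeries.C b') := by
      intro b b'
      rw [← map_mul, ProperFormalism.subst, extX_C, extX_C, extX_C]
      simp
    set T := ProperFormalism.subst s hs
    have hT : XLin T := XLin.subst s hs
    -- Multiplicativity is extended from constant power series to arbitrary ones in one factor at a
    -- time, each time by linearity over `X`.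
    have h2 : ∀ f b, T (f * PowerSeries.C b) = T f * T (PowerSeries.C b) := by
      intro f b
      have : T ∘ₗ LinearMap.mulRight 𝕜 (PowerSeries.C b) -
          LinearMap.mulRight 𝕜 (T (PowerSeries.C b)) ∘ₗ T = 0 := by
        apply XLin.ext_C
        · exact (hT.comp (XLin.mulRight _)).sub ((XLin.mulRight _).comp hT)
        · intro b'
          simp [h1]
      exact sub_eq_zero.1 (DFunLike.congr_fun this f)
    intro f g
    have : T ∘ₗ LinearMap.mulLeft 𝕜 f - LinearMap.mulLeft 𝕜 (T f) ∘ₗ T = 0 := by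
      apply XLin.ext_C
      · exact (hT.comp (XLin.mulLeft _)).sub ((XLin.mulLeft _).comp hT)
      · intro b
        simp [h2]
    exact sub_eq_zero.1 (DFunLike.congr_fun this g)

theorem subst_jet (y : Jet D F I) : subst s hs (jet y) = ev s y := by
  rw [jet, subst, extX_C]
  simp [liftGen_gen]

theorem subst_var (z : Lab F I) : subst s hs (var z) = s z := by
  rw [var_eq, subst_jet, ev_zero]

theorem subst_tD (μ : Fin D) (f : LocalFun 𝕜 D c) : subst s hs (tD μ f) = tD μ (subst s hs f) :=
  (IsHom.subst s hs).comm_tD_of_var (XLin.subst s hs)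
    (fun y => by rw [subst_jet, subst_var, ev]) μ f

theorem subst_pa (r : ZMod 2) (f : LocalFun 𝕜 D c) : subst s hs (pa r f) = pa r (subst s hs f) := by
  have hpa : IsHom (pa r : LocalFun 𝕜 D c →ₗ[𝕜] _) := ⟨pa_one r, pa_mul r⟩
  have := ((IsHom.subst s hs).comp hpa).ext (hpa.comp (IsHom.subst s hs))
    ((XLin.subst s hs).comp (XLin.pa r)) ((XLin.pa r).comp (XLin.subst s hs)) (by
      intro y
      simp only [LinearMap.comp_apply, pa_jet, map_smul, subst_jet]
      exact ((hs y.1).mD y.2 r).symm)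
  exact DFunLike.congr_fun this f

theorem subst_subst_eq_self {t : Lab F I → LocalFun 𝕜 D c} (ht : ∀ z, HasPar (c.deg z).1 (t z))
    (h : ∀ z, subst s hs (t z) = var z) (f : LocalFun 𝕜 D c) :
    subst s hs (subst t ht f) = f := by
  have := ((IsHom.subst s hs).comp (IsHom.subst t ht)).ext IsHom.id
    ((XLin.subst s hs).comp (XLin.subst t ht)) XLin.id (by
      rintro ⟨z, α⟩
      simp only [LinearMap.comp_apply, subst_jet, ev, LinearMap.id_apply]
      rw [comm_mD (subst_tD s hs), h, jet_eq_mD z α, var_eq])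
  exact DFunLike.congr_fun this f

end Substitution

/-! ### Functions of some of the variables only. -/

section Dependence

/-- An operator that agrees with another one on polynomials in the variables that satisfy `p`. -/
theorem DependsOnlyOn.eq_of_gen_mul {p : Lab F I → Prop} {S T : LocalFun 𝕜 D c →ₗ[𝕜] LocalFun 𝕜 D c}
    (hS : XLin S) (hT : XLin T) (h1 : S 1 = T 1)
    (h : ∀ y f, p y.1 → S f = T f → S (jet y * f) = T (jet y * f))
    {f : LocalFun 𝕜 D c} (hf : DependsOnlyOn p f) : S f = T f := by
  have key : ∀ b ∈ polyIn 𝕜 D c p, S (PowerSeries.C b) = T (PowerSeries.C b) := by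
    have key' : ∀ a ∈ polyIn 𝕜 D c p, ∀ b, S (PowerSeries.C b) = T (PowerSeries.C b) →
        S (PowerSeries.C (a * b)) = T (PowerSeries.C (a * b)) := by
      intro a ha
      induction ha using Algebra.adjoin_induction with
      | mem a ha =>
        obtain ⟨y, hy, rfl⟩ := ha
        intro b hb
        rw [map_mul]
        exact h y _ hy hb
      | algebraMap r =>
        intro b hb
        rw [← Algebra.smul_def, C_smul, map_smul, map_smul, hb]
      | add a a' _ _ ha ha' =>
        intro b hb
        rw [add_mul, map_add, map_add, map_add, ha b hb, ha' b hb]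
      | mul a a' _ _ ha ha' =>
        intro b hb
        rw [mul_assoc]
        exact ha _ (ha' b hb)
    intro b hb
    have := key' b hb 1 (by simpa using h1)
    rwa [mul_one] at this
  have key2 : ∀ n, ∀ f : LocalFun 𝕜 D c, DependsOnlyOn p f →
      PowerSeries.coeff n (S f) = PowerSeries.coeff n (T f) := by
    intro n
    induction n with
    | zero =>
      intro f hf
      obtain ⟨g, hg⟩ := exists_eq_C_add_X_mul f
      have e : ∀ R : LocalFun 𝕜 D c →ₗ[𝕜] LocalFun 𝕜 D c, XLin R → R f =
          R (PowerSeries.C (PowerSeries.coeff 0 f)) + PowerSeries.X * R g := fun R hR => by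
        rw [← hR, ← map_add, ← hg]
      rw [e S hS, e T hT, key _ (hf 0)]
      simp
    | succ n ih =>
      intro f hf
      obtain ⟨g, hg⟩ := exists_eq_C_add_X_mul f
      -- Division by `X` shifts the coefficients, so the remainder satisfies the same restriction on
      -- its variables.
      have hg' : DependsOnlyOn p g := fun m => by
        have := hf (m + 1)
        rw [hg, map_add, PowerSeries.coeff_succ_C, zero_add, PowerSeries.coeff_succ_X_mul] at this
        exact this
      have e : ∀ R : LocalFun 𝕜 D c →ₗ[𝕜] LocalFun 𝕜 D c, XLin R → R f =
          R (PowerSeries.C (PowerSeries.coeff 0 f)) + PowerSeries.X * R g := fun R hR => by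
        rw [← hR, ← map_add, ← hg]
      rw [e S hS, e T hT, key _ (hf 0), map_add, map_add,
        PowerSeries.coeff_succ_X_mul, PowerSeries.coeff_succ_X_mul, ih g hg']
  ext n
  exact key2 n f hf

theorem DependsOnlyOn.der_eq {p : Lab F I → Prop} {S T : LocalFun 𝕜 D c →ₗ[𝕜] LocalFun 𝕜 D c}
    {r : ZMod 2} (hS : IsDer r S) (hT : IsDer r T) (hSX : XLin S) (hTX : XLin T)
    (h : ∀ y, p y.1 → S (jet y) = T (jet y)) {f : LocalFun 𝕜 D c} (hf : DependsOnlyOn p f) :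
    S f = T f :=
  hf.eq_of_gen_mul hSX hTX (by rw [hS.one, hT.one]) fun y f hy hf => by
    rw [hS, hT, h y hy, hf]

theorem DependsOnlyOn.hom_eq {p : Lab F I → Prop} {S T : LocalFun 𝕜 D c →ₗ[𝕜] LocalFun 𝕜 D c}
    (hS : IsHom S) (hT : IsHom T) (hSX : XLin S) (hTX : XLin T)
    (h : ∀ y, p y.1 → S (jet y) = T (jet y)) {f : LocalFun 𝕜 D c} (hf : DependsOnlyOn p f) :
    S f = T f :=
  hf.eq_of_gen_mul hSX hTX (by rw [hS.1, hT.1]) fun y f hy hf => by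
    rw [hS.2, hT.2, h y hy, hf]

theorem IsDer.zero (r : ZMod 2) : IsDer r (0 : LocalFun 𝕜 D c →ₗ[𝕜] _) := fun f g => by simp

theorem DependsOnlyOn.indepOf {p : Lab F I → Prop} {f : LocalFun 𝕜 D c} (hf : DependsOnlyOn p f)
    {z : Lab F I} (hz : ¬ p z) : IndepOf z f := fun α => by
  refine hf.der_eq (IsDer.pd (z, α)) (IsDer.zero _) (XLin.pd _) XLin.zero ?_
  rintro ⟨w, β⟩ hw
  rw [pd_jet_of_ne]
  · rfl
  · rintro h
    exact hz ((Prod.mk.inj h).1 ▸ hw)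

end Dependence

section DependsOnlyOn

variable {p : Lab F I → Prop} {f g : LocalFun 𝕜 D c}

theorem gen_mem_polyIn {y : Jet D F I} (hy : p y.1) : (gen y : JetAlg 𝕜 D c) ∈ polyIn 𝕜 D c p :=
  Algebra.subset_adjoin ⟨y, hy, rfl⟩

theorem polyIn_mono {p' : Lab F I → Prop} (h : ∀ z, p z → p' z) :
    polyIn 𝕜 D c p ≤ polyIn 𝕜 D c p' := by
  apply Algebra.adjoin_mono
  rintro _ ⟨y, hy, rfl⟩
  exact ⟨y, h _ hy, rfl⟩

theorem par_mem_polyIn (r : ZMod 2) {b : JetAlg 𝕜 D c} (hb : b ∈ polyIn 𝕜 D c p) :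
    par r b ∈ polyIn 𝕜 D c p := by
  induction hb using Algebra.adjoin_induction with
  | mem b hb =>
    obtain ⟨y, hy, rfl⟩ := hb
    rw [par_gen]
    exact Subalgebra.smul_mem _ (gen_mem_polyIn hy) _
  | algebraMap r => rw [AlgHom.commutes]; exact Subalgebra.algebraMap_mem _ _
  | add a b _ _ ha hb => rw [map_add]; exact add_mem ha hb
  | mul a b _ _ ha hb => rw [map_mul]; exact mul_mem ha hb

theorem totalD_mem_polyIn (μ : Fin D) {b : JetAlg 𝕜 D c} (hb : b ∈ polyIn 𝕜 D c p) :
    totalD μ b ∈ polyIn 𝕜 D c p := by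
  induction hb using Algebra.adjoin_induction with
  | mem b hb =>
    obtain ⟨⟨z, α⟩, hy, rfl⟩ := hb
    rw [totalD_gen]
    exact gen_mem_polyIn hy
  | algebraMap r =>
    rw [Algebra.algebraMap_eq_smul_one, map_smul, totalD, leftDer_one, smul_zero]
    exact zero_mem _
  | add a b _ _ ha hb => rw [map_add]; exact add_mem ha hb
  | mul a b ha' hb' ha hb =>
    rw [totalD_mul]
    exact add_mem (mul_mem ha hb') (mul_mem ha' hb)

theorem pdL_mem_polyIn (y : Jet D F I) {b : JetAlg 𝕜 D c} (hb : b ∈ polyIn 𝕜 D c p) :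
    pdL y b ∈ polyIn 𝕜 D c p := by
  induction hb using Algebra.adjoin_induction with
  | mem b hb =>
    obtain ⟨z, hy, rfl⟩ := hb
    rw [pdL_gen]
    split_ifs
    · exact one_mem _
    · exact zero_mem _
  | algebraMap r =>
    rw [Algebra.algebraMap_eq_smul_one, map_smul, pdL_one, smul_zero]
    exact zero_mem _
  | add a b _ _ ha hb => rw [map_add]; exact add_mem ha hb
  | mul a b ha' hb' ha hb =>
    rw [pdL_mul]
    exact add_mem (mul_mem ha hb') (mul_mem (par_mem_polyIn _ ha') hb)

namespace DependsOnlyOn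

theorem mono {p' : Lab F I → Prop} (hf : DependsOnlyOn p f) (h : ∀ z, p z → p' z) :
    DependsOnlyOn p' f := fun n => polyIn_mono h (hf n)

theorem zero : DependsOnlyOn p (0 : LocalFun 𝕜 D c) := fun n => by simp

theorem one : DependsOnlyOn p (1 : LocalFun 𝕜 D c) := fun n => by
  rw [PowerSeries.coeff_one]
  split_ifs
  · exact one_mem _
  · exact zero_mem _

theorem add (hf : DependsOnlyOn p f) (hg : DependsOnlyOn p g) : DependsOnlyOn p (f + g) :=
  fun n => by rw [map_add]; exact add_mem (hf n) (hg n)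

theorem sub (hf : DependsOnlyOn p f) (hg : DependsOnlyOn p g) : DependsOnlyOn p (f - g) :=
  fun n => by rw [map_sub]; exact sub_mem (hf n) (hg n)

theorem smul (hf : DependsOnlyOn p f) (r : 𝕜) : DependsOnlyOn p (r • f) := fun n => by
  have : PowerSeries.coeff n (r • f) = r • PowerSeries.coeff n f := by simp
  rw [this]
  exact Subalgebra.smul_mem _ (hf n) _

theorem mul (hf : DependsOnlyOn p f) (hg : DependsOnlyOn p g) : DependsOnlyOn p (f * g) :=
  fun n => by
    rw [PowerSeries.coeff_mul]
    exact sum_mem fun k _ => mul_mem (hf _) (hg _)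

theorem jet {y : Jet D F I} (hy : p y.1) : DependsOnlyOn p (jet y : LocalFun 𝕜 D c) := fun n => by
  rw [ProperFormalism.jet, PowerSeries.coeff_C]
  split_ifs
  · exact gen_mem_polyIn hy
  · exact zero_mem _

theorem var {z : Lab F I} (hz : p z) : DependsOnlyOn p (var z : LocalFun 𝕜 D c) :=
  jet (y := (z, 0)) hz

theorem tD (hf : DependsOnlyOn p f) (μ : Fin D) : DependsOnlyOn p (tD μ f) := fun n => by
  rw [ProperFormalism.tD, coeff_ow]
  exact totalD_mem_polyIn μ (hf n)

theorem mD (hf : DependsOnlyOn p f) (α : Fin D → ℕ) : DependsOnlyOn p (mD α f) := by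
  induction α using multiIndex_induction with
  | zero => rwa [mD_zero]
  | add_single α μ ih => rw [mD_add_single]; exact ih.tD μ

theorem pd (hf : DependsOnlyOn p f) (y : Jet D F I) : DependsOnlyOn p (pd y f) := fun n => by
  rw [ProperFormalism.pd, coeff_ow]
  exact pdL_mem_polyIn y (hf n)

theorem formalSum {κ : Type x} {f : κ → LocalFun 𝕜 D c} (h : ∀ k, DependsOnlyOn p (f k)) :
    DependsOnlyOn p (formalSum f) := fun n => by
  rw [coeff_formalSum]
  exact finsum_induction (p := fun b => b ∈ polyIn 𝕜 D c p) (zero_mem _)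
    (fun _ _ => add_mem) fun k => h k n

theorem sum {κ : Type x} {s : Finset κ} {f : κ → LocalFun 𝕜 D c} (h : ∀ k, DependsOnlyOn p (f k)) :
    DependsOnlyOn p (∑ k ∈ s, f k) := fun n => by
  rw [map_sum]
  exact sum_mem fun k _ => h k n

theorem list_prod {l : List (LocalFun 𝕜 D c)} (h : ∀ f ∈ l, DependsOnlyOn p f) :
    DependsOnlyOn p l.prod := by
  induction l with
  | nil => exact one
  | cons f l ih =>
    rw [List.prod_cons]
    exact (h f (by simp)).mul (ih fun g hg => h g (by simp [hg]))

theorem vf {q : Jet D F I → LocalFun 𝕜 D c} (hq : ∀ y, DependsOnlyOn p (q y))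
    (hf : DependsOnlyOn p f) : DependsOnlyOn p (vf q f) :=
  formalSum fun y => (hq y).mul (hf.pd y)

theorem vpair (hf : DependsOnlyOn p f) (hg : DependsOnlyOn p g) (z : Lab F I) :
    DependsOnlyOn p (vpair z f g) :=
  formalSum fun α => (((hf.pd _).mul hg).mD α).smul _

theorem const (r : PowerSeries 𝕜) : DependsOnlyOn p (const r : LocalFun 𝕜 D c) := fun n => by
  rw [ProperFormalism.const, PowerSeries.coeff_map]
  exact Subalgebra.algebraMap_mem _ _

end DependsOnlyOn

theorem IsDer.const {r : ZMod 2} {T : LocalFun 𝕜 D c →ₗ[𝕜] LocalFun 𝕜 D c} (hT : IsDer r T)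
    (hX : XLin T) (a : PowerSeries 𝕜) : T (const a) = 0 :=
  (DependsOnlyOn.const (p := fun _ => False) a).der_eq hT (IsDer.zero r) hX XLin.zero
    fun _ h => h.elim

theorem IsHom.const {T : LocalFun 𝕜 D c →ₗ[𝕜] LocalFun 𝕜 D c} (hT : IsHom T)
    (hX : XLin T) (a : PowerSeries 𝕜) : T (const a) = const a :=
  (DependsOnlyOn.const (p := fun _ => False) a).hom_eq hT IsHom.id hX XLin.id
    fun _ h => h.elim

theorem HasPar.const (a : PowerSeries 𝕜) : HasPar 0 (const a : LocalFun 𝕜 D c) := fun r => by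
  rw [IsHom.const ⟨pa_one r, pa_mul r⟩ (XLin.pa r)]
  simp

theorem HasPar.list_prod {κ : Type x} (l : List κ) {f : κ → LocalFun 𝕜 D c} {p : κ → ZMod 2}
    (h : ∀ k, HasPar (p k) (f k)) : HasPar (l.map p).sum (l.map f).prod := by
  induction l with
  | nil => simpa using HasPar.one
  | cons k l ih => simpa using (h k).mul ih

end DependsOnlyOn

/-! ### Statistics and ghost number. -/

section Degrees

variable {d e : Deg} {f g : LocalFun 𝕜 D c}

theorem monomial_mem_homog (l : List (Jet D F I)) :
    ((l.map gen).prod : JetAlg 𝕜 D c) ∈ homog 𝕜 D c (l.map fun y => c.deg y.1).sum :=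
  Submodule.subset_span ⟨l, rfl, rfl⟩

theorem mul_mem_homog {a b : JetAlg 𝕜 D c} (ha : a ∈ homog 𝕜 D c d) (hb : b ∈ homog 𝕜 D c e) :
    a * b ∈ homog 𝕜 D c (d + e) := by
  induction ha using Submodule.span_induction with
  | mem a ha =>
    obtain ⟨l, rfl, rfl⟩ := ha
    induction hb using Submodule.span_induction with
    | mem b hb =>
      obtain ⟨m, rfl, rfl⟩ := hb
      have := monomial_mem_homog (𝕜 := 𝕜) (c := c) (l ++ m)
      simpa using this
    | zero => simp
    | add b b' _ _ hb hb' => rw [mul_add]; exact add_mem hb hb'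
    | smul r b _ hb => rw [mul_smul_comm]; exact Submodule.smul_mem _ _ hb
  | zero => simp
  | add a a' _ _ ha ha' => rw [add_mul]; exact add_mem ha ha'
  | smul r a _ ha => rw [smul_mul_assoc]; exact Submodule.smul_mem _ _ ha

theorem gen_mem_homog (y : Jet D F I) : (gen y : JetAlg 𝕜 D c) ∈ homog 𝕜 D c (c.deg y.1) := by
  have := monomial_mem_homog (𝕜 := 𝕜) (c := c) [y]
  simpa using this

theorem totalD_mem_homog (μ : Fin D) {b : JetAlg 𝕜 D c} (hb : b ∈ homog 𝕜 D c d) :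
    totalD μ b ∈ homog 𝕜 D c d := by
  induction hb using Submodule.span_induction with
  | mem b hb =>
    obtain ⟨l, rfl, rfl⟩ := hb
    induction l with
    | nil => simp [totalD, leftDer_one]
    | cons y l ih =>
      obtain ⟨z, α⟩ := y
      simp only [List.map_cons, List.prod_cons, List.sum_cons, totalD_mul, totalD_gen]
      exact add_mem (mul_mem_homog (gen_mem_homog (z, α + Pi.single μ 1)) (monomial_mem_homog l))
        (mul_mem_homog (gen_mem_homog (z, α)) ih)
  | zero => simp
  | add a b _ _ ha hb => rw [map_add]; exact add_mem ha hb
  | smul r b _ hb => rw [map_smul]; exact Submodule.smul_mem _ _ hb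

namespace HasDeg

theorem hasPar (hf : HasDeg d f) : HasPar d.1 f := by
  intro r
  ext n
  rw [pa, coeff_ow]
  have hb := hf n
  simp only [AlgHom.toLinearMap_apply, LinearMap.map_smul_of_tower]
  generalize PowerSeries.coeff n f = b at hb ⊢
  clear hf
  induction hb using Submodule.span_induction with
  | mem b hb =>
    obtain ⟨l, rfl, rfl⟩ := hb
    rw [par_monomial]
    congr 2
    induction l with
    | nil => simp
    | cons y l ih => simp [ih]
  | zero => simp
  | add a b _ _ ha hb => rw [map_add, ha, hb, smul_add]
  | smul r' b _ hb => rw [map_smul, hb, smul_comm]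

theorem add (hf : HasDeg d f) (hg : HasDeg d g) : HasDeg d (f + g) := fun n => by
  rw [map_add]; exact add_mem (hf n) (hg n)

theorem mul (hf : HasDeg d f) (hg : HasDeg e g) : HasDeg (d + e) (f * g) := fun n => by
  rw [PowerSeries.coeff_mul]
  exact sum_mem fun k _ => mul_mem_homog (hf _) (hg _)

theorem one : HasDeg 0 (1 : LocalFun 𝕜 D c) := fun n => by
  rw [PowerSeries.coeff_one]
  split_ifs
  · simpa using monomial_mem_homog (𝕜 := 𝕜) (c := c) []
  · exact zero_mem _

theorem var (z : Lab F I) : HasDeg (c.deg z) (var z : LocalFun 𝕜 D c) := fun n => by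
  rw [ProperFormalism.var, PowerSeries.coeff_C]
  split_ifs
  · exact gen_mem_homog (z, 0)
  · exact zero_mem _

theorem mD (hf : HasDeg d f) (α : Fin D → ℕ) : HasDeg d (mD α f) := by
  induction α using multiIndex_induction with
  | zero => rwa [mD_zero]
  | add_single α μ ih =>
    intro n
    rw [mD_add_single, tD, coeff_ow]
    exact totalD_mem_homog μ (ih n)

theorem wf (hf : HasDeg d f) (wt : Lab F I → ℕ) (φ : ℕ → 𝕜) : HasDeg d (wf wt φ f) := by
  intro n
  rw [ProperFormalism.wf, coeff_ow]
  have hb := hf n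
  generalize PowerSeries.coeff n f = b at hb ⊢
  induction hb using Submodule.span_induction with
  | mem b hb =>
    obtain ⟨l, rfl, rfl⟩ := hb
    rw [weightOp_monomial]
    exact Submodule.smul_mem _ _ (monomial_mem_homog l)
  | zero => simp
  | add a b _ _ ha hb => rw [map_add]; exact add_mem ha hb
  | smul r' b _ hb => rw [map_smul]; exact Submodule.smul_mem _ _ hb

theorem subst [CharZero 𝕜] {s : Lab F I → LocalFun 𝕜 D c} (hs : ∀ z, HasPar (c.deg z).1 (s z))
    (hs' : ∀ z, HasDeg (c.deg z) (s z)) (hf : HasDeg d f) : HasDeg d (subst s hs f) := by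
  have key : ∀ b ∈ homog 𝕜 D c d, HasDeg d (ProperFormalism.subst s hs (PowerSeries.C b)) := by
    clear hf
    intro b hb
    induction hb using Submodule.span_induction with
    | mem b hb =>
      obtain ⟨l, rfl, rfl⟩ := hb
      induction l with
      | nil =>
        simp only [List.map_nil, List.prod_nil, List.sum_nil, map_one]
        rw [(IsHom.subst s hs).1]
        exact one
      | cons y l ih =>
        simp only [List.map_cons, List.prod_cons, List.sum_cons, map_mul]
        rw [(IsHom.subst s hs).2, ← jet, subst_jet]
        exact ((hs' y.1).mD y.2).mul ih
    | zero => simp only [map_zero]; exact fun n => zero_mem _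
    | add a b _ _ ha hb => rw [map_add, map_add]; exact ha.add hb
    | smul r' b _ hb =>
      rw [C_smul, map_smul]
      intro n
      have := Submodule.smul_mem _ r' (hb n)
      simpa using this
  intro n
  rw [ProperFormalism.subst, coeff_extX]
  refine sum_mem fun k _ => ?_
  have := key _ (hf k.2) k.1
  rwa [ProperFormalism.subst, extX_C] at this

end HasDeg

theorem proj0_dependsOnlyOn {wt : Lab F I → ℕ} {p : Lab F I → Prop} (h : ∀ z, wt z = 0 → p z)
    (f : LocalFun 𝕜 D c) : DependsOnlyOn p (proj0 wt f) := by
  intro n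
  rw [proj0, wf, coeff_ow]
  generalize PowerSeries.coeff n f = b
  have : b ∈ Submodule.span 𝕜 (Set.range fun l : List (Jet D F I) =>
      ((l.map gen).prod : JetAlg 𝕜 D c)) := by
    rw [span_monomials]
    exact Submodule.mem_top
  induction this using Submodule.span_induction with
  | mem b hb =>
    obtain ⟨l, rfl⟩ := hb
    simp only [weightOp_monomial]
    split_ifs with hl
    · rw [one_smul]
      apply Subalgebra.list_prod_mem
      intro b hb
      obtain ⟨y, hy, rfl⟩ := List.mem_map.1 hb
      apply gen_mem_polyIn
      apply h
      exact List.sum_eq_zero_iff.1 hl _ (List.mem_map.2 ⟨y, hy, rfl⟩)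
    · rw [zero_smul]
      exact zero_mem _
  | zero => simp
  | add a b _ _ ha hb => rw [map_add]; exact add_mem ha hb
  | smul r' b _ hb => rw [map_smul]; exact Subalgebra.smul_mem _ hb _

end Degrees

/-! ### Brackets as evolutionary derivations. -/

/-- The label is a field `Φ` or `N`. -/
def IsFld : Lab F I → Prop
  | .Φ _ => True
  | .N _ => True
  | _ => False

theorem IsPhi.isFld {z : Lab F I} (h : IsPhi z) : IsFld z := by cases z <;> simp_all [IsPhi, IsFld]

theorem IsPhi.isPhiOrK {z : Lab F I} (h : IsPhi z) : IsPhiOrK z := by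
  cases z <;> simp_all [IsPhi, IsPhiOrK]

theorem not_isFld_src (u : F ⊕ I) : ¬ IsFld (src u : Lab F I) := by rcases u with a | i <;> simp [src, IsFld]

theorem formalSum_lab_eq (f : Lab F I → LocalFun 𝕜 D c) (hf : LF f) :
    formalSum f = (formalSum fun u => f (fld u)) + formalSum fun u => f (src u) := by
  classical
  have hfld : Function.Injective (fld : F ⊕ I → Lab F I) := fld_injective
  let f₁ : Lab F I → LocalFun 𝕜 D c := fun z => if z ∈ Set.range (fld : F ⊕ I → Lab F I) then f z else 0
  let f₂ : Lab F I → LocalFun 𝕜 D c := fun z => if z ∈ Set.range (fld : F ⊕ I → Lab F I) then 0 else f z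
  have hsrc : ∀ u : F ⊕ I, (src u : Lab F I) ∉ Set.range (fld : F ⊕ I → Lab F I) := by
    rintro u ⟨v, hv⟩
    exact fld_ne_src _ _ hv
  have h1 : LF f₁ := hf.of_forall fun n z h => by
    simp only [f₁]
    split_ifs
    · exact h
    · intro m _; simp
  have h2 : LF f₂ := hf.of_forall fun n z h => by
    simp only [f₂]
    split_ifs
    · intro m _; simp
    · exact h
  have e : f = fun z => f₁ z + f₂ z := by
    ext1 z
    simp only [f₁, f₂]
    split_ifs <;> simp
  rw [e, formalSum_add h1 h2, formalSum_lab f₁ (fun u => by simp only [f₁, if_neg (hsrc u)]),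
    formalSum_injective src_injective f₂]
  · congr 2
    · ext1 u
      simp only [f₁, f₂, if_pos (Set.mem_range_self u), add_zero]
    · ext1 u
      simp only [f₁, f₂, if_neg (hsrc u), zero_add]
  · intro z hz
    rcases exists_fld_or_src z with ⟨u, rfl⟩ | ⟨u, rfl⟩
    · simp only [f₂, if_pos (Set.mem_range_self u)]
    · exact absurd ⟨u, rfl⟩ hz

/-- The characteristic of the flow generated by a formal sum of local functionals. -/
def flow {κ : Type x} (X : κ → LocalFun 𝕜 D c) : Lab F I → LocalFun 𝕜 D c
  | .Φ a => -dRSum (.K a) X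
  | .K a => dRSum (.Φ a) X
  | .N i => -dRSum (.H i) X
  | .H i => dRSum (.N i) X

theorem flow_fld {κ : Type x} (X : κ → LocalFun 𝕜 D c) (u : F ⊕ I) :
    flow X (fld u) = -dRSum (src u) X := by rcases u with a | i <;> rfl

theorem flow_src {κ : Type x} (X : κ → LocalFun 𝕜 D c) (u : F ⊕ I) :
    flow X (src u) = dRSum (fld u) X := by rcases u with a | i <;> rfl

section Brackets

variable [Fintype F]

theorem sqAntiparen_eq {κ : Type x} (X : κ → LocalFun 𝕜 D c) (Y : LocalFun 𝕜 D c) :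
    sqAntiparen X Y = formalSum fun z => flow X z * dL z Y := by
  have hLF : LF fun z => flow X z * dL z Y := (LF.dL Y).mul_left _
  have h1 : LF fun u : F ⊕ I => flow X (fld u) * dL (fld u) Y := hLF.comp_injective fld_injective
  have h2 : LF fun u : F ⊕ I => flow X (src u) * dL (src u) Y := hLF.comp_injective src_injective
  rw [formalSum_lab_eq _ hLF, ← formalSum_add h1 h2, formalSum_sum (h1.add h2), formalSum_fintype,
    sqAntiparen]
  congr 1
  · apply Finset.sum_congr rfl
    intro a _
    simp only [fld, src, flow]
    noncomm_ring
  · congr 1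
    ext1 i
    simp only [fld, src, flow]
    noncomm_ring

/-- The squared antiparentheses are, up to total divergences, an evolutionary derivation. -/
theorem sqAntiparen_sub_mem_divs {κ : Type x} (X : κ → LocalFun 𝕜 D c) (Y : LocalFun 𝕜 D c) :
    sqAntiparen X Y - vf (ev (flow X)) Y ∈ divs 𝕜 D c := by
  rw [sqAntiparen_eq]
  exact formalSum_mul_dL_sub_mem_divs _ _

/-- The characteristic of the flow generated by `S(Φ, K)` in the usual formalism. -/
def usualFlow (S : LocalFun 𝕜 D c) : Lab F I → LocalFun 𝕜 D c
  | .Φ a => -dR (.K a) S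
  | .K a => dR (.Φ a) S
  | _ => 0

theorem antiparen_eq (S Y : LocalFun 𝕜 D c) :
    antiparen S Y = formalSum fun z => usualFlow S z * dL z Y := by
  have hLF : LF fun z => usualFlow S z * dL z Y := (LF.dL Y).mul_left _
  have h1 : LF fun u : F ⊕ I => usualFlow S (fld u) * dL (fld u) Y :=
    hLF.comp_injective fld_injective
  have h2 : LF fun u : F ⊕ I => usualFlow S (src u) * dL (src u) Y :=
    hLF.comp_injective src_injective
  rw [formalSum_lab_eq _ hLF, ← formalSum_add h1 h2, formalSum_sum (h1.add h2), formalSum_fintype,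
    antiparen]
  simp only [fld, src, usualFlow, zero_mul, add_zero, formalSum_zero]
  apply Finset.sum_congr rfl
  intro a _
  noncomm_ring

theorem antiparen_sub_mem_divs (S Y : LocalFun 𝕜 D c) :
    antiparen S Y - vf (ev (usualFlow S)) Y ∈ divs 𝕜 D c := by
  rw [antiparen_eq]
  exact formalSum_mul_dL_sub_mem_divs _ _

/-- The characteristic of a gauge transformation. -/
def gaugeChar (R : F → LocalFun 𝕜 D c) : Lab F I → LocalFun 𝕜 D c
  | .Φ a => R a
  | _ => 0

theorem gaugeVar_eq (R : F → LocalFun 𝕜 D c) (O : LocalFun 𝕜 D c) :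
    gaugeVar R O = vf (ev (gaugeChar R)) O := by
  have h : LF fun y : Jet D F I => ev (gaugeChar R) y * pd y O := (LF.pd O).mul_left _
  have h' : LF fun z : Lab F I => formalSum fun α => ev (gaugeChar R) (z, α) * pd (z, α) O := by
    intro n
    refine ((h n).image Prod.fst).subset ?_
    intro z hz
    by_contra hcon
    apply hz
    change PowerSeries.coeff n (formalSum fun α => ev (gaugeChar R) (z, α) * pd (z, α) O) = 0
    rw [coeff_formalSum]
    apply finsum_eq_zero_of_forall_eq_zero
    intro α
    by_contra h0
    exact hcon ⟨(z, α), h0, rfl⟩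
  rw [vf_apply, formalSum_prod h, formalSum_lab, formalSum_sum (h'.comp_injective fld_injective),
    formalSum_fintype]
  · have e : ∀ i : I, (formalSum fun α : Fin D → ℕ => ev (gaugeChar R) (fld (.inr i), α) *
        pd (fld (.inr i), α) O) = 0 := by
      intro i
      simp [ev, gaugeChar, fld, formalSum_zero]
    simp only [e, formalSum_zero, add_zero]
    rfl
  · intro u
    rcases u with a | i <;> simp [ev, gaugeChar, src, formalSum_zero]

end Brackets

section Variations

theorem dR_of_even {f : LocalFun 𝕜 D c} (hf : HasPar 0 f) (z : Lab F I) :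
    dR z f = sgn 𝕜 (c.deg z).1 (c.deg z).1 • vpair z f 1 := by
  rw [dR_eq, hf]
  simp

open Classical in
theorem vpair_mul_var {z : Lab F I} {f : LocalFun 𝕜 D c} (hf : IndepOf z f) (w : Lab F I)
    (g : LocalFun 𝕜 D c) :
    vpair z (f * var w) g = if w = z then pa (c.deg z).1 f * g else 0 := by
  rw [vpair_mul, hf.vpair, zero_add]
  split_ifs with h
  · subst h
    rw [formalSum_single _ 0]
    · rw [sg_zero, one_smul, mD_zero, var_eq, pd_jet_self, one_mul]
    · intro α hα
      rw [var_eq, pd_jet_of_ne, zero_mul, mul_zero, map_zero, smul_zero]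
      rintro h
      exact hα (Prod.mk.inj h).2.symm
  · rw [← formalSum_zero]
    congr 1
    ext1 α
    rw [var_eq, pd_jet_of_ne, zero_mul, mul_zero, map_zero, smul_zero]
    rintro h'
    exact h (Prod.mk.inj h').1

theorem IndepOf.var {z w : Lab F I} (h : w ≠ z) : IndepOf z (var w : LocalFun 𝕜 D c) := fun α => by
  rw [var_eq, pd_jet_of_ne]
  rintro h'
  exact h (Prod.mk.inj h').1

theorem vpair_hasPar {p : ZMod 2} {f : LocalFun 𝕜 D c} (hf : HasPar p f) (z : Lab F I) :
    HasPar ((c.deg z).1 + p) (vpair z f 1) := by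
  apply HasPar.formalSum (LF.vpair z f 1)
  intro α
  rw [mul_one]
  exact ((hf.apply_op (OpPar.pd (z, α))).mD α).smul _

/-- Exactly one of the field and its source is fermionic, so exactly one of the two factors is -1.
-/
theorem sgn_K_mul_sgn_Φ (a : F) : sgn 𝕜 (c.deg (.Φ a)).1 (c.deg (.Φ a)).1 *
    sgn 𝕜 (c.deg (.K a)).1 (c.deg (.K a)).1 = -1 := by
  have := deg_src (c := c) (.inl a)
  simp only [src, fld] at this
  rw [this, sgn_add_left, sgn_add_right, sgn_add_right, sgn_one_one,
    sgn_comm 1 (c.deg (.Φ a)).1, sgn_comm _ 1, sgn_one_left]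
  have h := sgn_mul_self (𝕜 := 𝕜) (c.deg (.Φ a : Lab F I)).1 (c.deg (.Φ a : Lab F I)).1
  generalize sgn 𝕜 (c.deg (.Φ a : Lab F I)).1 (c.deg (.Φ a : Lab F I)).1 = k at h ⊢
  linear_combination (-k * k - 1) * h

end Variations

/-! ### Gauge invariance and nilpotency from the usual master equation. -/

namespace GaugeTheory

variable [Fintype F] (T : GaugeTheory 𝕜 D c)

theorem R_hasPar (a : F) : HasPar (1 + (c.deg (.Φ a)).1) (T.R a) := by
  have := (T.R_deg a).hasPar
  rwa [Prod.fst_add, add_comm] at this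

theorem gaugeVar_dependsOn {O : LocalFun 𝕜 D c} (hO : DependsOnlyOn IsPhi O) :
    DependsOnlyOn IsPhi (vf (ev (gaugeChar T.R)) O) := by
  apply DependsOnlyOn.vf _ hO
  rintro ⟨z, α⟩
  apply DependsOnlyOn.mD
  cases z
  · exact T.R_dependsOn _
  all_goals exact DependsOnlyOn.zero

theorem gaugeChar_hasPar (z : Lab F I) : HasPar (1 + (c.deg z).1) (gaugeChar T.R z) := by
  cases z
  · exact T.R_hasPar _
  all_goals exact HasPar.zero

theorem R_mul_K_hasPar (a : F) : HasPar 0 (T.R a * var (.K a)) := by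
  have := (T.R_hasPar a).mul (HasPar.jet (𝕜 := 𝕜) (c := c) ((.K a, 0) : Jet D F I))
  have h : 1 + (c.deg (.Φ a)).1 + (c.deg (.K a)).1 = 0 := by
    have := deg_src (c := c) (.inl a)
    simp only [src, fld] at this
    rw [this]
    exact add_self_zmod_two _
  rwa [h] at this

theorem vpair_K_action (a : F) :
    vpair (.K a) T.action 1 = -(sgn 𝕜 (c.deg (.K a)).1 (c.deg (.K a)).1 • T.R a) := by
  classical
  rw [action, linearAction, vpair_sub_left, (T.S₀_dependsOn.indepOf (by simp [IsPhi])).vpair, zero_sub,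
    ← vpairL_apply, map_sum]
  congr 1
  rw [Finset.sum_eq_single a]
  · rw [vpairL_apply, vpair_mul_var ((T.R_dependsOn a).indepOf (by simp [IsPhi])), if_pos rfl, mul_one,
      T.R_hasPar]
    congr 2
    exact (deg_src (c := c) (.inl a)).symm
  · intro b _ hb
    rw [vpairL_apply, vpair_mul_var ((T.R_dependsOn b).indepOf (by simp [IsPhi])), if_neg]
    simpa using hb
  · simp

theorem action_hasPar : HasPar 0 T.action := by
  have h : HasPar 0 (∑ a : F, T.R a * var (.K a)) := by
    rw [← formalSum_fintype]
    exact HasPar.formalSum (LF.of_finite _) T.R_mul_K_hasPar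
  exact T.S₀_deg.hasPar.sub h

theorem dR_K_action (a : F) : dR (.K a) T.action = -T.R a := by
  rw [dR_of_even T.action_hasPar, vpair_K_action, smul_neg, smul_smul, sgn_mul_self, one_smul]

variable [CharZero 𝕜]

/-- The two halves of the bracket (S, S) coincide once the factors are reordered, so (S, S) is, up
to a divergence, twice the gauge variation of the action; the factor 2 is invertible. -/
theorem gaugeVar_action_mem_divs : vf (ev (gaugeChar T.R)) T.action ∈ divs 𝕜 D c := by
  have h1 : antiparen T.action T.action ∈ divs 𝕜 D c := by
    have := sameFunctional_iff.1 T.master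
    rwa [sub_zero] at this
  have h2 : antiparen T.action T.action =
      (2 : 𝕜) • formalSum fun z => gaugeChar T.R z * dL z T.action := by
    have hLF : LF fun u : F ⊕ I => gaugeChar T.R (fld u) * dL (fld u) T.action :=
      ((LF.dL T.action).mul_left _).comp_injective fld_injective
    rw [formalSum_lab _ (fun u => by rcases u with a | i <;> simp [src, gaugeChar]),
      formalSum_sum hLF, formalSum_fintype]
    simp only [fld, gaugeChar, zero_mul, formalSum_zero, add_zero]
    rw [antiparen, Finset.smul_sum]
    apply Finset.sum_congr rfl
    intro a _
    rw [T.dR_K_action, dL_eq, dL_eq, T.vpair_K_action, dR_of_even T.action_hasPar]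
    have hE : HasPar (c.deg (.Φ a)).1 (vpair (.Φ a) T.action 1) := by
      simpa using vpair_hasPar T.action_hasPar (.Φ a)
    -- The statistics of the two factors are p and p + 1, and p (p + 1) is even, so they commute.
    have hcomm : vpair (.Φ a) T.action 1 * T.R a = T.R a * vpair (.Φ a) T.action 1 := by
      rw [hE.mul_comm, T.R_hasPar, sgn_add_right, sgn_comm _ 1, sgn_one_left, sgn_mul_self, one_smul]
    rw [mul_neg, smul_mul_smul_comm, sgn_K_mul_sgn_Φ, hcomm, neg_one_smul, neg_neg, neg_mul,
      sub_neg_eq_add, two_smul]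
  have h3 := formalSum_mul_dL_sub_mem_divs (gaugeChar T.R) T.action
  rw [h2] at h1
  have h4 : (formalSum fun z => gaugeChar T.R z * dL z T.action) ∈ divs 𝕜 D c := by
    have := Submodule.smul_mem _ (2 : 𝕜)⁻¹ h1
    rwa [smul_smul, inv_mul_cancel₀ two_ne_zero, one_smul] at this
  simpa using sub_mem h4 h3

/-- The weight that counts the sources `K`. -/
def _root_.ProperFormalism.weightK : Lab F I → ℕ
  | .K _ => 1
  | _ => 0

theorem gaugeVar_action_eq : vf (ev (gaugeChar T.R)) T.action = vf (ev (gaugeChar T.R)) T.S₀ -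
    ∑ a : F, vf (ev (gaugeChar T.R)) (T.R a) * var (.K a) := by
  rw [action, linearAction, map_sub, map_sum]
  congr 1
  apply Finset.sum_congr rfl
  intro a _
  rw [IsDer.vf (HasPar.ev T.gaugeChar_hasPar), vf_ev_var]
  simp [gaugeChar]

/-- This is the part of the previous statement without sources; setting K = 0 commutes with total
derivatives and so preserves divergences. -/
theorem gaugeVar_S₀_mem_divs : vf (ev (gaugeChar T.R)) T.S₀ ∈ divs 𝕜 D c := by
  have h := map_mem_divs (proj0_tD weightK) T.gaugeVar_action_mem_divs
  rw [gaugeVar_action_eq, map_sub, map_sum] at h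
  have h1 : proj0 weightK (vf (ev (gaugeChar T.R)) T.S₀) = vf (ev (gaugeChar T.R)) T.S₀ :=
    (T.gaugeVar_dependsOn T.S₀_dependsOn).hom_eq (IsHom.proj0 _) IsHom.id (XLin.proj0 _) XLin.id
      (by
        rintro ⟨z, α⟩ hz
        rw [proj0_jet, if_pos]
        · rfl
        · cases z <;> simp_all [IsPhi, weightK])
  have h2 : ∀ a : F, proj0 weightK (vf (ev (gaugeChar T.R)) (T.R a) * var (.K a)) = 0 := by
    intro a
    rw [proj0_mul, var_eq, proj0_jet, if_neg (by simp [weightK]), mul_zero]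
  simpa [h1, h2] using h

/-- The part linear in K is a divergence too, so its functional derivative with respect to K
vanishes. As this derivative strips off the source, nilpotency holds as an exact equation and not
merely modulo divergences. -/
theorem gaugeVar_R (b : F) : vf (ev (gaugeChar T.R)) (T.R b) = 0 := by
  classical
  have h : (∑ a : F, vf (ev (gaugeChar T.R)) (T.R a) * var (.K a)) ∈ divs 𝕜 D c := by
    have := sub_mem T.gaugeVar_S₀_mem_divs T.gaugeVar_action_mem_divs
    rwa [gaugeVar_action_eq, sub_sub_cancel] at this
  have h1 := vpair_one_of_mem_divs h (.K b)
  rw [← vpairL_apply, map_sum, Finset.sum_eq_single b] at h1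
  · rw [vpairL_apply, vpair_mul_var ((T.gaugeVar_dependsOn (T.R_dependsOn b)).indepOf (by simp [IsPhi])),
      if_pos rfl, mul_one] at h1
    have h2 := congrArg (pa (c.deg (.K b)).1) h1
    rwa [pa_pa, add_self_zmod_two, pa_zero, map_zero] at h2
  · intro a _ ha
    rw [vpairL_apply, vpair_mul_var ((T.gaugeVar_dependsOn (T.R_dependsOn a)).indepOf (by simp [IsPhi])),
      if_neg]
    simpa using ha
  · simp

theorem gaugeVar_gaugeVar (f : LocalFun 𝕜 D c) :
    vf (ev (gaugeChar T.R)) (vf (ev (gaugeChar T.R)) f) = 0 := by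
  apply sq_eq_zero_of_var T.gaugeChar_hasPar
  intro z
  cases z
  · exact T.gaugeVar_R _
  all_goals exact map_zero _

end GaugeTheory

/-! ### Finite linear combinations and variations of products. -/

/-- The linear combination of the variables `s i` with the coefficients `v i`. -/
def lin (s : I → LocalFun 𝕜 D c) : (I →₀ 𝕜) →ₗ[𝕜] LocalFun 𝕜 D c := Finsupp.linearCombination 𝕜 s

theorem lin_single (s : I → LocalFun 𝕜 D c) (i : I) : lin s (Finsupp.single i 1) = s i := by
  simp [lin]

theorem lin_apply_eq_formalSum (s : I → LocalFun 𝕜 D c) (v : I →₀ 𝕜) :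
    lin s v = formalSum fun i => v i • s i := by
  ext n
  rw [coeff_formalSum, lin, Finsupp.linearCombination_apply, Finsupp.sum, map_sum,
    finsum_eq_sum_of_support_subset]
  intro i hi
  simp only [Function.mem_support] at hi
  rw [Finset.mem_coe, Finsupp.mem_support_iff]
  rintro h
  simp [h] at hi

theorem map_lin (s : I → LocalFun 𝕜 D c) (T : LocalFun 𝕜 D c →ₗ[𝕜] LocalFun 𝕜 D c) (v : I →₀ 𝕜) :
    T (lin s v) = lin (fun i => T (s i)) v := by
  have : T ∘ₗ lin s = lin fun i => T (s i) := by
    ext i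
    simp [lin]
  exact DFunLike.congr_fun this v

theorem lin_comp (s : I → LocalFun 𝕜 D c) (A : (I →₀ 𝕜) →ₗ[𝕜] (I →₀ 𝕜)) (v : I →₀ 𝕜) :
    lin (fun i => lin s (A (Finsupp.single i 1))) v = lin s (A v) := by
  have : lin (fun i => lin s (A (Finsupp.single i 1))) = lin s ∘ₗ A := by
    ext1 i
    ext1
    simp [lin]
  exact DFunLike.congr_fun this v

section Variations

theorem vpair_mul_of_hasPar [CharZero 𝕜] {p p' : ZMod 2} {f f' : LocalFun 𝕜 D c} (hf : HasPar p f)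
    (hf' : HasPar p' f') (z : Lab F I) :
    vpair z (f * f') 1 = vpair z f f' + sgn 𝕜 p p' • vpair z f' f := by
  rw [vpair_mul, mul_one]
  congr 1
  rw [vpair, smul_formalSum _ (LF.vpair z f' f)]
  congr 1
  ext1 α
  rw [mul_one, hf, smul_mul_assoc, hf.mul_comm, hf'.apply_op (OpPar.pd (z, α)), smul_mul_assoc,
    smul_smul, map_smul, smul_comm, sgn_add_right, sgn_comm p (c.deg z).1, ← mul_assoc, sgn_mul_self,
    one_mul]

theorem IsHom.map_vpair_eq_zero {P : LocalFun 𝕜 D c →ₗ[𝕜] LocalFun 𝕜 D c} (hP : IsHom P)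
    (hX : XLin P) (hD : ∀ μ f, P (tD μ f) = tD μ (P f)) (z : Lab F I) (f : LocalFun 𝕜 D c)
    {g : LocalFun 𝕜 D c} (hg : P g = 0) : P (vpair z f g) = 0 := by
  rw [vpair, hX.map_formalSum (LF.vpair z f g), ← formalSum_zero]
  congr 1
  ext1 α
  rw [map_smul, comm_mD hD, hP.2, hg, mul_zero, map_zero, smul_zero]

/-- The variation of a product of two factors that are mapped to zero is mapped to zero. -/
theorem IsHom.map_vpair_mul_eq_zero {P : LocalFun 𝕜 D c →ₗ[𝕜] LocalFun 𝕜 D c} (hP : IsHom P)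
    (hX : XLin P) (hD : ∀ μ f, P (tD μ f) = tD μ (P f)) (z : Lab F I) {p : ZMod 2}
    {f g : LocalFun 𝕜 D c} (hp : HasPar p f) (hf : P f = 0) (hg : P g = 0) :
    P (vpair z (f * g) 1) = 0 := by
  rw [vpair, hX.map_formalSum (LF.vpair z (f * g) 1), ← formalSum_zero]
  congr 1
  ext1 α
  rw [map_smul, comm_mD hD, mul_one, pd_mul, map_add, hP.2, hP.2, hg, hp, map_smul, hf, mul_zero,
    smul_zero, zero_mul, add_zero, map_zero, smul_zero]

open Classical in
theorem vpair_var (z w : Lab F I) (g : LocalFun 𝕜 D c) :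
    vpair z (var w) g = if w = z then g else 0 := by
  have h := vpair_mul_var (z := z) (f := 1) (fun α => (IsDer.pd (z, α)).one) w g
  simpa using h

end Variations

/-! ### The flow of the proper action and its nilpotency. -/

namespace CompositeSector

variable [Fintype F] {T : GaugeTheory 𝕜 D c} {J : Type x} (P : CompositeSector T J)

/-- The transformations of all the fields. -/
def transf : F ⊕ I → LocalFun 𝕜 D c
  | .inl a => T.R a
  | .inr i => gaugeVar T.R (P.O i)

/-- The source-independent terms of the proper action. -/
def potential : Unit ⊕ (I × I) ⊕ J → LocalFun 𝕜 D c
  | .inl _ => T.S₀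
  | .inr (.inl (i, j)) => (1 / 2 * P.entry i j : 𝕜) • (P.tildeN i * P.tildeN j)
  | .inr (.inr k) => const (P.ρ k) * P.monomial k * P.Oinv k

theorem transf_dependsOn (u : F ⊕ I) : DependsOnlyOn IsPhi (P.transf u) := by
  rcases u with a | i
  · exact T.R_dependsOn a
  · rw [transf, gaugeVar_eq]
    exact T.gaugeVar_dependsOn (P.O_dependsOn i)

theorem transf_LF : LF P.transf := by
  apply LF.sum (LF.of_finite _)
  simp only [transf, gaugeVar_eq]
  exact LF.map P.O_finite fun i => XLin.vf _

theorem tildeN_hasPar (i : I) : HasPar (c.composite i).1 (P.tildeN i) :=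
  (HasPar.jet (𝕜 := 𝕜) (c := c) ((.N i, 0) : Jet D F I)).sub (P.O_deg i).hasPar

theorem tildeN_dependsOn (i : I) : DependsOnlyOn IsFld (P.tildeN i) :=
  (DependsOnlyOn.var (by trivial)).sub ((P.O_dependsOn i).mono fun _ => IsPhi.isFld)

theorem monomial_hasPar (k : J) :
    HasPar ((P.mon k).map fun q => (c.composite q.1).1).sum (P.monomial k) :=
  HasPar.list_prod _ fun q => (P.tildeN_hasPar q.1).mD q.2

theorem monomial_dependsOn (k : J) : DependsOnlyOn IsFld (P.monomial k) := by
  apply DependsOnlyOn.list_prod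
  intro f hf
  obtain ⟨q, -, rfl⟩ := List.mem_map.1 hf
  exact (P.tildeN_dependsOn q.1).mD q.2

theorem composite_eq_of_entry_ne {i j : I} (h : P.entry i j ≠ 0) :
    (c.composite i).1 = (c.composite j).1 := by
  have := congrArg Prod.fst (P.A_deg i j h)
  generalize (c.composite i) = p at this ⊢
  generalize (c.composite j) = q at this ⊢
  simp only [Prod.fst_add, Prod.fst_zero] at this
  generalize p.1 = p at this ⊢
  generalize q.1 = q at this ⊢
  revert p q
  decide

theorem potential_hasPar (l : Unit ⊕ (I × I) ⊕ J) : HasPar 0 (P.potential l) := by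
  rcases l with _ | ⟨i, j⟩ | k
  · exact T.S₀_deg.hasPar
  · by_cases h : P.entry i j = 0
    · simp only [potential, h, mul_zero, zero_smul]
      exact HasPar.zero
    · have := ((P.tildeN_hasPar i).mul (P.tildeN_hasPar j)).smul (1 / 2 * P.entry i j)
      rwa [P.composite_eq_of_entry_ne h, add_self_zmod_two] at this
  · have := ((HasPar.const (𝕜 := 𝕜) (D := D) (c := c) (P.ρ k)).mul (P.monomial_hasPar k)).mul (P.Oinv_deg k).hasPar
    have e : ((P.mon k).map fun q => c.composite q.1).sum.1 =
        ((P.mon k).map fun q => (c.composite q.1).1).sum := by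
      rw [← AddMonoidHom.coe_fst, map_list_sum, List.map_map]
      rfl
    rwa [Prod.fst_neg, e, zero_add, add_neg_cancel] at this

theorem potential_dependsOn (l : Unit ⊕ (I × I) ⊕ J) : DependsOnlyOn IsFld (P.potential l) := by
  rcases l with _ | ⟨i, j⟩ | k
  · exact T.S₀_dependsOn.mono fun _ => IsPhi.isFld
  · exact ((P.tildeN_dependsOn i).mul (P.tildeN_dependsOn j)).smul _
  · exact ((DependsOnlyOn.const _).mul (P.monomial_dependsOn k)).mul
      ((P.Oinv_dependsOn k).mono fun _ => IsPhi.isFld)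

/-- Columns of A are finitely supported because A acts on finitely supported vectors; graded
symmetry transfers this to the rows. -/
theorem entry_finite (i : I) : {j | P.entry i j ≠ 0}.Finite := by
  refine (P.A (Finsupp.single i 1)).support.finite_toSet.subset fun j hj => ?_
  rw [Finset.mem_coe, Finsupp.mem_support_iff]
  intro h
  exact hj (by rw [entry, P.A_symm, h, mul_zero])

/-- The quadratic term runs over possibly infinitely many pairs, but its variation is locally
finite: varying N selects at most one row of A, which is finite, and varying O leaves finitely many
rows at each order. -/
theorem LF_entry_smul_vpair (z : Lab F I) :
    LF fun k : I × I => P.entry k.1 k.2 • vpair z (P.tildeN k.1) (P.tildeN k.2) := by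
  classical
  have h1 : LF fun k : I × I => P.entry k.1 k.2 • vpair z (var (.N k.1)) (P.tildeN k.2) := by
    apply LF.of_support_finite
    by_cases hz : ∃ i, z = .N i
    · obtain ⟨i, rfl⟩ := hz
      refine ((Set.finite_singleton i).prod (P.entry_finite i)).subset ?_
      rintro ⟨i', j⟩ h
      simp only [vpair_var, Lab.N.injEq, Set.mem_ofPred_eq] at h
      by_cases hi : i' = i
      · subst hi
        refine ⟨rfl, ?_⟩
        rintro h0
        exact h (by rw [h0, zero_smul])
      · exact absurd (by simp [hi]) h
    · convert Set.finite_empty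
      ext k
      simp only [vpair_var, Set.mem_ofPred_eq, Set.mem_empty_iff_false, iff_false, not_not]
      rw [if_neg, smul_zero]
      rintro h
      exact hz ⟨_, h.symm⟩
  have h2 : LF fun k : I × I => P.entry k.1 k.2 • vpair z (P.O k.1) (P.tildeN k.2) := by
    apply LF.prod P.O P.O_finite
    · intro n i j h m hm
      have := (XLin.vpairL z (P.tildeN j)).vanishTo h m hm
      rw [vpairL_apply] at this
      simp [this]
    · intro i
      apply LF.of_support_finite
      refine (P.entry_finite i).subset ?_
      rintro j hj h0
      exact hj (by simp [h0])
  refine (h1.sub h2).of_forall fun n k h => ?_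
  rwa [tildeN, vpair_sub_left, smul_sub]

theorem LF_vpair_transf (z : Lab F I) : LF fun u => vpair z (P.transf u * var (src u)) 1 :=
  P.transf_LF.map fun u => (XLin.vpairL z 1).comp (XLin.mulRight (var (src u)))

theorem transf_hasPar (u : F ⊕ I) : HasPar (c.deg (src u)).1 (P.transf u) := by
  rw [deg_src]
  rcases u with a | i
  · exact T.R_hasPar a
  · rw [transf, gaugeVar_eq]
    exact (P.O_deg i).hasPar.apply_op (OpPar.vf (HasPar.ev T.gaugeChar_hasPar))

variable [CharZero 𝕜]

/-- Graded symmetry of A absorbs the sign from varying the second factor, so the two contributions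
differ only by the exchange of the indices. -/
theorem vpair_quadratic (z : Lab F I) (i j : I) :
    vpair z (P.potential (.inr (.inl (i, j)))) 1 = (1 / 2 : 𝕜) •
      (P.entry i j • vpair z (P.tildeN i) (P.tildeN j) +
        P.entry j i • vpair z (P.tildeN j) (P.tildeN i)) := by
  rw [potential, vpair_smul_left, vpair_mul_of_hasPar (P.tildeN_hasPar i) (P.tildeN_hasPar j),
    mul_smul, smul_add, smul_smul (P.entry i j)]
  congr 3
  rw [entry, entry, P.A_symm j i, sgn_comm, mul_comm]

theorem LF_vpair_potential (z : Lab F I) : LF fun l => vpair z (P.potential l) 1 := by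
  apply LF.sum (LF.of_finite _)
  apply LF.sum
  · have h := P.LF_entry_smul_vpair z
    have h' := h.comp_injective (e := Prod.swap) Prod.swap_injective
    have := (h.add h').smul fun _ => (1 / 2 : 𝕜)
    refine this.of_forall fun n k hk => ?_
    obtain ⟨i, j⟩ := k
    rwa [P.vpair_quadratic]
  · have h : LF fun k => (const (P.ρ k) : LocalFun 𝕜 D c) := fun n =>
      (P.ρ_finite n).subset fun k hk h0 => hk (by
        change PowerSeries.coeff n (const (P.ρ k) : LocalFun 𝕜 D c) = 0
        rw [const, PowerSeries.coeff_map, h0, map_zero])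
    exact ((h.mul_right P.monomial).mul_right P.Oinv).map fun k => XLin.vpairL z 1

/-- Regroups the termwise derivative of the proper action into a source-independent part and a part
linear in the sources, the form to which `vf_sq_eq_zero` applies. -/
theorem dRSum_properAction (z : Lab F I) : dRSum z P.properAction =
    sgn 𝕜 (c.deg z).1 (c.deg z).1 • ((formalSum fun l => vpair z (P.potential l) 1) -
      formalSum fun u => vpair z (P.transf u * var (src u)) 1) := by
  have hpar : ∀ u, HasPar 0 (P.transf u * var (src u)) := fun u => by
    have := (P.transf_hasPar u).mul (HasPar.jet (𝕜 := 𝕜) (c := c) ((src u, 0) : Jet D F I))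
    rwa [add_self_zmod_two] at this
  have hb := P.LF_vpair_potential z
  have hr := P.LF_vpair_transf z
  have e : ∀ k, dR z (P.properAction k) = sgn 𝕜 (c.deg z).1 (c.deg z).1 •
      vpair z (P.properAction k) 1 := by
    intro k
    apply dR_of_even
    rcases k with _ | i | ⟨i, j⟩ | k
    · exact T.action_hasPar
    · exact (hpar (.inr i)).neg
    · exact P.potential_hasPar (.inr (.inl (i, j)))
    · exact P.potential_hasPar (.inr (.inr k))
  have hb' := hb.comp_injective Sum.inr_injective
  have hr' := hr.comp_injective Sum.inr_injective
  have h1 : ∀ i, vpair z (P.properAction (.inr (.inl i))) 1 =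
      -vpair z (P.transf (.inr i) * var (src (.inr i))) 1 := fun i =>
    map_neg (vpairL z 1) _
  have h2 : vpair z (P.properAction (.inl ())) 1 = vpair z (P.potential (.inl ())) 1 -
      ∑ a, vpair z (P.transf (.inl a) * var (src (.inl a))) 1 := by
    simp only [← vpairL_apply, ← map_sum, ← map_sub]
    rfl
  have hpot : ∀ k, P.properAction (.inr (.inr k)) = P.potential (.inr k) := by
    rintro (⟨i, j⟩ | k) <;> rfl
  have h3 : LF fun k => vpair z (P.properAction (.inr k)) 1 := by
    apply LF.sum
    · simp only [h1]
      exact hr'.neg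
    · simp only [hpot]
      exact hb'
  have h4 : LF fun k => vpair z (P.properAction k) 1 := LF.sum (LF.of_finite _) h3
  rw [dRSum]
  simp only [e]
  rw [← smul_formalSum _ h4, formalSum_sum h4, formalSum_sum h3, formalSum_sum hb, formalSum_sum hr]
  have h5 : (formalSum fun i => -vpair z (P.transf (.inr i) * var (src (.inr i))) 1) =
      -formalSum fun i => vpair z (P.transf (.inr i) * var (src (.inr i))) 1 := by
    have := smul_formalSum (-1) hr'
    simpa using this.symm
  have h6 : ∀ f : Unit → LocalFun 𝕜 D c, formalSum f = f () := fun f =>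
    formalSum_single f () fun k hk => absurd rfl hk
  rw [h6, h6]
  simp only [h1, h2, h5, hpot, formalSum_fintype]
  congr 1
  abel

theorem flow_fld_eq (u : F ⊕ I) : flow P.properAction (fld u) = P.transf u := by
  have h : ∀ l, vpair (src u) (P.potential l) 1 = 0 := fun l =>
    ((P.potential_dependsOn l).indepOf (not_isFld_src u)).vpair 1
  rw [flow_fld, dRSum_properAction]
  simp only [h, formalSum_zero, zero_sub]
  rw [formalSum_single _ u, vpair_mul_var, if_pos rfl, mul_one, P.transf_hasPar, smul_neg, neg_neg,
    smul_smul, sgn_mul_self, one_smul]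
  · exact (P.transf_dependsOn u).indepOf fun h => not_isFld_src u h.isFld
  · intro v hv
    rw [vpair_mul_var ((P.transf_dependsOn v).indepOf fun h => not_isFld_src u h.isFld), if_neg]
    exact fun h => hv (src_injective h)

theorem flow_src_eq (u : F ⊕ I) : flow P.properAction (src u) =
    sgn 𝕜 (c.deg (fld u)).1 (c.deg (fld u)).1 •
      ((formalSum fun l => vpair (fld u) (P.potential l) 1) -
        formalSum fun v => vpair (fld u) (P.transf v) (var (src v))) := by
  rw [flow_src, dRSum_properAction]
  congr 2
  congr 1
  ext1 v
  rw [vpair_mul_of_indep (IndepOf.var (fld_ne_src u v).symm), mul_one]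

theorem flow_hasPar (z : Lab F I) : HasPar (1 + (c.deg z).1) (flow P.properAction z) := by
  rcases exists_fld_or_src z with ⟨u, rfl⟩ | ⟨u, rfl⟩
  · rw [flow_fld_eq, ← deg_src]
    exact P.transf_hasPar u
  · have e : 1 + (c.deg (src u)).1 = (c.deg (fld u)).1 := by
      rw [deg_src, ← add_assoc, add_self_zmod_two, zero_add]
    rw [flow_src_eq, e]
    refine (HasPar.sub (HasPar.formalSum (P.LF_vpair_potential _) fun l => ?_)
      (HasPar.formalSum (P.transf_LF.map fun v => XLin.vpairL _ _) fun v => ?_)).smul _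
    · simpa using vpair_hasPar (P.potential_hasPar l) (fld u)
    · apply HasPar.formalSum (LF.vpair _ _ _)
      intro α
      have := (((P.transf_hasPar v).apply_op (OpPar.pd (fld u, α))).mul
        (HasPar.jet (𝕜 := 𝕜) (c := c) ((src v, 0) : Jet D F I))).mD α
      rw [add_assoc, add_self_zmod_two, add_zero] at this
      exact this.smul _

theorem vf_flow_of_isPhi {f : LocalFun 𝕜 D c} (hf : DependsOnlyOn IsPhi f) :
    vf (ev (flow P.properAction)) f = vf (ev (gaugeChar T.R)) f := by
  apply hf.der_eq (IsDer.vf (HasPar.ev P.flow_hasPar)) (IsDer.vf (HasPar.ev T.gaugeChar_hasPar))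
    (XLin.vf _) (XLin.vf _)
  rintro ⟨z, α⟩ hz
  rw [vf_jet, vf_jet, ev, ev]
  cases z with
  | Φ a => exact congrArg _ (P.flow_fld_eq (.inl a))
  | _ => exact hz.elim

/-- The coefficient of H is chosen so that N transforms exactly like the composite field that is
subtracted from it. -/
theorem vf_flow_tildeN (i : I) : vf (ev (flow P.properAction)) (P.tildeN i) = 0 := by
  rw [tildeN, map_sub, vf_ev_var, P.vf_flow_of_isPhi (P.O_dependsOn i), ← gaugeVar_eq, sub_eq_zero]
  exact P.flow_fld_eq (.inr i)

theorem vf_flow_transf (u : F ⊕ I) : vf (ev (flow P.properAction)) (P.transf u) = 0 := by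
  rw [P.vf_flow_of_isPhi (P.transf_dependsOn u)]
  rcases u with a | i
  · exact T.gaugeVar_R a
  · rw [transf, gaugeVar_eq]
    exact T.gaugeVar_gaugeVar _

theorem vf_flow_monomial (k : J) : vf (ev (flow P.properAction)) (P.monomial k) = 0 := by
  have hD := IsDer.vf (HasPar.ev P.flow_hasPar)
  have : ∀ l : List (I × (Fin D → ℕ)), vf (ev (flow P.properAction))
      (l.map fun q => orderwise (multiD q.2) (P.tildeN q.1)).prod = 0 := by
    intro l
    induction l with
    | nil => exact hD.one
    | cons q l ih =>
      have h : vf (ev (flow P.properAction)) (orderwise (multiD q.2) (P.tildeN q.1)) = 0 := by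
        change vf (ev (flow P.properAction)) (mD q.2 (P.tildeN q.1)) = 0
        rw [comm_mD (vf_ev_tD P.flow_hasPar), vf_flow_tildeN, map_zero]
      rw [List.map_cons, List.prod_cons, hD, h, ih, zero_mul, mul_zero, add_zero]
  exact this _

/-- The source-independent action is invariant up to a divergence by the usual master equation; the
other terms are strictly invariant, being built from invariant Ñ, constants and gauge-invariant
composite fields. -/
theorem vf_flow_potential (l : Unit ⊕ (I × I) ⊕ J) :
    vf (ev (flow P.properAction)) (P.potential l) ∈ divs 𝕜 D c := by
  have hD := IsDer.vf (HasPar.ev P.flow_hasPar)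
  rcases l with _ | ⟨i, j⟩ | k
  · rw [potential, P.vf_flow_of_isPhi T.S₀_dependsOn]
    exact T.gaugeVar_S₀_mem_divs
  · rw [potential, map_smul, hD, vf_flow_tildeN, vf_flow_tildeN, zero_mul, mul_zero, add_zero,
      smul_zero]
    exact zero_mem _
  · rw [potential, hD, hD, hD.const (XLin.vf _), vf_flow_monomial,
      P.vf_flow_of_isPhi (P.Oinv_dependsOn k), ← gaugeVar_eq, P.Oinv_invariant]
    simp

/-- The form in which the master equation of the proper action is used: it holds on local functions,
without divergences, so it can be combined with operators that act on integrands. -/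
theorem vf_flow_vf_flow (f : LocalFun 𝕜 D c) :
    vf (ev (flow P.properAction)) (vf (ev (flow P.properAction)) f) = 0 :=
  vf_sq_eq_zero P.flow_hasPar P.flow_fld_eq P.flow_src_eq
    (fun u v => (P.transf_dependsOn v).indepOf fun h => not_isFld_src u h.isFld)
    (fun u l => (P.potential_dependsOn l).indepOf (not_isFld_src u)) P.transf_LF
    (fun _ => P.LF_vpair_potential _) P.vf_flow_transf
    (fun u l => vpair_one_of_mem_divs (P.vf_flow_potential l) (fld u)) f

end CompositeSector

/-! ### Equations of motion of the composite sector. -/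

/-- The weight that counts the proper fields `N` and their sources `H`. -/
def weightNH : Lab F I → ℕ
  | .N _ => 1
  | .H _ => 1
  | _ => 0

theorem isPhiOrK_of_weightNH {z : Lab F I} (h : weightNH z = 0) : IsPhiOrK z := by
  cases z <;> simp_all [IsPhiOrK, weightNH]

theorem weightNH_eq_zero {z : Lab F I} (h : IsPhiOrK z) : weightNH z = 0 := by
  cases z <;> simp_all [IsPhiOrK, weightNH]

theorem proj0_eq_self {wt : Lab F I → ℕ} {p : Lab F I → Prop} (h : ∀ z, p z → wt z = 0)
    {f : LocalFun 𝕜 D c} (hf : DependsOnlyOn p f) : proj0 wt f = f :=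
  hf.hom_eq (IsHom.proj0 wt) IsHom.id (XLin.proj0 wt) XLin.id fun y hy => by
    rw [proj0_jet, if_pos (h _ hy)]
    rfl

theorem subst_eq_self [CharZero 𝕜] {s : Lab F I → LocalFun 𝕜 D c}
    (hs : ∀ z, HasPar (c.deg z).1 (s z)) {p : Lab F I → Prop} (h : ∀ z, p z → s z = var z)
    {f : LocalFun 𝕜 D c} (hf : DependsOnlyOn p f) : subst s hs f = f :=
  hf.hom_eq (IsHom.subst s hs) IsHom.id (XLin.subst s hs) XLin.id fun y hy => by
    rw [subst_jet, ev, h _ hy, var_eq, ← jet_eq_mD]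
    rfl

/-- An evolutionary derivation that shifts a weight by a constant. -/
theorem num_vf [CharZero 𝕜] {wt : Lab F I → ℕ} {p : ZMod 2} {q : Lab F I → LocalFun 𝕜 D c}
    (hq : ∀ z, HasPar (p + (c.deg z).1) (q z)) (a : 𝕜)
    (h : ∀ z, num wt (q z) = (wt z : 𝕜) • q z + a • q z) (f : LocalFun 𝕜 D c) :
    num wt (vf (ev q) f) = vf (ev q) (num wt f) + a • vf (ev q) f := by
  have hD := IsDer.vf (HasPar.ev hq)
  have hC := IsDer.comm (IsDer.num wt) hD (OpPar.num wt) (OpPar.vf (HasPar.ev hq))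
  rw [zero_add] at hC
  have hA : IsDer p (a • vf (ev q)) := fun f g => by
    simp only [LinearMap.smul_apply, hD f g, smul_add, smul_mul_assoc, mul_smul_comm]
  have hX := XLin.vf (ev q)
  have key := (hC.sub hA).eq_zero_of_var
    ((((XLin.num wt).comp hX).sub ((hX.comp (XLin.num wt)).smul _)).sub (hX.smul a))
    (fun μ f => by
      simp only [LinearMap.sub_apply, LinearMap.smul_apply, LinearMap.comp_apply, num_tD,
        vf_ev_tD hq, map_sub, map_smul])
    (fun z => by
      simp only [LinearMap.sub_apply, LinearMap.smul_apply, LinearMap.comp_apply, vf_ev_var,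
        sgn_zero_left, one_smul, h]
      rw [var_eq, num_jet, map_smul, vf_jet, ev_zero]
      abel)
  have := DFunLike.congr_fun key f
  simp only [LinearMap.sub_apply, LinearMap.smul_apply, LinearMap.comp_apply, sgn_zero_left,
    one_smul, LinearMap.zero_apply] at this
  rw [sub_sub, sub_eq_zero] at this
  exact this

theorem num_num_comm [CharZero 𝕜] (wt wt' : Lab F I → ℕ) (f : LocalFun 𝕜 D c) :
    num wt (num wt' f) = num wt' (num wt f) := by
  have key := (IsDer.comm (IsDer.num (𝕜 := 𝕜) (D := D) (c := c) wt) (IsDer.num wt') (OpPar.num wt)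
    (OpPar.num wt')).eq_zero
    (((XLin.num wt).comp (XLin.num wt')).sub (((XLin.num wt').comp (XLin.num wt)).smul _))
    (fun y => by
      simp only [LinearMap.sub_apply, LinearMap.comp_apply, num_jet, map_smul,
        sgn_zero_left, one_smul]
      rw [smul_comm, sub_self])
  have := DFunLike.congr_fun key f
  simpa [sub_eq_zero] using this

namespace CompositeSector

variable [Fintype F] {T : GaugeTheory 𝕜 D c} {J : Type x} (P : CompositeSector T J)

/-- The terms of the equations of motion of `N` of higher order. -/
def higher (i : I) : LocalFun 𝕜 D c := sgn 𝕜 (c.composite i).1 (c.composite i).1 •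
  formalSum fun k => vpair (.N i) (P.potential (.inr (.inr k))) 1

/-- The coefficients ρ have no constant term. Hence at leading order the equation of N is linear,
with the invertible matrix A. -/
theorem higher_vanishTo (i : I) : VanishTo 0 (P.higher i) := by
  have h : VanishTo 0 (formalSum fun k => vpair (.N i) (P.potential (.inr (.inr k))) 1) := by
    apply VanishTo.formalSum
    intro k
    apply (XLin.vpairL (.N i) 1).vanishTo
    have : VanishTo 0 (const (P.ρ k) : LocalFun 𝕜 D c) := fun m hm => by
      rw [const, PowerSeries.coeff_map, Nat.le_zero.1 hm, P.ρ_zero, map_zero]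
    exact (this.mul_right _).mul_right _
  exact (XLin.id.smul (sgn 𝕜 (c.composite i).1 (c.composite i).1)).vanishTo h

/-- The sign of the right functional derivative converts a row of A into a column, so the equation
of N involves A as an operator and its inverse can be applied. -/
theorem sgn_smul_entry (i j : I) :
    sgn 𝕜 (c.composite i).1 (c.composite i).1 * P.entry i j = P.A (Finsupp.single i 1) j := by
  have h := P.A_symm j i
  by_cases h0 : P.entry i j = 0
  · rw [h0, mul_zero, h]
    change _ = _ * P.entry i j
    rw [h0, mul_zero]
  · rw [h, P.composite_eq_of_entry_ne h0]
    rfl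

/-- Every term other than the source-independent action contains at least two factors Ñ, so one of
them survives a variation and is killed by `Z`. -/
theorem map_vpair_potential {Z : LocalFun 𝕜 D c →ₗ[𝕜] LocalFun 𝕜 D c} (hZ : IsHom Z) (hX : XLin Z)
    (hD : ∀ μ f, Z (tD μ f) = tD μ (Z f)) (hN : ∀ i, Z (P.tildeN i) = 0) (z : Lab F I) (l : (I × I) ⊕ J) :
    Z (vpair z (P.potential (.inr l)) 1) = 0 := by
  rcases l with ⟨i, j⟩ | k
  · rw [potential, vpair_smul_left, map_smul,
      hZ.map_vpair_mul_eq_zero hX hD z (P.tildeN_hasPar i) (hN i) (hN j), smul_zero]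
  · have hlen := P.mon_length k
    rw [potential, monomial]
    rcases hl : P.mon k with _ | ⟨q, _ | ⟨q', l⟩⟩
    · simp [hl] at hlen
    · simp [hl] at hlen
    have hq : ∀ q : I × (Fin D → ℕ), Z (orderwise (multiD q.2) (P.tildeN q.1)) = 0 := fun q => by
      change Z (mD q.2 (P.tildeN q.1)) = 0
      rw [comm_mD hD, hN, map_zero]
    -- The first two factors of the monomial are separated, the coefficient going with the first and
    -- everything else with the second, so that each group is killed by `Z`.
    rw [List.map_cons, List.map_cons, List.prod_cons, List.prod_cons, ← mul_assoc, mul_assoc]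
    refine hZ.map_vpair_mul_eq_zero hX hD z
      ((HasPar.const (P.ρ k)).mul ((P.tildeN_hasPar q.1).mD q.2)) ?_ ?_
    · change Z (const (P.ρ k) * orderwise (multiD q.2) (P.tildeN q.1)) = 0
      rw [hZ.2, hq, mul_zero]
    · rw [hZ.2, hZ.2, hq, zero_mul, zero_mul]

variable [CharZero 𝕜]

theorem flow_H (i : I) :
    flow P.properAction (.H i) = lin P.tildeN (P.A (Finsupp.single i 1)) + P.higher i := by
  classical
  have h1 : flow P.properAction (.H i) = sgn 𝕜 (c.composite i).1 (c.composite i).1 •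
      ((formalSum fun l => vpair (.N i) (P.potential l) 1) -
        formalSum fun v => vpair (.N i) (P.transf v) (var (src v))) := P.flow_src_eq (.inr i)
  have h2 : ∀ v, vpair (.N i) (P.transf v) (var (src v)) = 0 := fun v =>
    ((P.transf_dependsOn v).indepOf (by simp [IsPhi])).vpair _
  have hLF := P.LF_vpair_potential (.N i)
  have hLF' := hLF.comp_injective Sum.inr_injective
  have h3 : vpair (.N i) (P.potential (.inl ())) 1 = 0 :=
    (T.S₀_dependsOn.indepOf (by simp [IsPhi])).vpair _
  have h4 : ∀ f : Unit → LocalFun 𝕜 D c, formalSum f = f () := fun f =>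
    formalSum_single f () fun k hk => absurd rfl hk
  have hE := P.LF_entry_smul_vpair (.N i)
  have hE' := hE.comp_injective (e := Prod.swap) Prod.swap_injective
  -- The two halves from `vpair_quadratic` are exchanged by the swap of indices, which cancels the
  -- factor 1/2.
  have h5 : (formalSum fun k : I × I => vpair (.N i) (P.potential (.inr (.inl k))) 1) =
      formalSum fun k : I × I => P.entry k.1 k.2 • vpair (.N i) (P.tildeN k.1) (P.tildeN k.2) := by
    have e : (fun k : I × I => vpair (.N i) (P.potential (.inr (.inl k))) 1) = fun k : I × I =>
        (1 / 2 : 𝕜) • (P.entry k.1 k.2 • vpair (.N i) (P.tildeN k.1) (P.tildeN k.2) +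
          P.entry k.swap.1 k.swap.2 • vpair (.N i) (P.tildeN k.swap.1) (P.tildeN k.swap.2)) := by
      ext1 ⟨j, k⟩
      exact P.vpair_quadratic _ _ _
    have hswap := formalSum_equiv (Equiv.prodComm I I) fun k : I × I =>
      P.entry k.1 k.2 • vpair (.N i) (P.tildeN k.1) (P.tildeN k.2)
    simp only [Equiv.prodComm_apply] at hswap
    rw [e, ← smul_formalSum _ (hE.add hE'), formalSum_add hE hE', hswap, ← two_smul 𝕜, smul_smul]
    norm_num
  have h6 : ∀ j g, vpair (.N i) (P.tildeN j) g = if j = i then g else 0 := fun j g => by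
    rw [tildeN, vpair_sub_left, ((P.O_dependsOn j).indepOf (by simp [IsPhi])).vpair, sub_zero,
      vpair_var]
    simp
  have h7 : (formalSum fun k : I × I => P.entry k.1 k.2 •
      vpair (.N i) (P.tildeN k.1) (P.tildeN k.2)) = formalSum fun j => P.entry i j • P.tildeN j := by
    rw [formalSum_injective (e := fun j : I => (i, j)) fun _ _ h => (Prod.mk.inj h).2]
    · simp [h6]
    · rintro ⟨j, k⟩ hk
      rw [h6, if_neg, smul_zero]
      rintro rfl
      exact hk ⟨k, rfl⟩
  have h8 : LF fun j => P.entry i j • P.tildeN j := by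
    apply LF.of_support_finite
    refine (P.entry_finite i).subset fun j hj h0 => hj ?_
    rw [h0, zero_smul]
  simp only [h2, formalSum_zero, sub_zero] at h1
  rw [h1, formalSum_sum hLF, h4, h3, zero_add, formalSum_sum hLF', h5, h7, smul_add,
    smul_formalSum _ h8, lin_apply_eq_formalSum]
  simp only [smul_smul]
  congr 2
  ext1 j
  congr 1
  exact P.sgn_smul_entry i j

/-- The terms of the equations of motion of `Φ` that involve the composite sector. -/
def compositeEOM (a : F) : LocalFun 𝕜 D c :=
  flow P.properAction (.K a) - dR (.Φ a) T.action

theorem compositeEOM_eq (a : F) : P.compositeEOM a =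
    sgn 𝕜 (c.field a).1 (c.field a).1 •
      ((formalSum fun l => vpair (.Φ a) (P.potential (.inr l)) 1) -
        formalSum fun i => vpair (.Φ a) (P.transf (.inr i)) (var (.H i))) := by
  have h1 : flow P.properAction (.K a) = sgn 𝕜 (c.field a).1 (c.field a).1 •
      ((formalSum fun l => vpair (.Φ a) (P.potential l) 1) -
        formalSum fun v => vpair (.Φ a) (P.transf v) (var (src v))) := P.flow_src_eq (.inl a)
  have hLF := P.LF_vpair_potential (.Φ a)
  have hr : LF fun v => vpair (.Φ a) (P.transf v) (var (src v)) :=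
    P.transf_LF.map fun v => XLin.vpairL _ _
  have h4 : ∀ f : Unit → LocalFun 𝕜 D c, formalSum f = f () := fun f =>
    formalSum_single f () fun k hk => absurd rfl hk
  have h2 : vpair (.Φ a) T.action 1 = vpair (.Φ a) (P.potential (.inl ())) 1 -
      ∑ b, vpair (.Φ a) (P.transf (.inl b)) (var (.K b)) := by
    have : ∀ b, vpair (.Φ a) (P.transf (.inl b)) (var (.K b)) =
        vpair (.Φ a) (P.transf (.inl b) * var (.K b)) 1 := fun b => by
      rw [vpair_mul_of_indep (IndepOf.var (by simp)), mul_one]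
    simp only [this, ← vpairL_apply, ← map_sum, ← map_sub]
    rfl
  rw [compositeEOM, h1, dR_of_even T.action_hasPar, h2, formalSum_sum hLF, formalSum_sum hr, h4,
    formalSum_fintype (κ := F), show c.deg (.Φ a) = c.field a from rfl, ← smul_sub]
  congr 1
  simp only [src]
  abel

/-- The label is not a source `K`. -/
def _root_.ProperFormalism.NotK (z : Lab F I) : Prop := weightK z = 0

/-- The K-dependence of the Φ equation comes entirely from the usual action, which has been
subtracted. Absence of K is what makes the interaction lower the number of sources K. -/
theorem compositeEOM_dependsOn (a : F) : DependsOnlyOn NotK (P.compositeEOM a) := by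
  have h : ∀ z : Lab F I, IsPhi z → NotK z := by
    intro z hz
    cases z <;> simp_all [IsPhi, NotK, weightK]
  have h' : ∀ z : Lab F I, IsFld z → NotK z := by
    intro z hz
    cases z <;> simp_all [IsFld, NotK, weightK]
  rw [compositeEOM_eq]
  refine (DependsOnlyOn.sub (DependsOnlyOn.formalSum fun l => ?_)
    (DependsOnlyOn.formalSum fun i => ?_)).smul _
  · exact ((P.potential_dependsOn _).mono h').vpair DependsOnlyOn.one _
  · exact ((P.transf_dependsOn _).mono h).vpair (DependsOnlyOn.var (by simp [NotK, weightK])) _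

section Vanishing

variable {Z : LocalFun 𝕜 D c →ₗ[𝕜] LocalFun 𝕜 D c}

theorem map_higher (hZ : IsHom Z) (hX : XLin Z)
    (hD : ∀ μ f, Z (tD μ f) = tD μ (Z f)) (hN : ∀ i, Z (P.tildeN i) = 0) (i : I) : Z (P.higher i) = 0 := by
  have hLF := ((P.LF_vpair_potential (.N i)).comp_injective Sum.inr_injective).comp_injective
    Sum.inr_injective
  rw [higher, map_smul, hX.map_formalSum hLF]
  simp only [P.map_vpair_potential hZ hX hD hN, formalSum_zero, smul_zero]

theorem map_compositeEOM (hZ : IsHom Z) (hX : XLin Z)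
    (hD : ∀ μ f, Z (tD μ f) = tD μ (Z f)) (hN : ∀ i, Z (P.tildeN i) = 0)
    (hH : ∀ i, Z (var (.H i)) = 0) (a : F) : Z (P.compositeEOM a) = 0 := by
  have hLF := (P.LF_vpair_potential (.Φ a)).comp_injective Sum.inr_injective
  have hr : LF fun i => vpair (.Φ a) (P.transf (.inr i)) (var (.H i)) :=
    (P.transf_LF.comp_injective Sum.inr_injective).map fun v => XLin.vpairL _ _
  rw [compositeEOM_eq, map_smul, map_sub, hX.map_formalSum hLF, hX.map_formalSum hr]
  simp only [P.map_vpair_potential hZ hX hD hN, hZ.map_vpair_eq_zero hX hD _ _ (hH _),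
    formalSum_zero, sub_zero, smul_zero]

end Vanishing

end CompositeSector

/-! ### Counting and parity of linear combinations of variables. -/

theorem VanishTo.vf {n : ℕ} {q : Lab F I → LocalFun 𝕜 D c} (h : ∀ z, VanishTo n (q z))
    (f : LocalFun 𝕜 D c) : VanishTo n (vf (ev q) f) := by
  rw [vf_apply]
  exact VanishTo.formalSum fun y => ((XLin.mD y.2).vanishTo (h y.1)).mul_right _

theorem num_var (wt : Lab F I → ℕ) (z : Lab F I) :
    num wt (var z : LocalFun 𝕜 D c) = (wt z : 𝕜) • var z := num_jet _ _

theorem num_weightNH_of_isPhiOrK [CharZero 𝕜] {f : LocalFun 𝕜 D c} (hf : DependsOnlyOn IsPhiOrK f) :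
    num weightNH f = 0 := by
  rw [← proj0_eq_self (fun z => weightNH_eq_zero) hf, num_proj0]

theorem lin_smul (s : I → LocalFun 𝕜 D c) (a : 𝕜) (v : I →₀ 𝕜) :
    lin (fun i => a • s i) v = a • lin s v := by
  have : lin (fun i => a • s i) = a • lin s := by
    ext1 i
    ext1
    simp [lin]
  exact DFunLike.congr_fun this v

theorem num_lin {wt : Lab F I → ℕ} {s : I → Lab F I} {k : ℕ} (h : ∀ i, wt (s i) = k) (v : I →₀ 𝕜) :
    num wt (lin (fun i => var (s i)) v : LocalFun 𝕜 D c) =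
      (k : 𝕜) • lin (fun i => var (s i)) v := by
  have : (fun i => num wt (var (s i) : LocalFun 𝕜 D c)) = fun i => (k : 𝕜) • var (s i) :=
    funext fun i => by rw [num_var, h]
  rw [map_lin, this, lin_smul]

/-- The sign action of the parity automorphism on the coefficients. -/
def coeffSign (c : Content F I) (r : ZMod 2) : (I →₀ 𝕜) →ₗ[𝕜] (I →₀ 𝕜) :=
  Finsupp.linearCombination 𝕜 fun i => Finsupp.single i (sgn 𝕜 r (c.composite i).1)

theorem coeffSign_apply (r : ZMod 2) (v : I →₀ 𝕜) (k : I) :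
    coeffSign c r v k = sgn 𝕜 r (c.composite k).1 * v k := by
  classical
  have : Finsupp.lapply k ∘ₗ coeffSign c r =
      sgn 𝕜 r (c.composite k).1 • (Finsupp.lapply k : (I →₀ 𝕜) →ₗ[𝕜] 𝕜) := by
    ext i
    by_cases h : i = k
    · subst h
      simp [coeffSign]
    · simp [coeffSign, h]
  exact DFunLike.congr_fun this v

theorem coeffSign_single (r : ZMod 2) (i : I) : coeffSign c r (Finsupp.single i (1 : 𝕜)) =
    sgn 𝕜 r (c.composite i).1 • Finsupp.single i 1 := by simp [coeffSign]

/-- Parity is recorded by an operator on coefficient vectors, so that the statistics of a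
combination can be read off from an eigenvector condition; this suits A and its inverse alike. -/
theorem lin_hasPar {s : I → LocalFun 𝕜 D c} {p q : ZMod 2}
    (hs : ∀ i, HasPar (p + (c.composite i).1) (s i)) {v : I →₀ 𝕜}
    (hv : ∀ r, coeffSign c r v = sgn 𝕜 r q • v) : HasPar (p + q) (lin s v) := fun r => by
  have e : (fun i => pa r (s i)) =
      fun i => sgn 𝕜 r p • lin s (coeffSign c r (Finsupp.single i 1)) := by
    ext1 i
    rw [hs, sgn_add_right, mul_smul, coeffSign_single, map_smul, lin_single]
  rw [map_lin, e, lin_smul, lin_comp, hv, map_smul, sgn_add_right, mul_smul]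

/-! ### Shifted variables and the contracting homotopy. -/

namespace CompositeSector

variable [Fintype F] {T : GaugeTheory 𝕜 D c} {J : Type x} (P : CompositeSector T J)

/-- The substitution of `Ñ` for `N`. -/
def shiftVar : Lab F I → LocalFun 𝕜 D c
  | .N i => P.tildeN i
  | z => var z

/-- The substitution of `N + O` for `N`. -/
def unshiftVar : Lab F I → LocalFun 𝕜 D c
  | .N i => var (.N i) + P.O i
  | z => var z

theorem shiftVar_hasPar (z : Lab F I) : HasPar (c.deg z).1 (P.shiftVar z) := by
  cases z with
  | N i => exact P.tildeN_hasPar i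
  | _ => exact HasPar.jet (_, 0)

theorem unshiftVar_hasPar (z : Lab F I) : HasPar (c.deg z).1 (P.unshiftVar z) := by
  cases z with
  | N i => exact (HasPar.jet (.N i, 0)).add (P.O_deg i).hasPar
  | _ => exact HasPar.jet (_, 0)

theorem unshiftVar_hasDeg (z : Lab F I) : HasDeg (c.deg z) (P.unshiftVar z) := by
  cases z with
  | N i => exact (HasDeg.var (.N i)).add (P.O_deg i)
  | _ => exact HasDeg.var _

theorem shiftVar_eq {z : Lab F I} (h : IsPhiOrK z) : P.shiftVar z = var z := by
  cases z <;> simp_all [IsPhiOrK, shiftVar]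

theorem unshiftVar_eq {z : Lab F I} (h : IsPhiOrK z) : P.unshiftVar z = var z := by
  cases z <;> simp_all [IsPhiOrK, unshiftVar]

theorem O_dependsOn_phiOrK (i : I) : DependsOnlyOn IsPhiOrK (P.O i) :=
  (P.O_dependsOn i).mono fun _ => IsPhi.isPhiOrK

theorem action_dependsOn : DependsOnlyOn IsPhiOrK T.action :=
  (T.S₀_dependsOn.mono fun _ => IsPhi.isPhiOrK).sub (DependsOnlyOn.sum fun a =>
    ((T.R_dependsOn a).mono fun _ => IsPhi.isPhiOrK).mul (DependsOnlyOn.var (by trivial)))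

theorem dR_action_dependsOn (a : F) : DependsOnlyOn IsPhiOrK (dR (.Φ a) T.action) := by
  rw [dR_of_even T.action_hasPar]
  exact (action_dependsOn.vpair DependsOnlyOn.one _).smul _

/-- A nonzero entry of A connects only labels of equal statistics. -/
theorem coeffSign_A (r : ZMod 2) (v : I →₀ 𝕜) : coeffSign c r (P.A v) = P.A (coeffSign c r v) := by
  have : coeffSign c r ∘ₗ P.A.toLinearMap = P.A.toLinearMap ∘ₗ coeffSign c r := by
    ext1 i
    ext1
    ext k
    have e : coeffSign c r (Finsupp.single i (1 : 𝕜)) =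
        sgn 𝕜 r (c.composite i).1 • Finsupp.single i 1 := by simp [coeffSign]
    simp only [LinearMap.comp_apply, LinearEquiv.coe_coe, Finsupp.lsingle_apply, e, map_smul,
      coeffSign_apply, Finsupp.smul_apply, smul_eq_mul]
    by_cases h : P.entry k i = 0
    · change _ * P.entry k i = _ * P.entry k i
      rw [h, mul_zero, mul_zero]
    · rw [P.composite_eq_of_entry_ne h]
  exact DFunLike.congr_fun this v

/-- The inverse commutes with the signs because A does, so its entries never have to be examined. -/
theorem coeffSign_A_symm (r : ZMod 2) (v : I →₀ 𝕜) :
    coeffSign c r (P.A.symm v) = P.A.symm (coeffSign c r v) := by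
  rw [LinearEquiv.eq_symm_apply, ← coeffSign_A, LinearEquiv.apply_symm_apply]

/-- The part of the equations of motion that preserves the number of proper fields and sources. -/
def freeChar : Lab F I → LocalFun 𝕜 D c
  | .Φ a => T.R a
  | .K a => dR (.Φ a) T.action
  | .N _ => 0
  | .H i => lin (fun j => var (.N j)) (P.A (Finsupp.single i 1))

theorem freeChar_hasPar (z : Lab F I) : HasPar (1 + (c.deg z).1) (P.freeChar z) := by
  cases z with
  | Φ a => exact T.R_hasPar a
  | K a =>
    have h := vpair_hasPar T.action_hasPar (.Φ a)
    have e : 1 + (c.deg (.K a)).1 = (c.deg (.Φ a)).1 + 0 := by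
      have := deg_src (c := c) (.inl a)
      simp only [src, fld] at this
      rw [this, ← add_assoc, add_self_zmod_two, zero_add, add_zero]
    rw [e, freeChar, dR_of_even T.action_hasPar]
    exact h.smul _
  | N i => exact HasPar.zero
  | H i =>
    have e : 1 + (c.deg (.H i)).1 = 0 + (c.composite i).1 := by
      have := deg_src (c := c) (.inr i)
      simp only [src, fld] at this
      rw [this, ← add_assoc, add_self_zmod_two]
      rfl
    rw [e]
    apply lin_hasPar
    · intro j
      rw [zero_add]
      exact HasPar.jet (.N j, 0)
    · intro r
      rw [coeffSign_A, coeffSign_single, map_smul]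

/-- The contracting homotopy: `N` is mapped to the combination of `H` whose equation is `N = 0`. -/
def homotopyChar : Lab F I → LocalFun 𝕜 D c
  | .N j => lin (fun i => var (.H i)) (P.A.symm (Finsupp.single j 1))
  | _ => 0

theorem homotopyChar_hasPar (z : Lab F I) : HasPar (1 + (c.deg z).1) (P.homotopyChar z) := by
  cases z with
  | N j =>
    apply lin_hasPar
    · intro i
      have := deg_src (c := c) (.inr i)
      simp only [src, fld] at this
      change HasPar (1 + (c.deg (.N i)).1) _
      rw [← this]
      exact HasPar.jet (.H i, 0)
    · intro r
      rw [coeffSign_A_symm, coeffSign_single, map_smul]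
      rfl
  | _ => exact HasPar.zero

variable [CharZero 𝕜]

/-- The change of variables from `N` to `Ñ`. -/
def shift : LocalFun 𝕜 D c →ₗ[𝕜] LocalFun 𝕜 D c := subst P.shiftVar P.shiftVar_hasPar

/-- The change of variables from `Ñ` to `N`. -/
def unshift : LocalFun 𝕜 D c →ₗ[𝕜] LocalFun 𝕜 D c := subst P.unshiftVar P.unshiftVar_hasPar

theorem unshift_isHom : IsHom P.unshift := IsHom.subst _ _

theorem shift_xLin : XLin P.shift := XLin.subst _ _

theorem unshift_xLin : XLin P.unshift := XLin.subst _ _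

theorem unshift_jet (y : Jet D F I) : P.unshift (jet y) = mD y.2 (P.unshiftVar y.1) :=
  subst_jet _ _ y

theorem shift_var (z : Lab F I) : P.shift (var z) = P.shiftVar z := subst_var _ _ z

theorem unshift_var (z : Lab F I) : P.unshift (var z) = P.unshiftVar z := subst_var _ _ z

theorem shift_tD (μ : Fin D) (f : LocalFun 𝕜 D c) : P.shift (tD μ f) = tD μ (P.shift f) :=
  subst_tD _ _ μ f

theorem unshift_tD (μ : Fin D) (f : LocalFun 𝕜 D c) : P.unshift (tD μ f) = tD μ (P.unshift f) :=
  subst_tD _ _ μ f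

theorem shift_eq_self {f : LocalFun 𝕜 D c} (hf : DependsOnlyOn IsPhiOrK f) : P.shift f = f :=
  subst_eq_self P.shiftVar_hasPar (fun _ => P.shiftVar_eq) hf

theorem unshift_eq_self {f : LocalFun 𝕜 D c} (hf : DependsOnlyOn IsPhiOrK f) : P.unshift f = f :=
  subst_eq_self P.unshiftVar_hasPar (fun _ => P.unshiftVar_eq) hf

theorem unshift_tildeN (i : I) : P.unshift (P.tildeN i) = var (.N i) := by
  rw [tildeN, map_sub, unshift_var, P.unshift_eq_self (P.O_dependsOn_phiOrK i), unshiftVar,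
    add_sub_cancel_right]

theorem shift_unshift (f : LocalFun 𝕜 D c) : P.shift (P.unshift f) = f := by
  apply subst_subst_eq_self
  intro z
  cases z with
  | N i =>
    change P.shift (var (.N i) + P.O i) = _
    rw [map_add, P.shift_eq_self (P.O_dependsOn_phiOrK i), shift_var, shiftVar, tildeN,
      sub_add_cancel]
  | _ => exact P.shift_var _

theorem unshift_shift (f : LocalFun 𝕜 D c) : P.unshift (P.shift f) = f := by
  apply subst_subst_eq_self
  intro z
  cases z with
  | N i => exact P.unshift_tildeN i
  | _ => exact P.unshift_var _

/-- The equations of motion in the shifted variables. -/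
def shiftedFlow : LocalFun 𝕜 D c →ₗ[𝕜] LocalFun 𝕜 D c :=
  P.unshift ∘ₗ vf (ev (flow P.properAction)) ∘ₗ P.shift

theorem shiftedFlow_isDer : IsDer 1 P.shiftedFlow := fun f g => by
  simp only [shiftedFlow, LinearMap.comp_apply]
  rw [shift, unshift, (IsHom.subst _ _).2, IsDer.vf (HasPar.ev P.flow_hasPar), map_add, ← subst_pa,
    (IsHom.subst _ _).2, (IsHom.subst _ _).2]
  change _ * P.unshift (P.shift g) + P.unshift (P.shift (pa 1 f)) * _ = _
  rw [unshift_shift, unshift_shift]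

theorem shiftedFlow_opPar : OpPar 1 P.shiftedFlow := fun r f => by
  simp only [shiftedFlow, LinearMap.comp_apply]
  rw [shift, unshift, subst_pa, OpPar.vf (HasPar.ev P.flow_hasPar), map_smul, subst_pa]

theorem shiftedFlow_xLin : XLin P.shiftedFlow :=
  P.unshift_xLin.comp ((XLin.vf _).comp P.shift_xLin)

theorem shiftedFlow_tD (μ : Fin D) (f : LocalFun 𝕜 D c) :
    P.shiftedFlow (tD μ f) = tD μ (P.shiftedFlow f) := by
  simp only [shiftedFlow, LinearMap.comp_apply]
  rw [shift_tD, vf_ev_tD P.flow_hasPar, unshift_tD]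

theorem shiftedFlow_shiftedFlow (f : LocalFun 𝕜 D c) : P.shiftedFlow (P.shiftedFlow f) = 0 := by
  simp only [shiftedFlow, LinearMap.comp_apply]
  rw [shift_unshift, vf_flow_vf_flow, map_zero]

theorem shiftedFlow_Φ (a : F) : P.shiftedFlow (var (.Φ a)) = T.R a := by
  simp only [shiftedFlow, LinearMap.comp_apply]
  rw [shift_var, P.shiftVar_eq (by trivial), vf_ev_var]
  refine (congrArg P.unshift (P.flow_fld_eq (.inl a))).trans ?_
  exact P.unshift_eq_self ((T.R_dependsOn a).mono fun _ => IsPhi.isPhiOrK)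

theorem shiftedFlow_N (i : I) : P.shiftedFlow (var (.N i)) = 0 := by
  simp only [shiftedFlow, LinearMap.comp_apply]
  rw [shift_var, shiftVar, vf_flow_tildeN, map_zero]

theorem shiftedFlow_H (i : I) : P.shiftedFlow (var (.H i)) =
    P.freeChar (.H i) + P.unshift (P.higher i) := by
  simp only [shiftedFlow, LinearMap.comp_apply]
  rw [shift_var, show P.shiftVar (.H i) = var (.H i) from rfl, vf_ev_var, flow_H, map_add, map_lin]
  simp only [unshift_tildeN]
  rfl

theorem shiftedFlow_K (a : F) : P.shiftedFlow (var (.K a)) =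
    P.freeChar (.K a) + P.unshift (P.compositeEOM a) := by
  simp only [shiftedFlow, LinearMap.comp_apply]
  rw [shift_var, P.shiftVar_eq (by trivial), vf_ev_var, compositeEOM, map_sub,
    P.unshift_eq_self (dR_action_dependsOn a), freeChar, add_sub_cancel]

/-- The higher-order part of the equations of motion of `N`. -/
def charH : Lab F I → LocalFun 𝕜 D c
  | .H i => P.unshift (P.higher i)
  | _ => 0

/-- The composite part of the equations of motion of `Φ`. -/
def charK : Lab F I → LocalFun 𝕜 D c
  | .K a => P.unshift (P.compositeEOM a)
  | _ => 0

theorem charH_hasPar (z : Lab F I) : HasPar (1 + (c.deg z).1) (P.charH z) := by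
  cases z with
  | H i =>
    have h : HasPar (1 + (c.deg (.H i)).1) (P.shiftedFlow (var (.H i))) :=
      (HasPar.jet (.H i, 0)).apply_op P.shiftedFlow_opPar
    have := h.sub (P.freeChar_hasPar (.H i))
    rwa [shiftedFlow_H, add_sub_cancel_left] at this
  | _ => exact HasPar.zero

theorem charK_hasPar (z : Lab F I) : HasPar (1 + (c.deg z).1) (P.charK z) := by
  cases z with
  | K a =>
    have h : HasPar (1 + (c.deg (.K a)).1) (P.shiftedFlow (var (.K a))) :=
      (HasPar.jet (.K a, 0)).apply_op P.shiftedFlow_opPar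
    have := h.sub (P.freeChar_hasPar (.K a))
    rwa [shiftedFlow_K, add_sub_cancel_left] at this
  | _ => exact HasPar.zero

/-- Both sides are odd derivations that commute with total derivatives, so comparison on the
variables without derivatives suffices. -/
theorem shiftedFlow_eq (f : LocalFun 𝕜 D c) : P.shiftedFlow f =
    vf (ev P.freeChar) f + (vf (ev P.charK) f + vf (ev P.charH) f) := by
  have h0 := IsDer.vf (HasPar.ev P.freeChar_hasPar)
  have hK := IsDer.vf (HasPar.ev P.charK_hasPar)
  have hH := IsDer.vf (HasPar.ev P.charH_hasPar)
  have := (((P.shiftedFlow_isDer.sub h0).sub hK).sub hH).eq_zero_of_var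
    (((P.shiftedFlow_xLin.sub (XLin.vf _)).sub (XLin.vf _)).sub (XLin.vf _))
    (fun μ f => by
      simp only [LinearMap.sub_apply, shiftedFlow_tD, vf_ev_tD P.freeChar_hasPar,
        vf_ev_tD P.charK_hasPar, vf_ev_tD P.charH_hasPar, map_sub])
    (fun z => by
      simp only [LinearMap.sub_apply, vf_ev_var]
      cases z <;> simp [shiftedFlow_Φ, shiftedFlow_K, shiftedFlow_N, shiftedFlow_H, freeChar, charK,
        charH])
  have := DFunLike.congr_fun this f
  simp only [LinearMap.sub_apply, LinearMap.zero_apply] at this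
  rwa [sub_sub, sub_sub, sub_eq_zero] at this

theorem proj0_unshift_tildeN (i : I) : proj0 weightNH (P.unshift (P.tildeN i)) = 0 := by
  rw [unshift_tildeN, var_eq, proj0_jet, if_neg (by simp [weightNH])]

theorem proj0_unshift_H (i : I) : proj0 weightNH (P.unshift (var (.H i))) = 0 := by
  rw [unshift_var, show P.unshiftVar (.H i) = var (.H i) from rfl, var_eq, proj0_jet, if_neg (by simp [weightNH])]

theorem proj0_unshift_hom : IsHom (proj0 weightNH ∘ₗ P.unshift) :=
  (IsHom.proj0 _).comp P.unshift_isHom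

theorem proj0_unshift_xLin : XLin (proj0 weightNH ∘ₗ P.unshift) :=
  (XLin.proj0 _).comp P.unshift_xLin

theorem proj0_unshift_tD (μ : Fin D) (f : LocalFun 𝕜 D c) :
    (proj0 weightNH ∘ₗ P.unshift) (tD μ f) = tD μ ((proj0 weightNH ∘ₗ P.unshift) f) := by
  rw [LinearMap.comp_apply, unshift_tD, proj0_tD, LinearMap.comp_apply]

/-- After the shift, every composite term in the Φ equation carries a factor N or H, and the
projection sets these to zero. -/
theorem proj0_vf_charK (f : LocalFun 𝕜 D c) : proj0 weightNH (vf (ev P.charK) f) = 0 := by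
  refine (IsHom.proj0 _).map_der_eq_zero_of_var (XLin.proj0 _) (proj0_tD _)
    (IsDer.vf (HasPar.ev P.charK_hasPar)) (XLin.vf _) (vf_ev_tD P.charK_hasPar) (fun z => ?_) f
  rw [vf_ev_var]
  cases z with
  | K a =>
    exact P.map_compositeEOM P.proj0_unshift_hom P.proj0_unshift_xLin P.proj0_unshift_tD
      P.proj0_unshift_tildeN P.proj0_unshift_H a
  | _ => exact map_zero _

theorem proj0_vf_charH (f : LocalFun 𝕜 D c) : proj0 weightNH (vf (ev P.charH) f) = 0 := by
  refine (IsHom.proj0 _).map_der_eq_zero_of_var (XLin.proj0 _) (proj0_tD _)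
    (IsDer.vf (HasPar.ev P.charH_hasPar)) (XLin.vf _) (vf_ev_tD P.charH_hasPar) (fun z => ?_) f
  rw [vf_ev_var]
  cases z with
  | H i =>
    exact P.map_higher P.proj0_unshift_hom P.proj0_unshift_xLin P.proj0_unshift_tD
      P.proj0_unshift_tildeN i
  | _ => exact map_zero _

theorem proj0_vf_homotopyChar (f : LocalFun 𝕜 D c) :
    proj0 weightNH (vf (ev P.homotopyChar) f) = 0 := by
  refine (IsHom.proj0 _).map_der_eq_zero_of_var (XLin.proj0 _) (proj0_tD _)
    (IsDer.vf (HasPar.ev P.homotopyChar_hasPar)) (XLin.vf _) (vf_ev_tD P.homotopyChar_hasPar)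
    (fun z => ?_) f
  rw [vf_ev_var]
  cases z with
  | N i =>
    have h : ∀ j, proj0 weightNH (var (.H j) : LocalFun 𝕜 D c) = 0 := fun j => by
      rw [var_eq, proj0_jet, if_neg (by simp [weightNH])]
    rw [homotopyChar, map_lin, lin_apply_eq_formalSum]
    simp only [h, smul_zero, formalSum_zero]
  | _ => exact map_zero _

theorem num_vf_freeChar (f : LocalFun 𝕜 D c) :
    num weightNH (vf (ev P.freeChar) f) = vf (ev P.freeChar) (num weightNH f) := by
  have := num_vf (wt := weightNH) P.freeChar_hasPar 0 (fun z => ?_) f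
  · simpa using this
  · rw [zero_smul, add_zero]
    cases z with
    | Φ a =>
      rw [freeChar, num_weightNH_of_isPhiOrK ((T.R_dependsOn a).mono fun _ => IsPhi.isPhiOrK)]
      simp [weightNH]
    | K a =>
      rw [freeChar, num_weightNH_of_isPhiOrK (dR_action_dependsOn a)]
      simp [weightNH]
    | N i => simp [freeChar]
    | H i =>
      rw [show P.freeChar (.H i) = lin (fun j => var (.N j)) (P.A (Finsupp.single i 1)) from rfl,
        num_lin (s := Lab.N) (k := 1) fun _ => rfl]
      rfl

theorem num_weightK_vf_homotopyChar (f : LocalFun 𝕜 D c) :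
    num weightK (vf (ev P.homotopyChar) f) = vf (ev P.homotopyChar) (num weightK f) := by
  have := num_vf (wt := weightK) P.homotopyChar_hasPar 0 (fun z => ?_) f
  · simpa using this
  · rw [zero_smul, add_zero]
    cases z with
    | N j =>
      rw [show P.homotopyChar (.N j) = lin (fun i => var (.H i)) (P.A.symm (Finsupp.single j 1)) from
        rfl, num_lin (s := Lab.H) (k := 0) fun _ => rfl]
      rfl
    | _ => simp [homotopyChar]

theorem num_unshift_compositeEOM (a : F) : num weightK (P.unshift (P.compositeEOM a)) = 0 := by
  have h : proj0 weightK (P.unshift (P.compositeEOM a)) = P.unshift (P.compositeEOM a) := by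
    refine (P.compositeEOM_dependsOn a).hom_eq (S := proj0 weightK ∘ₗ P.unshift)
      ((IsHom.proj0 _).comp P.unshift_isHom) P.unshift_isHom
      ((XLin.proj0 _).comp P.unshift_xLin) P.unshift_xLin ?_
    rintro ⟨z, α⟩ hz
    have hz' : proj0 weightK (P.unshiftVar z) = P.unshiftVar z := by
      have hNK : ∀ w : Lab F I, IsFld w → weightK w = 0 := fun w hw => by
        cases w <;> simp_all [IsFld, weightK]
      cases z with
      | N i =>
        exact proj0_eq_self hNK ((DependsOnlyOn.var (by trivial)).add
          ((P.O_dependsOn i).mono fun _ => IsPhi.isFld))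
      | _ => exact proj0_eq_self (p := NotK) (fun _ h => h) (DependsOnlyOn.var hz)
    rw [LinearMap.comp_apply, unshift_jet, comm_mD (proj0_tD weightK), hz']
  rw [← h, num_proj0]

/-- This derivation replaces one K by an expression without K. The resulting drop of the K-number
drives the nilpotency of the defect. -/
theorem num_vf_charK (f : LocalFun 𝕜 D c) :
    num weightK (vf (ev P.charK) f) = vf (ev P.charK) (num weightK f) - vf (ev P.charK) f := by
  have := num_vf (wt := weightK) P.charK_hasPar (-1) (fun z => ?_) f
  · rw [this, neg_one_smul, sub_eq_add_neg]
  · cases z with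
    | K a =>
      rw [charK, num_unshift_compositeEOM]
      simp [weightK]
    | _ => simp [charK]

/-- The anticommutator of two odd derivations is an even derivation. It kills Φ and K, because the
homotopy kills them and their equations; on N it gives A after its inverse, on H the inverse after
A, hence the identity on both. This is the number operator. -/
theorem homotopy (f : LocalFun 𝕜 D c) :
    vf (ev P.homotopyChar) (vf (ev P.freeChar) f) + vf (ev P.freeChar) (vf (ev P.homotopyChar) f) =
      num weightNH f := by
  have hQ := IsDer.vf (HasPar.ev P.freeChar_hasPar)
  have hh := IsDer.vf (HasPar.ev P.homotopyChar_hasPar)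
  have hC := IsDer.comm hh hQ (OpPar.vf (HasPar.ev P.homotopyChar_hasPar))
    (OpPar.vf (HasPar.ev P.freeChar_hasPar))
  rw [add_self_zmod_two] at hC
  have hXh := XLin.vf (ev P.homotopyChar)
  have hXQ := XLin.vf (ev P.freeChar)
  have h0 : ∀ g : LocalFun 𝕜 D c, DependsOnlyOn IsPhiOrK g → vf (ev P.homotopyChar) g = 0 := by
    intro g hg
    refine hg.der_eq hh (IsDer.zero 1) hXh XLin.zero ?_
    rintro ⟨z, α⟩ hz
    rw [vf_jet, ev]
    cases z <;> simp_all [IsPhiOrK, homotopyChar]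
  have key := (hC.sub (IsDer.num weightNH)).eq_zero_of_var
    (((hXh.comp hXQ).sub ((hXQ.comp hXh).smul _)).sub (XLin.num _))
    (fun μ f => by
      simp only [LinearMap.sub_apply, LinearMap.smul_apply, LinearMap.comp_apply, num_tD,
        vf_ev_tD P.freeChar_hasPar, vf_ev_tD P.homotopyChar_hasPar, map_sub, map_smul])
    (fun z => by
      simp only [LinearMap.sub_apply, LinearMap.smul_apply, LinearMap.comp_apply, vf_ev_var,
        sgn_one_one, neg_one_smul, sub_neg_eq_add, num_var]
      cases z with
      | Φ a =>
        rw [freeChar, h0 _ ((T.R_dependsOn a).mono fun _ => IsPhi.isPhiOrK)]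
        simp [homotopyChar, weightNH]
      | K a =>
        rw [freeChar, h0 _ (dR_action_dependsOn a)]
        simp [homotopyChar, weightNH]
      | N j =>
        rw [homotopyChar, map_lin]
        simp only [vf_ev_var, freeChar, map_zero, weightNH, Nat.cast_one, one_smul, zero_add]
        have := lin_comp (fun j => (var (.N j) : LocalFun 𝕜 D c)) P.A.toLinearMap
          (P.A.symm (Finsupp.single j 1))
        simp only [LinearEquiv.coe_coe, LinearEquiv.apply_symm_apply, lin_single] at this
        rw [this, sub_self]
      | H i =>
        rw [freeChar, map_lin]
        simp only [vf_ev_var, homotopyChar, map_zero, weightNH, Nat.cast_one, one_smul, add_zero]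
        have := lin_comp (fun j => (var (.H j) : LocalFun 𝕜 D c)) P.A.symm.toLinearMap
          (P.A (Finsupp.single i 1))
        simp only [LinearEquiv.coe_coe, LinearEquiv.symm_apply_apply, lin_single] at this
        rw [this, sub_self])
  have := DFunLike.congr_fun key f
  simp only [LinearMap.sub_apply, LinearMap.smul_apply, LinearMap.comp_apply, sgn_one_one,
    neg_one_smul, sub_neg_eq_add, LinearMap.zero_apply, sub_eq_zero] at this
  exact this

end CompositeSector

/-! ### Homotopy for the full flow and its cohomology. -/

namespace CompositeSector

variable [Fintype F] {T : GaugeTheory 𝕜 D c} {J : Type x} (P : CompositeSector T J)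

/-- The homotopy for the free part of the equations of motion. -/
def homotopyOp : Module.End 𝕜 (LocalFun 𝕜 D c) := vf (ev P.homotopyChar) ∘ₗ invNum weightNH

/-- The failure of the homotopy for a perturbation of the free equations of motion. -/
def defect (V : LocalFun 𝕜 D c →ₗ[𝕜] LocalFun 𝕜 D c) : Module.End 𝕜 (LocalFun 𝕜 D c) :=
  -(V ∘ₗ P.homotopyOp + P.homotopyOp ∘ₗ V)

theorem defect_apply (V : LocalFun 𝕜 D c →ₗ[𝕜] LocalFun 𝕜 D c) (f : LocalFun 𝕜 D c) :
    P.defect V f = -(V (P.homotopyOp f) + P.homotopyOp (V f)) := rfl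

theorem homotopyOp_apply (f : LocalFun 𝕜 D c) :
    P.homotopyOp f = vf (ev P.homotopyChar) (invNum weightNH f) := rfl

theorem homotopyOp_xLin : XLin P.homotopyOp := (XLin.vf _).comp (XLin.invNum _)

theorem defect_xLin {V : LocalFun 𝕜 D c →ₗ[𝕜] LocalFun 𝕜 D c} (hV : XLin V) : XLin (P.defect V) := by
  intro f
  have h := (hV.comp P.homotopyOp_xLin).add (P.homotopyOp_xLin.comp hV) f
  rw [defect_apply, defect_apply, mul_neg]
  exact congrArg _ h

theorem sqAntiparen_mem_divs_iff (f : LocalFun 𝕜 D c) :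
    sqAntiparen P.properAction f ∈ divs 𝕜 D c ↔ vf (ev (flow P.properAction)) f ∈ divs 𝕜 D c := by
  have h := sqAntiparen_sub_mem_divs P.properAction f
  constructor
  · intro h'
    simpa using sub_mem h' h
  · intro h'
    simpa using add_mem h h'

variable [CharZero 𝕜]

theorem homotopyOp_tD (μ : Fin D) (f : LocalFun 𝕜 D c) :
    P.homotopyOp (tD μ f) = tD μ (P.homotopyOp f) := by
  rw [homotopyOp_apply, homotopyOp_apply, ← comm_invNum fun f => (num_tD weightNH μ f).symm,
    vf_ev_tD P.homotopyChar_hasPar]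

theorem proj0_homotopyOp (f : LocalFun 𝕜 D c) : proj0 weightNH (P.homotopyOp f) = 0 :=
  P.proj0_vf_homotopyChar _

theorem num_homotopyOp (f : LocalFun 𝕜 D c) :
    num weightK (P.homotopyOp f) = P.homotopyOp (num weightK f) := by
  rw [homotopyOp_apply, homotopyOp_apply, num_weightK_vf_homotopyChar,
    comm_invNum (num_num_comm weightK weightNH)]

theorem free_homotopyOp (f : LocalFun 𝕜 D c) :
    vf (ev P.freeChar) (P.homotopyOp f) + P.homotopyOp (vf (ev P.freeChar) f) =
      f - proj0 weightNH f := by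
  rw [homotopyOp_apply, homotopyOp_apply, ← comm_invNum fun f => (P.num_vf_freeChar f).symm, add_comm,
    homotopy, num_invNum]

/-- The composite part of the equations of motion in the shifted variables. -/
def interaction : LocalFun 𝕜 D c →ₗ[𝕜] LocalFun 𝕜 D c := vf (ev P.charK) + vf (ev P.charH)

theorem interaction_xLin : XLin P.interaction := (XLin.vf _).add (XLin.vf _)

theorem interaction_tD (μ : Fin D) (f : LocalFun 𝕜 D c) :
    P.interaction (tD μ f) = tD μ (P.interaction f) := by
  simp only [interaction, LinearMap.add_apply, vf_ev_tD P.charK_hasPar, vf_ev_tD P.charH_hasPar,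
    map_add]

theorem proj0_interaction (f : LocalFun 𝕜 D c) : proj0 weightNH (P.interaction f) = 0 := by
  simp only [interaction, LinearMap.add_apply, map_add, proj0_vf_charK, proj0_vf_charH, add_zero]

theorem shiftedFlow_eq_add (f : LocalFun 𝕜 D c) :
    P.shiftedFlow f = vf (ev P.freeChar) f + P.interaction f := P.shiftedFlow_eq f

/-- At order zero the `charH` part of the interaction vanishes. The `charK` part lowers the number
of K by one and the homotopy preserves it, so the leading part of the defect is nilpotent on each
differential polynomial, although with no uniform bound. -/
theorem defect_nilpotent (f : LocalFun 𝕜 D c) :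
    ∃ m, VanishTo 0 ((P.defect P.interaction ^ m) f) := by
  apply exists_pow_vanishTo_zero (wt := weightK) (P.defect_xLin (XLin.vf (ev P.charK)))
  · intro f
    have hH : ∀ g, VanishTo 0 (vf (ev P.charH) g) := VanishTo.vf fun z => by
      cases z with
      | H i => exact P.unshift_xLin.vanishTo (P.higher_vanishTo i)
      | _ => exact fun m _ => map_zero _
    have e : P.defect P.interaction f - P.defect (vf (ev P.charK)) f =
        -(vf (ev P.charH) (P.homotopyOp f) + P.homotopyOp (vf (ev P.charH) f)) := by
      simp only [defect_apply, interaction, LinearMap.add_apply, map_add]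
      abel
    rw [e]
    intro m hm
    rw [map_neg, map_add, hH _ m hm, P.homotopyOp_xLin.vanishTo (hH f) m hm, add_zero, neg_zero]
  · intro f
    simp only [defect_apply, map_neg, map_add, num_vf_charK, num_homotopyOp, map_sub]
    abel

theorem vf_freeChar_of_isPhiOrK {f : LocalFun 𝕜 D c} (hf : DependsOnlyOn IsPhiOrK f) :
    vf (ev P.freeChar) f = vf (ev (usualFlow T.action)) f := by
  have e : ∀ z : Lab F I, IsPhiOrK z → P.freeChar z = usualFlow T.action z := by
    intro z hz
    cases z with
    | Φ a => exact (neg_eq_iff_eq_neg.2 (T.dR_K_action a)).symm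
    | K a => rfl
    | _ => exact hz.elim
  have hpar : ∀ z : Lab F I, HasPar (1 + (c.deg z).1) (usualFlow T.action z) := by
    intro z
    cases z with
    | Φ a => rw [← e _ (by trivial)]; exact P.freeChar_hasPar _
    | K a => rw [← e _ (by trivial)]; exact P.freeChar_hasPar _
    | _ => exact HasPar.zero
  apply hf.der_eq (IsDer.vf (HasPar.ev P.freeChar_hasPar)) (IsDer.vf (HasPar.ev hpar))
    (XLin.vf _) (XLin.vf _)
  rintro ⟨z, α⟩ hz
  rw [vf_jet, vf_jet, ev, ev, e _ hz]

theorem antiparen_sub_free_mem_divs {f : LocalFun 𝕜 D c} (hf : DependsOnlyOn IsPhiOrK f) :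
    antiparen T.action f - vf (ev P.freeChar) f ∈ divs 𝕜 D c := by
  rw [P.vf_freeChar_of_isPhiOrK hf]
  exact antiparen_sub_mem_divs _ _

/-- Setting N = H = 0 in the shifted variables intertwines the full flow with the usual one, because
the interaction vanishes there and the free flow preserves the number of N and H. -/
theorem proj0_shiftedFlow (f : LocalFun 𝕜 D c) :
    proj0 weightNH (P.shiftedFlow f) = vf (ev P.freeChar) (proj0 weightNH f) := by
  rw [shiftedFlow_eq_add, map_add, proj0_interaction, add_zero,
    comm_proj0 fun f => (P.num_vf_freeChar f).symm]

theorem interaction_of_isPhi {f : LocalFun 𝕜 D c} (hf : DependsOnlyOn IsPhi f) :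
    P.interaction f = 0 := by
  have h : ∀ q : Lab F I → LocalFun 𝕜 D c, (∀ z, HasPar (1 + (c.deg z).1) (q z)) →
      (∀ a, q (.Φ a) = 0) → vf (ev q) f = 0 := by
    intro q hq h0
    refine hf.der_eq (IsDer.vf (HasPar.ev hq)) (IsDer.zero 1) (XLin.vf _) XLin.zero ?_
    rintro ⟨z, α⟩ hz
    cases z with
    | Φ a => rw [vf_jet, ev, h0, map_zero]; rfl
    | _ => exact hz.elim
  rw [interaction, LinearMap.add_apply, h _ P.charK_hasPar fun _ => rfl,
    h _ P.charH_hasPar fun _ => rfl, add_zero]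

/-- Closed functionals in the shifted variables that vanish at `N = H = 0` are exact. -/
theorem exists_shiftedFlow_sub_mem_divs {f : LocalFun 𝕜 D c} (hf : proj0 weightNH f = 0)
    (hQ : P.shiftedFlow f ∈ divs 𝕜 D c) : ∃ g, f - P.shiftedFlow g ∈ divs 𝕜 D c := by
  -- Adding the interaction V to the free homotopy formula gives Qh + hQ = 1 - P - E with E the
  -- defect of V; PE = 0 because P kills every value of V and of h.
  refine exists_sub_mem_divs (Q := P.shiftedFlow) (H := P.homotopyOp) (P := proj0 weightNH)
    (E := P.defect P.interaction) (P.defect_xLin P.interaction_xLin) P.defect_nilpotent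
    P.homotopyOp_tD (fun μ f => ?_) P.shiftedFlow_shiftedFlow (fun f => ?_) (fun f => ?_)
    (fun f h => ?_) hf hQ
  · simp only [defect_apply, homotopyOp_tD, interaction_tD, map_neg, map_add]
  · rw [← P.free_homotopyOp, defect_apply, shiftedFlow_eq_add, shiftedFlow_eq_add, map_add]
    abel
  · rw [defect_apply, map_neg, map_add, proj0_interaction, proj0_homotopyOp, add_zero, neg_zero]
  · rw [proj0_shiftedFlow, h, map_zero]

/-- Every closed functional is, up to an exact one, a functional of `Φ`, if this is so in the usual
formalism. -/
theorem exists_of_closed (d : Deg)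
    (hcoh : ∀ χ : LocalFun 𝕜 D c, DependsOnlyOn IsPhiOrK χ → HasDeg d χ →
      SameFunctional (antiparen T.action χ) 0 →
      ∃ G χ' : LocalFun 𝕜 D c, DependsOnlyOn IsPhi G ∧ DependsOnlyOn IsPhiOrK χ' ∧
        SameFunctional χ (G + antiparen T.action χ'))
    {χ : LocalFun 𝕜 D c} (hχ : HasDeg d χ) (h : vf (ev (flow P.properAction)) χ ∈ divs 𝕜 D c) :
    ∃ ω χ' : LocalFun 𝕜 D c, DependsOnlyOn IsPhi ω ∧
      χ - (ω + vf (ev (flow P.properAction)) χ') ∈ divs 𝕜 D c := by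
  have hclosed : P.shiftedFlow (P.unshift χ) ∈ divs 𝕜 D c := by
    simp only [shiftedFlow, LinearMap.comp_apply]
    rw [shift_unshift]
    exact map_mem_divs P.unshift_tD h
  have hdep : ∀ f : LocalFun 𝕜 D c, DependsOnlyOn IsPhiOrK (proj0 weightNH f) :=
    proj0_dependsOnlyOn fun z => isPhiOrK_of_weightNH
  -- The projection of χ at N = H = 0 is closed in the usual formalism, and it keeps the degree d,
  -- so the hypothesis applies to it.
  obtain ⟨G, χ₀, hG, hχ₀, hGχ⟩ := hcoh (proj0 weightNH (P.unshift χ)) (hdep _)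
    ((HasDeg.subst P.unshiftVar_hasPar P.unshiftVar_hasDeg hχ).wf _ _) (by
      rw [sameFunctional_iff, sub_zero]
      have h1 := P.antiparen_sub_free_mem_divs (hdep (P.unshift χ))
      have h2 := map_mem_divs (proj0_tD weightNH) hclosed
      rw [proj0_shiftedFlow] at h2
      simpa using add_mem h1 h2)
  rw [sameFunctional_iff] at hGχ
  have h0 : proj0 weightNH χ₀ = χ₀ := proj0_eq_self (fun _ => weightNH_eq_zero) hχ₀
  have h1 : proj0 weightNH (P.unshift χ) - (G + vf (ev P.freeChar) χ₀) ∈ divs 𝕜 D c := by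
    have := add_mem hGχ (P.antiparen_sub_free_mem_divs hχ₀)
    convert this using 1
    abel
  -- On functions of Φ and K the free flow is the projection of the full flow, and inherits its
  -- nilpotency.
  have h2 : vf (ev P.freeChar) (vf (ev P.freeChar) χ₀) = 0 := by
    rw [← h0, ← proj0_shiftedFlow, ← proj0_shiftedFlow, shiftedFlow_shiftedFlow, map_zero]
  have h3 : vf (ev P.freeChar) G ∈ divs 𝕜 D c := by
    have h4 := map_mem_divs (vf_ev_tD P.freeChar_hasPar) h1
    have h5 := map_mem_divs (proj0_tD weightNH) hclosed
    rw [proj0_shiftedFlow] at h5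
    rw [map_sub, map_add, h2, add_zero] at h4
    simpa using sub_mem h5 h4
  -- Two integrands of the same functional: the first is killed by the projection, the second is
  -- visibly closed once `h3` is known. Exactness needs both properties.
  have h4 : P.unshift χ - proj0 weightNH (P.unshift χ) - P.interaction χ₀ -
      (P.unshift χ - G - P.shiftedFlow χ₀) ∈ divs 𝕜 D c := by
    have := neg_mem h1
    rw [shiftedFlow_eq_add]
    convert this using 1
    abel
  obtain ⟨g, hg⟩ := P.exists_shiftedFlow_sub_mem_divs
    (f := P.unshift χ - proj0 weightNH (P.unshift χ) - P.interaction χ₀)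
    (by
      rw [map_sub, map_sub, proj0_eq_self (fun _ => weightNH_eq_zero) (hdep _), sub_self,
        proj0_interaction, sub_zero])
    (by
      have h5 := map_mem_divs P.shiftedFlow_tD h4
      rw [map_sub, map_sub _ (P.unshift χ - G), map_sub _ (P.unshift χ) G, shiftedFlow_shiftedFlow,
        sub_zero, shiftedFlow_eq_add _ G, P.interaction_of_isPhi hG, add_zero] at h5
      have := add_mem h5 (sub_mem hclosed h3)
      simpa using this)
  -- χ₀ absorbs the part at N = H = 0, and g the remainder; the shift brings both back to the
  -- original variables and leaves G unchanged.
  refine ⟨G, P.shift (χ₀ + g), hG, ?_⟩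
  have h5 := map_mem_divs P.shift_tD (sub_mem hg h4)
  have h6 : P.shift (P.shiftedFlow (χ₀ + g)) =
      vf (ev (flow P.properAction)) (P.shift (χ₀ + g)) := by
    simp only [shiftedFlow, LinearMap.comp_apply]
    rw [shift_unshift]
  rw [← h6, ← P.shift_unshift χ, ← P.shift_eq_self (hG.mono fun _ => IsPhi.isPhiOrK), ← map_add,
    ← map_sub]
  convert h5 using 2
  rw [map_add]
  abel

end CompositeSector

end ProperFormalism

end

/-! ### The theorem. -/

open ProperFormalism

theorem theorem3 {𝕜 : Type*} [Field 𝕜] [CharZero 𝕜] {D : ℕ} {F I J : Type*} [Fintype F]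
    (c : Content F I) (T : GaugeTheory 𝕜 D c)
    (P : CompositeSector T J) (d : Deg)
    (hcoh : ∀ χ : LocalFun 𝕜 D c,
      DependsOnlyOn IsPhiOrK χ →
      HasDeg d χ →
      SameFunctional (antiparen T.action χ) 0 →
      ∃ G χ' : LocalFun 𝕜 D c,
        DependsOnlyOn IsPhi G ∧
        DependsOnlyOn IsPhiOrK χ' ∧
        SameFunctional χ (G + antiparen T.action χ'))
    (χ : LocalFun 𝕜 D c) (hχ : HasDeg d χ) :
    SameFunctional (sqAntiparen P.properAction χ) 0 ↔
      ∃ ω χ' : LocalFun 𝕜 D c,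
        DependsOnlyOn IsPhi ω ∧
        SameFunctional (sqAntiparen P.properAction ω) 0 ∧
        SameFunctional χ
          (ω + sqAntiparen P.properAction χ') := by
  have hQ : ∀ {f : LocalFun 𝕜 D c}, f ∈ divs 𝕜 D c →
      vf (ev (flow P.properAction)) f ∈ divs 𝕜 D c :=
    fun h => map_mem_divs (vf_ev_tD P.flow_hasPar) h
  have hex : ∀ ω χ' : LocalFun 𝕜 D c, SameFunctional χ (ω + sqAntiparen P.properAction χ') ↔
      χ - (ω + vf (ev (flow P.properAction)) χ') ∈ divs 𝕜 D c := by
    intro ω χ'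
    have h := sqAntiparen_sub_mem_divs P.properAction χ'
    rw [sameFunctional_iff]
    constructor
    · intro h'
      convert add_mem h' h using 1
      abel
    · intro h'
      convert sub_mem h' h using 1
      abel
  simp only [hex, sameFunctional_iff, sub_zero, P.sqAntiparen_mem_divs_iff]
  constructor
  · intro h
    obtain ⟨ω, χ', hω, hχ'⟩ := P.exists_of_closed d hcoh hχ h
    refine ⟨ω, χ', hω, ?_, hχ'⟩
    -- Applying the flow to χ - ω - Qχ' and using Q² = 0 shows that Qχ and Qω differ by a
    -- divergence, so χ is closed exactly when ω is; the converse direction rests on the same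
    -- remark.
    have := hQ hχ'
    rw [map_sub, map_add, P.vf_flow_vf_flow, add_zero] at this
    simpa using sub_mem h this
  · rintro ⟨ω, χ', -, hω, hχ'⟩
    have := hQ hχ'
    rw [map_sub, map_add, P.vf_flow_vf_flow, add_zero] at this
    simpa using add_mem this hω
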